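/- Let $V$ be a real polynomial with $V''\ge c_u>0$ on $\mathbb R$. For sequences $a_k\in\mathbb R$, $b_k>0$ let $T(a,b)$ be the symmetric tridiagonal matrix with diagonal $a_1,a_2,\dots$ and off-diagonal $b_1,b_2,\dots$ (0) There is exactly one pair of bounded real sequences $(a_k)_{k\ge1}$, $(b_k)_{k\ge 1}$ with $b_k>0$ such that for every finite interval of indices $I$ the variables $a_k,b_k$, $k\in I$, minimize the Hamiltonian $\operatorname{tr}V(T)-\sum_k\log b_k$ (of which only finitely many terms depend on them) given the remaining variables. Let $J$ be the semi-infinite Jacobi operator with these entries, as a bounded operator on $\ell^2(\mathbb N)$, and let $\mu$ be its spectral measure at the first coordinate vector $\mathbf e_1$, i.e. the unique probability measure with $\int x^k\,d\mu=\langle \mathbf e_1,J^k\mathbf e_1\rangle$ for all $k\ge0$. Then: (i) For every $\beta\in(0,\infty)$, $\mu$ is the limit of the eigenvalue distribution of $T_n$. Here $T_n=T(A,B)$ is the random $n\times n$ tridiagonal matrix whose entries $(A,B)\in\mathbb R^n\times(0,\infty)^{n-1}$ have the probability density proportional to $$\exp\Big\{-n\beta\Big[\operatorname{tr}V(T(a,b))-\sum_{k=1}^{n-1}\Big(1-\frac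 kn-\frac1{n\beta}\Big)\log b_k\Big]\Big\}$$ (which is integrable), the eigenvalue distribution is $\frac1n\sum_{i=1}^n\delta_{\lambda_i}$ with $\lambda_1,\dots,\lambda_n$ the eigenvalues of $T_n$, and the convergence is weak convergence, almost surely, for every coupling of the matrices $T_n$, $n\ge1$, on one probability space. (ii) $\mu$ is the weak limit of the empirical measures $\frac1n\sum_{i=1}^n\delta_{x_i^{(n)}}$ of Fekete points, i.e. of any maximizers $x^{(n)}\in\mathbb R^n$ of $e^{-n\sum_iV(\lambda_i)}\prod_{i<j}|\lambda_i-\lambda_j|$ (maximizers exist for each $n$). Moreover $\mu$ is the equilibrium measure $\mu_V$, i.e. the unique minimizer of $$\int V\,d\nu+\frac12\iint\log\frac1{|s-t|}\,d\nu(s)\,d\nu(t)$$ over all probability measures $\nu$ on $\mathbb R$. -/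

import Mathlib

open MeasureTheory ProbabilityTheory Filter Topology Polynomial
open scoped ENNReal lp

/-! Tridiagonal matrices. Rows are indexed from `0`: `a i` is the entry `(i, i)` and `b i` is the
entry `(i, i + 1)`. -/

/-- The symmetric tridiagonal `n × n` matrix with diagonal `a` and off-diagonal `b`. -/
def jacobiMatrix (n : ℕ) (a : Fin n → ℝ) (b : Fin (n - 1) → ℝ) : Matrix (Fin n) (Fin n) ℝ :=
  Matrix.of fun i j =>
    if i = j then a i
    else if h : (i : ℕ) + 1 = j then b ⟨i, by omega⟩
    else if h : (j : ℕ) + 1 = i then b ⟨j, by omega⟩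
    else 0

theorem jacobiMatrix_isHermitian (n : ℕ) (a : Fin n → ℝ) (b : Fin (n - 1) → ℝ) :
    (jacobiMatrix n a b).IsHermitian := by
  ext i j
  simp only [jacobiMatrix, Matrix.conjTranspose_apply, Matrix.of_apply, star_trivial]
  by_cases h : i = j
  · subst h; simp
  · have h' : ¬ j = i := fun e => h e.symm
    simp only [h, h', if_false]
    by_cases h1 : (i : ℕ) + 1 = j
    · have h2 : ¬ (j : ℕ) + 1 = i := by omega
      simp [h1, h2]
    · simp [h1]

/-- `tr V(T) - ∑ α_k log b_k`, where `T` is the tridiagonal matrix with entries `a`, `b`. -/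
noncomputable def hamiltonian (V : ℝ[X]) (n : ℕ) (α : Fin (n - 1) → ℝ)
    (a : Fin n → ℝ) (b : Fin (n - 1) → ℝ) : ℝ :=
  (aeval (jacobiMatrix n a b) V).trace - ∑ k, α k * Real.log (b k)

/-! The random matrix `T_n`. -/

/-- The Hamiltonian of the beta ensemble, with logarithmic coefficients
`1 - k / n - 1 / (n β)` for `k = 1, …, n - 1`. -/
noncomputable def betaHamiltonian (V : ℝ[X]) (β : ℝ) (n : ℕ)
    (a : Fin n → ℝ) (b : Fin (n - 1) → ℝ) : ℝ :=
  hamiltonian V n (fun k => 1 - ((k : ℝ) + 1) / n - 1 / (n * β)) a b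

/-- The measure on `(a, b) ∈ ℝⁿ × (0, ∞)ⁿ⁻¹` with density `exp (- n β H(a, b))`. -/
noncomputable def unnormalizedTridiagonalLaw (V : ℝ[X]) (β : ℝ) (n : ℕ) :
    Measure ((Fin n → ℝ) × (Fin (n - 1) → ℝ)) :=
  (volume.restrict {p | ∀ k, 0 < p.2 k}).withDensity
    fun p => ENNReal.ofReal (Real.exp (-(n * β * betaHamiltonian V β n p.1 p.2)))

/-- The joint law of the diagonal and the off-diagonal of `T_n`. -/
noncomputable def tridiagonalLaw (V : ℝ[X]) (β : ℝ) (n : ℕ) :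
    Measure ((Fin n → ℝ) × (Fin (n - 1) → ℝ)) :=
  (unnormalizedTridiagonalLaw V β n Set.univ)⁻¹ • unnormalizedTridiagonalLaw V β n

/-- The empirical distribution `(1 / n) ∑ δ_{x_i}` of `n ≥ 1` points. -/
noncomputable def empiricalDistribution {n : ℕ} [NeZero n] (x : Fin n → ℝ) :
    ProbabilityMeasure ℝ :=
  ⟨(n : ℝ≥0∞)⁻¹ • ∑ i, Measure.dirac (x i), ⟨by
    simp [ENNReal.inv_mul_cancel (Nat.cast_ne_zero.mpr (NeZero.ne n)) (ENNReal.natCast_ne_top n)]⟩⟩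

/-- The eigenvalue distribution of a tridiagonal matrix: each of the `n` eigenvalues, counted with
multiplicity, has mass `1 / n`. -/
noncomputable def eigenvalueDistribution (n : ℕ) [NeZero n] (a : Fin n → ℝ)
    (b : Fin (n - 1) → ℝ) : ProbabilityMeasure ℝ :=
  empiricalDistribution (jacobiMatrix_isHermitian n a b).eigenvalues

/-! The limiting semi-infinite Jacobi operator. -/

/-- `(a, b)` is a bounded sequence with `b > 0` which, for every finite interval of indices
`{l, …, r}`, minimizes `tr V(T) - ∑ log b_k` over the variables with indices in the interval, the
other variables being held fixed. The variables in the interval meet only finitely many terms of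
this formal expression, and all of them are present in the `N × N` truncation as soon as
`N ≥ r + deg V`. -/
structure IsHalfLineMinimizer (V : ℝ[X]) (a b : ℕ → ℝ) : Prop where
  pos : ∀ k, 0 < b k
  bounded : ∃ C : ℝ, ∀ k, |a k| ≤ C ∧ b k ≤ C
  minimizes : ∀ l r N : ℕ, l ≤ r → r + V.natDegree ≤ N →
    ∀ a' b' : ℕ → ℝ, (∀ k, k ∉ Finset.Icc l r → a' k = a k ∧ b' k = b k) → (∀ k, 0 < b' k) →
      hamiltonian V N 1 (fun k => a k) (fun k => b k) ≤
        hamiltonian V N 1 (fun k => a' k) (fun k => b' k)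

/-- The bounded operator `J` on `ℓ²(ℕ)` is given by the semi-infinite symmetric tridiagonal matrix
with diagonal `a` and off-diagonal `b`. -/
def IsJacobiOperator (a b : ℕ → ℝ) (J : ℓ²(ℕ, ℝ) →L[ℝ] ℓ²(ℕ, ℝ)) : Prop :=
  ∀ f : ℓ²(ℕ, ℝ), J f 0 = a 0 * f 0 + b 0 * f 1 ∧
    ∀ k : ℕ, J f (k + 1) = b k * f k + a (k + 1) * f (k + 1) + b (k + 1) * f (k + 2)

/-- The first coordinate vector. -/
noncomputable def firstVector : ℓ²(ℕ, ℝ) := lp.single 2 0 (1 : ℝ)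

/-- `μ` is the spectral measure of `J` at the first coordinate vector: its `k`-th moment is
`⟨e, J ^ k e⟩`. -/
def IsSpectralMeasure (J : ℓ²(ℕ, ℝ) →L[ℝ] ℓ²(ℕ, ℝ)) (μ : ProbabilityMeasure ℝ) : Prop :=
  ∀ k : ℕ, Integrable (fun x : ℝ => x ^ k) (μ : Measure ℝ) ∧
    ∫ x, x ^ k ∂(μ : Measure ℝ) = inner ℝ firstVector ((J ^ k) firstVector)

/-! Fekete points and the equilibrium measure. -/

/-- `exp (- n ∑ V(x_i)) ∏_{i < j} |x_i - x_j|`. -/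
noncomputable def feketeDensity (V : ℝ[X]) {n : ℕ} (x : Fin n → ℝ) : ℝ :=
  Real.exp (-(n * ∑ i, V.eval (x i))) * ∏ i, ∏ j ∈ Finset.Ioi i, |x i - x j|

/-- `x` is a configuration of `n` Fekete points. -/
def IsFekete (V : ℝ[X]) {n : ℕ} (x : Fin n → ℝ) : Prop :=
  ∀ y : Fin n → ℝ, feketeDensity V y ≤ feketeDensity V x

/-- The energy `∫ V dν + (1 / 2) ∬ log (1 / |s - t|) dν(s) dν(t)` is finite. As
`log (1 / 0) = +∞`, the diagonal has to be a null set. -/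
structure HasFiniteEnergy (V : ℝ[X]) (ν : ProbabilityMeasure ℝ) : Prop where
  diagonal : ((ν : Measure ℝ).prod (ν : Measure ℝ)) {p | p.1 = p.2} = 0
  integrable_potential : Integrable (fun s => V.eval s) (ν : Measure ℝ)
  integrable_log : Integrable (fun p : ℝ × ℝ => Real.log (1 / |p.1 - p.2|))
    ((ν : Measure ℝ).prod (ν : Measure ℝ))

/-- The value of the energy `∫ V dν + (1 / 2) ∬ log (1 / |s - t|) dν(s) dν(t)` where it is
finite. -/
noncomputable def energy (V : ℝ[X]) (ν : ProbabilityMeasure ℝ) : ℝ :=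
  ∫ s, V.eval s ∂(ν : Measure ℝ) +
    1 / 2 * ∫ p : ℝ × ℝ, Real.log (1 / |p.1 - p.2|) ∂((ν : Measure ℝ).prod (ν : Measure ℝ))

/-- `ν` minimizes the energy over all probability measures on `ℝ`. (For a convex potential
of even degree, the energy of a measure for which it is not finite is `+∞`.) -/
def IsEquilibriumMeasure (V : ℝ[X]) (ν : ProbabilityMeasure ℝ) : Prop :=
  HasFiniteEnergy V ν ∧ ∀ ν' : ProbabilityMeasure ℝ, HasFiniteEnergy V ν' →
    energy V ν ≤ energy V ν'

/-! ## Functional calculus of symmetric matrices -/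

section Matrices

variable {n : Type*} [Fintype n] [DecidableEq n]

theorem conj_diagonal_pow {O : Matrix n n ℝ} (h : O.transpose * O = 1) (x : n → ℝ) (k : ℕ)
    (h' : O * O.transpose = 1) :
    (O * Matrix.diagonal x * O.transpose) ^ k =
      O * Matrix.diagonal (fun i => x i ^ k) * O.transpose := by
  induction k with
  | zero => simp [h']
  | succ k ih =>
    rw [pow_succ, ih]
    calc O * Matrix.diagonal (fun i => x i ^ k) * O.transpose *
          (O * Matrix.diagonal x * O.transpose)
        = O * Matrix.diagonal (fun i => x i ^ k) * (O.transpose * O) *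
          Matrix.diagonal x * O.transpose := by simp only [Matrix.mul_assoc]
      _ = _ := by
        rw [h, Matrix.mul_one, Matrix.mul_assoc O, Matrix.diagonal_mul_diagonal]
        simp only [pow_succ]

theorem aeval_conj_diagonal {O : Matrix n n ℝ} (h : O.transpose * O = 1)
    (x : n → ℝ) (V : ℝ[X]) :
    aeval (O * Matrix.diagonal x * O.transpose) V =
      O * Matrix.diagonal (fun i => V.eval (x i)) * O.transpose := by
  have h' : O * O.transpose = 1 := mul_eq_one_comm.mp h
  induction V using Polynomial.induction_on' with
  | add p q hp hq =>
    rw [map_add, hp, hq, ← Matrix.add_mul, ← Matrix.mul_add, Matrix.diagonal_add]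
    simp only [eval_add]
  | monomial k r =>
    rw [aeval_monomial, conj_diagonal_pow h x k h', ← Algebra.smul_def, ← Matrix.smul_mul,
      ← Matrix.mul_smul, ← Matrix.diagonal_smul]
    congr 3
    ext i
    simp

theorem trace_aeval_conj_diagonal {O : Matrix n n ℝ} (h : O.transpose * O = 1)
    (x : n → ℝ) (V : ℝ[X]) :
    (aeval (O * Matrix.diagonal x * O.transpose) V).trace = ∑ i, V.eval (x i) := by
  rw [aeval_conj_diagonal h, Matrix.trace_mul_comm, ← Matrix.mul_assoc, h, Matrix.one_mul,
    Matrix.trace_diagonal]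

theorem Matrix.IsHermitian.exists_eq_conj_diagonal {A : Matrix n n ℝ} (hA : A.IsHermitian) :
    ∃ O : Matrix n n ℝ, O.transpose * O = 1 ∧
      A = O * Matrix.diagonal hA.eigenvalues * O.transpose := by
  refine ⟨hA.eigenvectorUnitary, ?_, ?_⟩
  · exact Unitary.coe_star_mul_self hA.eigenvectorUnitary
  · have := hA.spectral_theorem
    rw [Unitary.conjStarAlgAut_apply] at this
    exact this

theorem trace_conj_diagonal_mul (U W : Matrix n n ℝ) (f g : n → ℝ) :
    (U * Matrix.diagonal f * U.transpose * (W * Matrix.diagonal g * W.transpose)).trace =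
      ∑ i, ∑ j, (U.transpose * W) i j ^ 2 * (f i * g j) := by
  have : (U * Matrix.diagonal f * U.transpose * (W * Matrix.diagonal g * W.transpose)).trace =
      (Matrix.diagonal f * (U.transpose * W) *
        (Matrix.diagonal g * (U.transpose * W).transpose)).trace := by
    rw [Matrix.transpose_mul, Matrix.transpose_transpose]
    simp only [Matrix.mul_assoc]
    rw [Matrix.trace_mul_comm]
    simp only [Matrix.mul_assoc]
  rw [this, Matrix.trace]
  refine Finset.sum_congr rfl fun i _ => ?_
  rw [Matrix.diag_apply, Matrix.mul_apply]
  refine Finset.sum_congr rfl fun j _ => ?_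
  rw [Matrix.diagonal_mul, Matrix.diagonal_mul, Matrix.transpose_apply]
  ring

end Matrices

theorem Polynomial.tangent_add_sq_le {V : ℝ[X]} {c : ℝ}
    (hV : ∀ x : ℝ, c ≤ V.derivative.derivative.eval x) (s t : ℝ) :
    V.eval t + V.derivative.eval t * (s - t) + c / 2 * (s - t) ^ 2 ≤ V.eval s := by
  set g : ℝ[X] := V - Polynomial.C (c / 2) * Polynomial.X ^ 2 with hg
  have hg' : ∀ x, g.derivative.eval x = V.derivative.eval x - c * x := by
    intro x; simp [hg]; ring
  have hmono : Monotone fun x => g.derivative.eval x := by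
    refine monotone_of_deriv_nonneg g.derivative.differentiable fun x => ?_
    rw [Polynomial.deriv]
    have := hV x
    simp [hg]
    linarith
  have key : g.eval t + g.derivative.eval t * (s - t) ≤ g.eval s := by
    rcases lt_trichotomy s t with h | h | h
    · obtain ⟨ξ, hξ, e⟩ := exists_deriv_eq_slope (fun x => g.eval x) h
        g.continuous.continuousOn g.differentiable.differentiableOn
      rw [Polynomial.deriv, eq_div_iff (by linarith)] at e
      have := hmono hξ.2.le
      simp only at this
      nlinarith
    · subst h; simp
    · obtain ⟨ξ, hξ, e⟩ := exists_deriv_eq_slope (fun x => g.eval x) h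
        g.continuous.continuousOn g.differentiable.differentiableOn
      rw [Polynomial.deriv, eq_div_iff (by linarith)] at e
      have := hmono hξ.1.le
      simp only at this
      nlinarith
  rw [hg'] at key
  simp [hg] at key
  nlinarith

section Klein

variable {n : Type*} [Fintype n] [DecidableEq n]

/-- Klein's inequality for a uniformly convex polynomial. -/
theorem trace_aeval_tangent_le {V : ℝ[X]} {c : ℝ}
    (hV : ∀ x : ℝ, c ≤ V.derivative.derivative.eval x) {S T : Matrix n n ℝ}
    (hS : S.IsHermitian) (hT : T.IsHermitian) :
    (aeval T V).trace + (aeval T V.derivative * (S - T)).trace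
      + c / 2 * ((S - T) * (S - T)).trace ≤ (aeval S V).trace := by
  obtain ⟨W, hW, eS⟩ := hS.exists_eq_conj_diagonal
  obtain ⟨U, hU, eT⟩ := hT.exists_eq_conj_diagonal
  set s := hS.eigenvalues
  set t := hT.eigenvalues
  have hW' : W * W.transpose = 1 := mul_eq_one_comm.mp hW
  have hU' : U * U.transpose = 1 := mul_eq_one_comm.mp hU
  have one_left : ∀ g : n → ℝ, (W * Matrix.diagonal g * W.transpose).trace =
      ∑ i, ∑ j, (U.transpose * W) i j ^ 2 * (1 * g j) := fun g => by
    rw [← trace_conj_diagonal_mul U W (fun _ => 1) g]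
    simp [hU']
  have one_right : ∀ f : n → ℝ, (U * Matrix.diagonal f * U.transpose).trace =
      ∑ i, ∑ j, (U.transpose * W) i j ^ 2 * (f i * 1) := fun f => by
    rw [← trace_conj_diagonal_mul U W f (fun _ => 1)]
    simp [hW']
  have sq : ∀ O : Matrix n n ℝ, O.transpose * O = 1 → ∀ f g : n → ℝ,
      O * Matrix.diagonal f * O.transpose * (O * Matrix.diagonal g * O.transpose) =
        O * Matrix.diagonal (fun i => f i * g i) * O.transpose := fun O hO f g => by
    calc O * Matrix.diagonal f * O.transpose * (O * Matrix.diagonal g * O.transpose)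
        = O * Matrix.diagonal f * (O.transpose * O) * Matrix.diagonal g * O.transpose := by
          simp only [Matrix.mul_assoc]
      _ = _ := by
          rw [hO, Matrix.mul_one, Matrix.mul_assoc O, Matrix.diagonal_mul_diagonal]
  have e1 : (aeval T V).trace = ∑ i, ∑ j, (U.transpose * W) i j ^ 2 * (V.eval (t i) * 1) := by
    rw [eT, aeval_conj_diagonal hU, one_right]
  have e2 : (aeval S V).trace = ∑ i, ∑ j, (U.transpose * W) i j ^ 2 * (1 * V.eval (s j)) := by
    rw [eS, aeval_conj_diagonal hW, one_left]
  have e3 : (aeval T V.derivative * (S - T)).trace =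
      ∑ i, ∑ j, (U.transpose * W) i j ^ 2 * (V.derivative.eval (t i) * s j) -
      ∑ i, ∑ j, (U.transpose * W) i j ^ 2 * (V.derivative.eval (t i) * t i * 1) := by
    rw [Matrix.mul_sub, Matrix.trace_sub, eT, aeval_conj_diagonal hU, sq U hU, one_right, eS,
      trace_conj_diagonal_mul]
  have e4 : ((S - T) * (S - T)).trace =
      ∑ i, ∑ j, (U.transpose * W) i j ^ 2 * (1 * (s j * s j)) -
      2 * ∑ i, ∑ j, (U.transpose * W) i j ^ 2 * (t i * s j) +
      ∑ i, ∑ j, (U.transpose * W) i j ^ 2 * (t i * t i * 1) := by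
    have : ((S - T) * (S - T)).trace = (S * S).trace - 2 * (T * S).trace + (T * T).trace := by
      rw [Matrix.mul_sub, Matrix.sub_mul, Matrix.sub_mul, Matrix.trace_sub, Matrix.trace_sub,
        Matrix.trace_sub, Matrix.trace_mul_comm S T]
      ring
    rw [this, ← one_left fun j => s j * s j, ← one_right fun i => t i * t i,
      ← trace_conj_diagonal_mul, ← sq W hW, ← sq U hU, ← eS, ← eT]
  rw [e1, e2, e3, e4]
  simp only [mul_sub, mul_add, Finset.mul_sum, ← Finset.sum_add_distrib, ← Finset.sum_sub_distrib]
  refine Finset.sum_le_sum fun i _ => Finset.sum_le_sum fun j _ => ?_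
  have := mul_le_mul_of_nonneg_left (Polynomial.tangent_add_sq_le hV (s j) (t i))
    (sq_nonneg ((U.transpose * W) i j))
  nlinarith

end Klein

/-! ## Tridiagonal matrices with entries from sequences -/

/-- The leading `n × n` block of the semi-infinite tridiagonal matrix with diagonal `a` and
off-diagonal `b`. -/
def jacobiBlock (n : ℕ) (a b : ℕ → ℝ) : Matrix (Fin n) (Fin n) ℝ :=
  jacobiMatrix n (fun k => a k) (fun k => b k)

theorem jacobiBlock_isHermitian (n : ℕ) (a b : ℕ → ℝ) : (jacobiBlock n a b).IsHermitian :=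
  jacobiMatrix_isHermitian _ _ _

theorem jacobiBlock_apply (n : ℕ) (a b : ℕ → ℝ) (i j : Fin n) :
    jacobiBlock n a b i j = if (i : ℕ) = j then a i else
      if (i : ℕ) + 1 = j then b i else if (j : ℕ) + 1 = i then b j else 0 := by
  simp only [jacobiBlock, jacobiMatrix, Matrix.of_apply, Fin.ext_iff, dite_eq_ite]

theorem jacobiBlock_add (n : ℕ) (a b a' b' : ℕ → ℝ) :
    jacobiBlock n (a + a') (b + b') = jacobiBlock n a b + jacobiBlock n a' b' := by
  ext i j
  simp only [Matrix.add_apply, jacobiBlock_apply, Pi.add_apply]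
  split_ifs <;> simp

theorem jacobiBlock_smul (n : ℕ) (r : ℝ) (a b : ℕ → ℝ) :
    jacobiBlock n (r • a) (r • b) = r • jacobiBlock n a b := by
  ext i j
  simp only [Matrix.smul_apply, jacobiBlock_apply, Pi.smul_apply]
  split_ifs <;> simp

theorem jacobiBlock_sub (n : ℕ) (a b a' b' : ℕ → ℝ) :
    jacobiBlock n (a - a') (b - b') = jacobiBlock n a b - jacobiBlock n a' b' := by
  ext i j
  simp only [Matrix.sub_apply, jacobiBlock_apply, Pi.sub_apply]
  split_ifs <;> simp

/-- The entries of a finite matrix, extended by zero. -/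
def Matrix.entry {n : ℕ} (M : Matrix (Fin n) (Fin n) ℝ) (i j : ℕ) : ℝ :=
  if h : i < n ∧ j < n then M ⟨i, h.1⟩ ⟨j, h.2⟩ else 0

theorem Matrix.entry_coe {n : ℕ} (M : Matrix (Fin n) (Fin n) ℝ) (i j : Fin n) :
    M.entry i j = M i j := by
  simp [Matrix.entry, i.2, j.2]

theorem sum_mul_jacobiBlock (n : ℕ) (a b : ℕ → ℝ) (f : ℕ → ℝ) (hf : ∀ i, n ≤ i → f i = 0)
    (j : Fin n) :
    ∑ i : Fin n, f i * jacobiBlock n a b i j =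
      f j * a j + f (j + 1) * b j + (if (j : ℕ) = 0 then 0 else f (j - 1) * b (j - 1)) := by
  have h : ∀ i : Fin n, f i * jacobiBlock n a b i j =
      (if (i : ℕ) = j then f j * a j else 0) + (if (i : ℕ) = j + 1 then f (j + 1) * b j else 0) +
      (if (i : ℕ) + 1 = j then f (j - 1) * b (j - 1) else 0) := fun i => by
    rw [jacobiBlock_apply]
    by_cases h1 : (i : ℕ) = j
    · simp [h1]
    by_cases h2 : (i : ℕ) + 1 = j
    · have h3 : (i : ℕ) = j - 1 := by omega
      have h4 : ¬ (i : ℕ) = j + 1 := by omega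
      simp [h1, h2, h4, ← h3]
    by_cases h3 : (j : ℕ) + 1 = i
    · simp [h1, h2, h3]
    · have h4 : ¬ (i : ℕ) = j + 1 := by omega
      simp [h1, h2, h3, h4]
  rw [Finset.sum_congr rfl fun i _ => h i]
  simp only [Finset.sum_add_distrib]
  rw [Fin.sum_univ_eq_sum_range (fun i => if i = (j : ℕ) then f j * a j else 0),
    Fin.sum_univ_eq_sum_range (fun i => if i = (j : ℕ) + 1 then f (j + 1) * b j else 0),
    Fin.sum_univ_eq_sum_range (fun i => if i + 1 = (j : ℕ) then f (j - 1) * b (j - 1) else 0),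
    Finset.sum_ite_eq', Finset.sum_ite_eq']
  congr 1
  · congr 1
    · simp [j.2]
    · split_ifs with h
      · rfl
      · rw [hf _ (by simpa using h), zero_mul]
  · split_ifs with h
    · simp [h]
    · rw [Finset.sum_eq_single ((j : ℕ) - 1)]
      · rw [if_pos (by omega)]
      · intro k _ hk
        rw [if_neg (by omega)]
      · intro hk
        exact absurd (Finset.mem_range.mpr (by omega)) hk

theorem trace_mul_jacobiBlock {n : ℕ} (M : Matrix (Fin n) (Fin n) ℝ)
    (hM : M.transpose = M) (a b : ℕ → ℝ) :
    (M * jacobiBlock n a b).trace =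
      ∑ k ∈ Finset.range n, (M.entry k k * a k + 2 * M.entry k (k + 1) * b k) := by
  have hsymm : ∀ i j, M.entry i j = M.entry j i := fun i j => by
    unfold Matrix.entry
    by_cases h : i < n ∧ j < n
    · rw [dif_pos h, dif_pos h.symm]
      exact congrFun (congrFun hM.symm _) _
    · rw [dif_neg h, dif_neg fun h' => h h'.symm]
  have h1 : (M * jacobiBlock n a b).trace = ∑ k ∈ Finset.range n,
      (M.entry k k * a k + M.entry k (k + 1) * b k +
        (if k = 0 then 0 else M.entry k (k - 1) * b (k - 1))) := by
    rw [Matrix.trace, ← Fin.sum_univ_eq_sum_range (fun k => M.entry k k * a k +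
      M.entry k (k + 1) * b k + (if k = 0 then 0 else M.entry k (k - 1) * b (k - 1)))]
    refine Finset.sum_congr rfl fun k _ => ?_
    rw [Matrix.diag_apply, Matrix.mul_apply, ← sum_mul_jacobiBlock n a b (M.entry k)
      (fun i hi => by simp [Matrix.entry, not_lt.mpr hi]) k]
    simp only [Matrix.entry_coe]
  rw [h1, Finset.sum_add_distrib, Finset.sum_add_distrib]
  have h2 : ∑ k ∈ Finset.range n, (if k = 0 then 0 else M.entry k (k - 1) * b (k - 1)) =
      ∑ k ∈ Finset.range n, M.entry k (k + 1) * b k := by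
    cases n with
    | zero => simp
    | succ m =>
      rw [Finset.sum_range_succ', Finset.sum_range_succ]
      have : M.entry m (m + 1) = 0 := by simp [Matrix.entry]
      simp only [this, zero_mul, add_zero, if_true, Nat.succ_ne_zero, if_false,
        Nat.add_sub_cancel]
      exact Finset.sum_congr rfl fun k _ => by rw [hsymm]
  rw [h2, Finset.sum_add_distrib, add_assoc, ← Finset.sum_add_distrib]
  congr 1
  exact Finset.sum_congr rfl fun k _ => by ring

theorem aeval_transpose {n : ℕ} {T : Matrix (Fin n) (Fin n) ℝ} (hT : T.transpose = T)
    (V : ℝ[X]) : (aeval T V).transpose = aeval T V := by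
  induction V using Polynomial.induction_on' with
  | add p q hp hq => rw [map_add, Matrix.transpose_add, hp, hq]
  | monomial k r =>
    rw [aeval_monomial, ← Algebra.smul_def, Matrix.transpose_smul, Matrix.transpose_pow, hT]

theorem jacobiBlock_transpose (n : ℕ) (a b : ℕ → ℝ) :
    (jacobiBlock n a b).transpose = jacobiBlock n a b := by
  have := jacobiBlock_isHermitian n a b
  rwa [Matrix.IsHermitian, Matrix.conjTranspose_eq_transpose_of_trivial] at this

theorem trace_jacobiBlock_mul_self (n : ℕ) (a b : ℕ → ℝ) :
    (jacobiBlock n a b * jacobiBlock n a b).trace =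
      ∑ k ∈ Finset.range n, (a k ^ 2 + 2 * if k + 1 < n then b k ^ 2 else 0) := by
  rw [trace_mul_jacobiBlock _ (jacobiBlock_transpose n a b)]
  refine Finset.sum_congr rfl fun k hk => ?_
  have hk := Finset.mem_range.mp hk
  by_cases h : k + 1 < n
  · simp [Matrix.entry, jacobiBlock_apply, hk, h]; ring
  · simp [Matrix.entry, jacobiBlock_apply, hk, h]; ring

theorem jacobiBlock_pow_eq_zero {n : ℕ} (a b : ℕ → ℝ) (k : ℕ) (i j : Fin n)
    (h : (j : ℕ) + k < i) : (jacobiBlock n a b ^ k) i j = 0 := by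
  induction k generalizing i with
  | zero =>
    have : i ≠ j := fun e => by simp [e] at h
    simp [this]
  | succ k ih =>
    rw [pow_succ', Matrix.mul_apply]
    refine Finset.sum_eq_zero fun l _ => ?_
    by_cases hl : (j : ℕ) + k < l
    · rw [ih l hl, mul_zero]
    · rw [jacobiBlock_apply, if_neg (by omega), if_neg (by omega), if_neg (by omega), zero_mul]

theorem jacobiBlock_pow_diag {n : ℕ} [NeZero n] (a b : ℕ → ℝ) (j : ℕ) (hj : j < n) :
    (jacobiBlock n a b ^ j) ⟨j, hj⟩ 0 = ∏ k ∈ Finset.range j, b k := by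
  induction j with
  | zero =>
    have : (⟨0, hj⟩ : Fin n) = 0 := rfl
    simp [this]
  | succ j ih =>
    rw [pow_succ', Matrix.mul_apply, Finset.sum_eq_single ⟨j, by omega⟩,
      ih (by omega), Finset.prod_range_succ, jacobiBlock_apply, if_neg (by simp),
      if_neg (by simp; omega), if_pos rfl, mul_comm]
    · intro l _ hl
      have hl' : (l : ℕ) ≠ j := fun e => hl (Fin.ext e)
      by_cases h : j < l
      · rw [jacobiBlock_pow_eq_zero _ _ _ _ _ (by simpa using h), mul_zero]
      · rw [jacobiBlock_apply, if_neg (by simp; omega), if_neg (by simp; omega),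
          if_neg (by simp; omega), zero_mul]
    · simp

/-- The product of the off-diagonal entries, with multiplicities, in terms of the eigenvalues and
of the first components of the eigenvectors. -/
theorem prod_offDiagonal_eq {n : ℕ} [NeZero n] {a b : ℕ → ℝ} {O : Matrix (Fin n) (Fin n) ℝ}
    (hO : O.transpose * O = 1) {x : Fin n → ℝ}
    (h : jacobiBlock n a b = O * Matrix.diagonal x * O.transpose) :
    |∏ j ∈ Finset.range n, ∏ k ∈ Finset.range j, b k| =
      (∏ i, |O 0 i|) * ∏ i, ∏ j ∈ Finset.Ioi i, |x i - x j| := by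
  have hO' : O * O.transpose = 1 := mul_eq_one_comm.mp hO
  let K : Matrix (Fin n) (Fin n) ℝ := Matrix.of fun i j => (jacobiBlock n a b ^ (j : ℕ)) i 0
  have h1 : K.det = ∏ j ∈ Finset.range n, ∏ k ∈ Finset.range j, b k := by
    rw [Matrix.det_of_isUpperTriangular, ← Fin.prod_univ_eq_prod_range]
    · exact Finset.prod_congr rfl fun j _ => jacobiBlock_pow_diag a b j j.2
    · intro i j hij
      exact jacobiBlock_pow_eq_zero a b j i 0 (by simpa using hij)
  have h2 : K = O * (Matrix.diagonal (O 0) * Matrix.vandermonde x) := by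
    ext i j
    have : K i j = (jacobiBlock n a b ^ (j : ℕ)) i 0 := rfl
    rw [this, h, conj_diagonal_pow hO x j hO', Matrix.mul_apply, Matrix.mul_apply]
    refine Finset.sum_congr rfl fun l _ => ?_
    rw [Matrix.mul_diagonal, Matrix.diagonal_mul, Matrix.transpose_apply,
      Matrix.vandermonde_apply]
    ring
  have h3 : |O.det| = 1 := by
    have := congrArg Matrix.det hO
    rw [Matrix.det_mul, Matrix.det_transpose, Matrix.det_one] at this
    rcases mul_self_eq_one_iff.mp this with h | h <;> simp [h]
  rw [← h1, h2, Matrix.det_mul, Matrix.det_mul, Matrix.det_diagonal, Matrix.det_vandermonde,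
    abs_mul, h3, one_mul, abs_mul, Finset.abs_prod, Finset.abs_prod]
  congr 1
  refine Finset.prod_congr rfl fun i _ => ?_
  rw [Finset.abs_prod]
  exact Finset.prod_congr rfl fun j _ => abs_sub_comm _ _

/-! ## Orthonormal polynomials of a linear functional -/

theorem Polynomial.degree_C_mul_le (r : ℝ) (p : ℝ[X]) : (C r * p).degree ≤ p.degree := by
  rw [← smul_eq_C_mul]
  exact degree_smul_le r p

section Lanczos

variable (L : ℝ[X] →ₗ[ℝ] ℝ)

/-- The state `(p_{k-1}, p_k, b_{k-1})` of the three-term recursion producing the orthonormal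
polynomials of `L`. -/
noncomputable def lanczos : ℕ → ℝ[X] × ℝ[X] × ℝ
  | 0 => (0, 1, 0)
  | k + 1 =>
    let s := lanczos k
    let r := X * s.2.1 - C (L (X * s.2.1 * s.2.1)) * s.2.1 - C s.2.2 * s.1
    (s.2.1, C (√(L (r * r)))⁻¹ * r, √(L (r * r)))

/-- The `k`-th orthonormal polynomial of `L`. -/
noncomputable def orthoPoly (k : ℕ) : ℝ[X] := (lanczos L k).2.1

/-- The diagonal Jacobi coefficients of `L`. -/
noncomputable def jacobiDiag (k : ℕ) : ℝ := L (X * orthoPoly L k * orthoPoly L k)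

/-- The off-diagonal Jacobi coefficients of `L`. -/
noncomputable def jacobiOff (k : ℕ) : ℝ := (lanczos L (k + 1)).2.2

/-- The unnormalized `k + 1`-st orthogonal polynomial. -/
noncomputable def lanczosResidual (k : ℕ) : ℝ[X] :=
  X * orthoPoly L k - C (jacobiDiag L k) * orthoPoly L k - C (lanczos L k).2.2 * (lanczos L k).1

theorem orthoPoly_zero : orthoPoly L 0 = 1 := rfl

theorem jacobiOff_eq (k : ℕ) :
    jacobiOff L k = √(L (lanczosResidual L k * lanczosResidual L k)) := rfl

theorem orthoPoly_succ (k : ℕ) :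
    orthoPoly L (k + 1) = C (jacobiOff L k)⁻¹ * lanczosResidual L k := rfl

theorem lanczosResidual_zero :
    lanczosResidual L 0 = X * orthoPoly L 0 - C (jacobiDiag L 0) * orthoPoly L 0 := by
  simp [lanczosResidual, lanczos]

theorem lanczosResidual_succ (k : ℕ) :
    lanczosResidual L (k + 1) = X * orthoPoly L (k + 1) -
      C (jacobiDiag L (k + 1)) * orthoPoly L (k + 1) - C (jacobiOff L k) * orthoPoly L k := rfl

theorem X_mul_orthoPoly_zero (h : 0 < jacobiOff L 0) :
    X * orthoPoly L 0 = C (jacobiDiag L 0) * orthoPoly L 0 + C (jacobiOff L 0) * orthoPoly L 1 := by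
  rw [orthoPoly_succ, ← mul_assoc, ← C_mul, mul_inv_cancel₀ h.ne', lanczosResidual_zero]
  simp

theorem X_mul_orthoPoly_succ {k : ℕ} (h : 0 < jacobiOff L (k + 1)) :
    X * orthoPoly L (k + 1) = C (jacobiOff L k) * orthoPoly L k +
      C (jacobiDiag L (k + 1)) * orthoPoly L (k + 1) +
      C (jacobiOff L (k + 1)) * orthoPoly L (k + 2) := by
  rw [orthoPoly_succ L (k + 1), ← mul_assoc (C (jacobiOff L (k + 1))), ← C_mul,
    mul_inv_cancel₀ h.ne', lanczosResidual_succ, C_1]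
  ring

theorem LinearMap.map_C_mul (r : ℝ) (p : ℝ[X]) : L (C r * p) = r * L p := by
  rw [← smul_eq_C_mul, L.map_smul, smul_eq_mul]

variable {L} {N : ℕ}

theorem orthoPoly_aux (h1 : L 1 = 1) (hpos : ∀ p : ℝ[X], p ≠ 0 → p.natDegree < N → 0 < L (p * p))
    (k : ℕ) (hk : k < N) :
    ((orthoPoly L k).natDegree = k ∧ 0 < (orthoPoly L k).leadingCoeff) ∧
      (∀ i ≤ k, L (orthoPoly L i * orthoPoly L k) = if i = k then 1 else 0) ∧
      ∀ i < k, 0 < jacobiOff L i := by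
  induction k using Nat.strong_induction_on with
  | _ k ih =>
  cases k with
  | zero => simp [orthoPoly_zero, h1]
  | succ k =>
    obtain ⟨⟨hd, hl⟩, ho, hb⟩ := ih k (by omega) (by omega)
    have hp0 : orthoPoly L k ≠ 0 := fun e => by simp [e] at hl
    have hXd : (X * orthoPoly L k).natDegree = k + 1 := by
      rw [natDegree_X_mul hp0, hd]
    have hXl : (X * orthoPoly L k).leadingCoeff = (orthoPoly L k).leadingCoeff := by
      rw [leadingCoeff_mul, leadingCoeff_X, one_mul]
    have hXdeg : (X * orthoPoly L k).degree = ((k + 1 : ℕ) : WithBot ℕ) := by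
      rw [degree_eq_natDegree (mul_ne_zero X_ne_zero hp0), hXd]
    -- the residual has the leading term of `X * p_k`
    obtain ⟨s, hs, hsd⟩ : ∃ s : ℝ[X], lanczosResidual L k = X * orthoPoly L k - s ∧
        s.degree < (X * orthoPoly L k).degree := by
      have hdk : (C (jacobiDiag L k) * orthoPoly L k).degree < ((k + 1 : ℕ) : WithBot ℕ) := by
        refine (Polynomial.degree_C_mul_le _ _).trans_lt ?_
        rw [degree_eq_natDegree hp0, hd]
        exact_mod_cast Nat.lt_succ_self k
      cases k with
      | zero => exact ⟨_, lanczosResidual_zero L, hXdeg ▸ hdk⟩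
      | succ k =>
        obtain ⟨⟨hd', hl'⟩, -, -⟩ := ih k (by omega) (by omega)
        have hp0' : orthoPoly L k ≠ 0 := fun e => by simp [e] at hl'
        refine ⟨C (jacobiDiag L (k + 1)) * orthoPoly L (k + 1) +
          C (jacobiOff L k) * orthoPoly L k, ?_, ?_⟩
        · rw [lanczosResidual_succ]; ring
        · rw [hXdeg]
          refine (degree_add_le _ _).trans_lt (max_lt hdk ?_)
          refine (Polynomial.degree_C_mul_le _ _).trans_lt ?_
          rw [degree_eq_natDegree hp0', hd']
          exact_mod_cast (by omega : k < k + 1 + 1)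
    have hrl : (lanczosResidual L k).leadingCoeff = (orthoPoly L k).leadingCoeff := by
      rw [hs, leadingCoeff_sub_of_degree_lt hsd, hXl]
    have hrd : (lanczosResidual L k).natDegree = k + 1 := by
      rw [hs, ← hXd]
      exact natDegree_eq_of_degree_eq (degree_sub_eq_left_of_degree_lt hsd)
    have hr0 : lanczosResidual L k ≠ 0 := fun e => by
      rw [e, leadingCoeff_zero] at hrl; exact hl.ne hrl
    have hrr := hpos _ hr0 (by omega)
    have hbk : 0 < jacobiOff L k := by rw [jacobiOff_eq]; exact Real.sqrt_pos.mpr hrr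
    have hbsq : jacobiOff L k ^ 2 = L (lanczosResidual L k * lanczosResidual L k) := by
      rw [jacobiOff_eq]; exact Real.sq_sqrt hrr.le
    have hbinv : (jacobiOff L k)⁻¹ ≠ 0 := inv_ne_zero hbk.ne'
    have hbs : ∀ i < k + 1, 0 < jacobiOff L i := fun i hi => by
      rcases Nat.lt_succ_iff_lt_or_eq.mp hi with h | h
      · exact hb i h
      · exact h ▸ hbk
    -- orthogonality relations of lower order
    have hoo : ∀ i j, i ≤ k → j ≤ k →
        L (orthoPoly L i * orthoPoly L j) = if i = j then 1 else 0 := by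
      intro i j hi hj
      rcases le_total i j with h | h
      · exact (ih j (by omega) (by omega)).2.1 i h
      · rw [mul_comm, (ih i (by omega) (by omega)).2.1 j h]
        simp only [eq_comm]
    have hor : ∀ i ≤ k, L (orthoPoly L i * lanczosResidual L k) = 0 := by
      intro i hi
      rcases Nat.lt_or_eq_of_le hi with hi' | rfl
      · cases k with
        | zero => omega
        | succ k =>
          have e1 : orthoPoly L i * lanczosResidual L (k + 1) =
              X * orthoPoly L i * orthoPoly L (k + 1) -
              C (jacobiDiag L (k + 1)) * (orthoPoly L i * orthoPoly L (k + 1)) -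
              C (jacobiOff L k) * (orthoPoly L i * orthoPoly L k) := by
            rw [lanczosResidual_succ]; ring
          have e2 : L (X * orthoPoly L i * orthoPoly L (k + 1)) =
              jacobiOff L i * if i = k then 1 else 0 := by
            cases i with
            | zero =>
              rw [X_mul_orthoPoly_zero L (hbs 0 (by omega)), add_mul, mul_assoc, mul_assoc,
                map_add, L.map_C_mul, L.map_C_mul, hoo _ _ (by omega) le_rfl,
                hoo _ _ (by omega) le_rfl, if_neg (by omega), mul_zero, zero_add]
              simp [eq_comm]
            | succ i =>
              rw [X_mul_orthoPoly_succ L (hbs (i + 1) (by omega)), add_mul, add_mul, mul_assoc,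
                mul_assoc, mul_assoc,
                map_add, map_add, L.map_C_mul, L.map_C_mul, L.map_C_mul, hoo _ _ (by omega) le_rfl,
                hoo _ _ (by omega) le_rfl, hoo _ _ (by omega) le_rfl, if_neg (by omega),
                if_neg (by omega), mul_zero, mul_zero, zero_add, zero_add]
              simp
          rw [e1, map_sub, map_sub, e2, L.map_C_mul, L.map_C_mul, hoo _ _ hi le_rfl,
            hoo _ _ (by omega) (by omega), if_neg (c := i = k + 1) (by omega)]
          by_cases h : i = k
          · rw [if_pos h, h]; ring
          · rw [if_neg h]; ring
      · cases i with
        | zero =>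
          have e1 : orthoPoly L 0 * lanczosResidual L 0 = X * orthoPoly L 0 * orthoPoly L 0 -
              C (jacobiDiag L 0) * (orthoPoly L 0 * orthoPoly L 0) := by
            rw [lanczosResidual_zero]; ring
          rw [e1, map_sub, L.map_C_mul, hoo 0 0 le_rfl le_rfl, jacobiDiag]
          simp
        | succ i =>
          have e1 : orthoPoly L (i + 1) * lanczosResidual L (i + 1) =
              X * orthoPoly L (i + 1) * orthoPoly L (i + 1) -
              C (jacobiDiag L (i + 1)) * (orthoPoly L (i + 1) * orthoPoly L (i + 1)) -
              C (jacobiOff L i) * (orthoPoly L i * orthoPoly L (i + 1)) := by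
            rw [lanczosResidual_succ]; ring
          rw [e1, map_sub, map_sub, L.map_C_mul, L.map_C_mul, hoo _ _ le_rfl le_rfl,
            hoo _ _ (by omega) le_rfl, jacobiDiag]
          simp
    refine ⟨⟨?_, ?_⟩, ?_, hbs⟩
    · rw [orthoPoly_succ, natDegree_C_mul hbinv, hrd]
    · rw [orthoPoly_succ, leadingCoeff_mul, leadingCoeff_C, hrl]
      positivity
    · intro i hi
      rcases Nat.lt_or_eq_of_le hi with hi' | rfl
      · rw [orthoPoly_succ, mul_left_comm, L.map_C_mul, hor i (by omega), if_neg (by omega),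
          mul_zero]
      · rw [if_pos rfl, orthoPoly_succ]
        have : C (jacobiOff L k)⁻¹ * lanczosResidual L k * (C (jacobiOff L k)⁻¹ *
            lanczosResidual L k) = C (jacobiOff L k)⁻¹ * (C (jacobiOff L k)⁻¹ *
            (lanczosResidual L k * lanczosResidual L k)) := by ring
        rw [this, L.map_C_mul, L.map_C_mul, ← hbsq]
        field_simp

theorem orthoPoly_orthonormal (h1 : L 1 = 1)
    (hpos : ∀ p : ℝ[X], p ≠ 0 → p.natDegree < N → 0 < L (p * p)) {i j : ℕ}
    (hi : i < N) (hj : j < N) :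
    L (orthoPoly L i * orthoPoly L j) = if i = j then 1 else 0 := by
  rcases le_total i j with h | h
  · exact (orthoPoly_aux h1 hpos j hj).2.1 i h
  · rw [mul_comm, (orthoPoly_aux h1 hpos i hi).2.1 j h]
    simp only [eq_comm]

theorem jacobiOff_pos (h1 : L 1 = 1)
    (hpos : ∀ p : ℝ[X], p ≠ 0 → p.natDegree < N → 0 < L (p * p)) {k : ℕ} (hk : k + 1 < N) :
    0 < jacobiOff L k :=
  (orthoPoly_aux h1 hpos (k + 1) hk).2.2 k (Nat.lt_succ_self k)

theorem map_X_mul_orthoPoly_of_lt (h1 : L 1 = 1)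
    (hpos : ∀ p : ℝ[X], p ≠ 0 → p.natDegree < N → 0 < L (p * p)) {i j : ℕ}
    (hij : i < j) (hj : j < N) :
    L (X * orthoPoly L i * orthoPoly L j) = if i + 1 = j then jacobiOff L i else 0 := by
  have ho := fun {i j : ℕ} => orthoPoly_orthonormal (i := i) (j := j) h1 hpos
  cases i with
  | zero =>
    rw [X_mul_orthoPoly_zero L (jacobiOff_pos h1 hpos (by omega)), add_mul, mul_assoc, mul_assoc,
      map_add, L.map_C_mul, L.map_C_mul, ho (by omega) hj, ho (by omega) hj, if_neg (by omega)]
    simp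
  | succ i =>
    rw [X_mul_orthoPoly_succ L (jacobiOff_pos h1 hpos (by omega)), add_mul, add_mul, mul_assoc,
      mul_assoc, mul_assoc, map_add, map_add, L.map_C_mul, L.map_C_mul, L.map_C_mul,
      ho (by omega) hj, ho (by omega) hj, ho (by omega) hj, if_neg (by omega), if_neg (by omega)]
    simp

theorem map_X_mul_orthoPoly (h1 : L 1 = 1)
    (hpos : ∀ p : ℝ[X], p ≠ 0 → p.natDegree < N → 0 < L (p * p)) (i j : Fin N) :
    L (X * orthoPoly L i * orthoPoly L j) =
      jacobiBlock N (jacobiDiag L) (jacobiOff L) i j := by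
  rw [jacobiBlock_apply]
  rcases lt_trichotomy (i : ℕ) j with h | h | h
  · rw [map_X_mul_orthoPoly_of_lt h1 hpos h j.2, if_neg h.ne, if_neg (c := (j : ℕ) + 1 = i) (by omega)]
  · rw [if_pos h, ← h, jacobiDiag]
  · rw [mul_right_comm, map_X_mul_orthoPoly_of_lt h1 hpos h i.2, if_neg h.ne',
      if_neg (c := (i : ℕ) + 1 = j) (by omega)]

end Lanczos

theorem sum_sq_pos_of_natDegree_lt {n : ℕ} {x : Fin n → ℝ} (hx : Function.Injective x) {p : ℝ[X]}
    (hp : p ≠ 0) (hd : p.natDegree < n) : 0 < ∑ i, p.eval (x i) * p.eval (x i) := by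
  refine lt_of_le_of_ne (Finset.sum_nonneg fun i _ => mul_self_nonneg _) fun h => hp ?_
  have h0 : ∀ i, p.eval (x i) = 0 := fun i => by
    have := (Finset.sum_eq_zero_iff_of_nonneg (fun i _ => mul_self_nonneg _)).mp h.symm i
      (Finset.mem_univ i)
    exact mul_self_eq_zero.mp this
  refine Polynomial.eq_zero_of_natDegree_lt_card_of_eval_eq_zero p hx h0 ?_
  simpa using hd

/-- Every set of `n` distinct points is the spectrum of a Jacobi matrix whose spectral measure at
the first coordinate vector is uniform. -/
theorem exists_jacobiBlock_of_injective {n : ℕ} [NeZero n] {x : Fin n → ℝ}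
    (hx : Function.Injective x) :
    ∃ (a b : ℕ → ℝ) (O : Matrix (Fin n) (Fin n) ℝ), (∀ k, k + 1 < n → 0 < b k) ∧
      O.transpose * O = 1 ∧ jacobiBlock n a b = O * Matrix.diagonal x * O.transpose ∧
      ∀ i, O 0 i = (√n)⁻¹ := by
  have hn : (0 : ℝ) < n := Nat.cast_pos.mpr (NeZero.pos n)
  let L : ℝ[X] →ₗ[ℝ] ℝ := (n : ℝ)⁻¹ • ∑ i, Polynomial.leval (x i)
  have hL : ∀ p : ℝ[X], L p = (n : ℝ)⁻¹ * ∑ i, p.eval (x i) := fun p => by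
    simp [L, LinearMap.smul_apply, LinearMap.sum_apply, Polynomial.leval_apply]
  have h1 : L 1 = 1 := by
    rw [hL]; simp [hn.ne']
  have hpos : ∀ p : ℝ[X], p ≠ 0 → p.natDegree < n → 0 < L (p * p) := fun p hp hd => by
    rw [hL]
    simp only [eval_mul]
    exact mul_pos (inv_pos.mpr hn) (sum_sq_pos_of_natDegree_lt hx hp hd)
  let O : Matrix (Fin n) (Fin n) ℝ := Matrix.of fun k i => (√n)⁻¹ * (orthoPoly L k).eval (x i)
  have hs : (√n)⁻¹ * (√n)⁻¹ = (n : ℝ)⁻¹ := by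
    rw [← mul_inv, Real.mul_self_sqrt hn.le]
  have hO : O * O.transpose = 1 := by
    ext k l
    have := orthoPoly_orthonormal h1 hpos k.2 l.2
    rw [hL] at this
    simp only [eval_mul] at this
    rw [Matrix.mul_apply, Matrix.one_apply]
    simp only [Matrix.transpose_apply, O, Matrix.of_apply, Fin.ext_iff]
    rw [← this, Finset.mul_sum]
    refine Finset.sum_congr rfl fun i _ => ?_
    rw [← hs]; ring
  refine ⟨jacobiDiag L, jacobiOff L, O, fun k hk => jacobiOff_pos h1 hpos hk,
    mul_eq_one_comm.mp hO, ?_, fun i => ?_⟩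
  · ext k l
    rw [← map_X_mul_orthoPoly h1 hpos, hL, Matrix.mul_apply, Finset.mul_sum]
    refine Finset.sum_congr rfl fun i _ => ?_
    rw [Matrix.mul_diagonal, Matrix.transpose_apply]
    simp only [O, Matrix.of_apply, eval_mul, eval_X]
    rw [← hs]; ring
  · simp [O, orthoPoly_zero]

/-! ## Minimizers on the half-line -/

theorem two_le_natDegree_of_deriv_pos {V : ℝ[X]} {c : ℝ} (hc : 0 < c)
    (hV : ∀ x : ℝ, c ≤ V.derivative.derivative.eval x) : 2 ≤ V.natDegree := by
  by_contra h
  have h1 : V.derivative.derivative = 0 := by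
    have := Polynomial.iterate_derivative_eq_zero (p := V) (x := 2) (by omega)
    simpa using this
  have := hV 0
  rw [h1] at this
  simp at this
  linarith

theorem hamiltonian_one_eq (V : ℝ[X]) (N : ℕ) (a b : ℕ → ℝ) :
    hamiltonian V N 1 (fun k => a k) (fun k => b k) =
      (aeval (jacobiBlock N a b) V).trace - ∑ k ∈ Finset.range (N - 1), Real.log (b k) := by
  rw [hamiltonian, jacobiBlock, ← Fin.sum_univ_eq_sum_range (fun k => Real.log (b k))]
  simp

/-- The Euler–Lagrange equations of the Hamiltonian `tr V(T) - ∑ log b_k` on the half-line. -/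
def IsHalfLineCritical (V : ℝ[X]) (a b : ℕ → ℝ) : Prop :=
  ∀ k N : ℕ, k + V.natDegree ≤ N →
    (aeval (jacobiBlock N a b) V.derivative).entry k k = 0 ∧
      2 * (aeval (jacobiBlock N a b) V.derivative).entry k (k + 1) = (b k)⁻¹

theorem eq_zero_of_mul_nonneg {h : ℝ → ℝ} (hc : ContinuousAt h 0)
    (hh : ∀ᶠ t in 𝓝 (0 : ℝ), 0 ≤ t * h t) : h 0 = 0 := by
  apply le_antisymm
  · refine le_of_tendsto (hc.tendsto.mono_left (nhdsWithin_le_nhds (s := Set.Iio 0))) ?_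
    filter_upwards [hh.filter_mono nhdsWithin_le_nhds, self_mem_nhdsWithin] with t ht ht'
    exact nonpos_of_mul_nonneg_right ht ht'
  · refine ge_of_tendsto (hc.tendsto.mono_left (nhdsWithin_le_nhds (s := Set.Ioi 0))) ?_
    filter_upwards [hh.filter_mono nhdsWithin_le_nhds, self_mem_nhdsWithin] with t ht ht'
    exact nonneg_of_mul_nonneg_right ht ht'

section HalfLine

variable {V : ℝ[X]} {c : ℝ}

theorem trace_jacobiBlock_mul_self_nonneg (n : ℕ) (a b : ℕ → ℝ) :
    0 ≤ (jacobiBlock n a b * jacobiBlock n a b).trace := by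
  rw [trace_jacobiBlock_mul_self]
  refine Finset.sum_nonneg fun k _ => ?_
  split_ifs <;> positivity

theorem trace_aeval_jacobiBlock_tangent (hV : ∀ x : ℝ, c ≤ V.derivative.derivative.eval x)
    (n : ℕ) (a b a' b' : ℕ → ℝ) :
    (aeval (jacobiBlock n a b) V).trace +
      (aeval (jacobiBlock n a b) V.derivative * jacobiBlock n (a' - a) (b' - b)).trace +
      c / 2 * (jacobiBlock n (a' - a) (b' - b) * jacobiBlock n (a' - a) (b' - b)).trace ≤
      (aeval (jacobiBlock n a' b') V).trace := by
  rw [jacobiBlock_sub]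
  exact trace_aeval_tangent_le hV (jacobiBlock_isHermitian _ _ _) (jacobiBlock_isHermitian _ _ _)

/-- Restricted to a line, the trace of `V(T)` lies below its tangents taken at the far end. -/
theorem trace_aeval_sub_le (hc : 0 ≤ c) (hV : ∀ x : ℝ, c ≤ V.derivative.derivative.eval x)
    (n : ℕ) (a b u w : ℕ → ℝ) (t : ℝ) :
    (aeval (jacobiBlock n (a + t • u) (b + t • w)) V).trace - (aeval (jacobiBlock n a b) V).trace ≤
      t * (aeval (jacobiBlock n (a + t • u) (b + t • w)) V.derivative *
        jacobiBlock n u w).trace := by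
  have h := trace_aeval_jacobiBlock_tangent hV n (a + t • u) (b + t • w) a b
  have e1 : a - (a + t • u) = (-t) • u := by rw [neg_smul]; abel
  have e2 : b - (b + t • w) = (-t) • w := by rw [neg_smul]; abel
  have h2 := trace_jacobiBlock_mul_self_nonneg n ((-t) • u) ((-t) • w)
  rw [e1, e2] at h
  have e3 : (aeval (jacobiBlock n (a + t • u) (b + t • w)) V.derivative *
      jacobiBlock n ((-t) • u) ((-t) • w)).trace = -t * (aeval (jacobiBlock n (a + t • u)
        (b + t • w)) V.derivative * jacobiBlock n u w).trace := by
    rw [jacobiBlock_smul, Matrix.mul_smul, Matrix.trace_smul, smul_eq_mul]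
  rw [e3] at h
  have := mul_nonneg (div_nonneg hc two_pos.le) h2
  linarith

theorem continuous_trace_aeval (n : ℕ) (a b u w : ℕ → ℝ) (p : ℝ[X]) :
    Continuous fun t : ℝ =>
      (aeval (jacobiBlock n (a + t • u) (b + t • w)) p * jacobiBlock n u w).trace := by
  have h1 : Continuous fun t : ℝ => jacobiBlock n (a + t • u) (b + t • w) := by
    simp only [jacobiBlock_add, jacobiBlock_smul]
    fun_prop
  have h2 : Continuous fun t : ℝ => aeval (jacobiBlock n (a + t • u) (b + t • w)) p :=
    p.continuous_aeval.comp h1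
  exact (h2.matrix_mul continuous_const).matrix_trace

theorem IsHalfLineMinimizer.isHalfLineCritical (hc : 0 < c)
    (hV : ∀ x : ℝ, c ≤ V.derivative.derivative.eval x) {a b : ℕ → ℝ}
    (h : IsHalfLineMinimizer V a b) : IsHalfLineCritical V a b := by
  intro k N hN
  have hd := two_le_natDegree_of_deriv_pos hc hV
  have htr := fun a' b' : ℕ → ℝ =>
    trace_mul_jacobiBlock _ (aeval_transpose (jacobiBlock_transpose N a b) V.derivative) a' b'
  constructor
  · have key := eq_zero_of_mul_nonneg
      (continuous_trace_aeval N a b (Pi.single k 1) 0 V.derivative).continuousAt ?_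
    · simp only [zero_smul, add_zero] at key
      rw [htr, Finset.sum_eq_single k] at key
      · simpa using key
      · intro j _ hj
        simp [hj]
      · intro hk
        exact absurd (Finset.mem_range.mpr (by omega)) hk
    · refine Eventually.of_forall fun t => ?_
      refine le_trans ?_ (trace_aeval_sub_le hc.le hV N a b _ _ t)
      have := h.minimizes k k N le_rfl hN (a + t • Pi.single k 1) (b + t • 0) (fun j hj => by
        have : j ≠ k := by simpa using hj
        simp [this]) (by simpa using h.pos)
      rw [hamiltonian_one_eq, hamiltonian_one_eq] at this
      simp only [smul_zero, add_zero] at this ⊢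
      linarith
  · have hb := h.pos k
    have key := eq_zero_of_mul_nonneg (h := fun t => (aeval (jacobiBlock N (a + t • 0)
      (b + t • Pi.single k 1)) V.derivative * jacobiBlock N 0 (Pi.single k 1)).trace -
        (b k + t)⁻¹) ?_ ?_
    · simp only [zero_smul, add_zero] at key
      rw [htr, Finset.sum_eq_single k] at key
      · simp at key
        linarith
      · intro j _ hj
        simp [hj]
      · intro hk
        exact absurd (Finset.mem_range.mpr (by omega)) hk
    · refine (continuous_trace_aeval N a b 0 (Pi.single k 1) V.derivative).continuousAt.sub ?_
      exact ContinuousAt.inv₀ (by fun_prop) (by simpa using hb.ne')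
    · filter_upwards [Ioi_mem_nhds (neg_lt_zero.mpr hb)] with t ht
      have ht' : 0 < b k + t := by have : -b k < t := ht; linarith
      have h1 := trace_aeval_sub_le hc.le hV N a b 0 (Pi.single k 1) t
      have h2 := h.minimizes k k N le_rfl hN (a + t • 0) (b + t • Pi.single k 1) (fun j hj => by
        have : j ≠ k := by simpa using hj
        simp [this]) (fun j => by
          by_cases hj : j = k
          · subst hj; simpa using ht'
          · simpa [hj] using h.pos j)
      rw [hamiltonian_one_eq, hamiltonian_one_eq] at h2
      have h3 : ∑ j ∈ Finset.range (N - 1), Real.log ((b + t • Pi.single k 1 : ℕ → ℝ) j) -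
          ∑ j ∈ Finset.range (N - 1), Real.log (b j) = Real.log (b k + t) - Real.log (b k) := by
        rw [← Finset.sum_sub_distrib, Finset.sum_eq_single k]
        · simp
        · intro j _ hj
          simp [hj]
        · intro hk
          exact absurd (Finset.mem_range.mpr (by omega)) hk
      have h4 : t * (b k + t)⁻¹ ≤ Real.log (b k + t) - Real.log (b k) := by
        have := Real.log_le_sub_one_of_pos (div_pos hb ht')
        rw [Real.log_div hb.ne' ht'.ne'] at this
        have e : b k / (b k + t) - 1 = -(t * (b k + t)⁻¹) := by field_simp; ring
        linarith
      rw [mul_sub]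
      linarith

theorem IsHalfLineCritical.isHalfLineMinimizer (hc : 0 < c)
    (hV : ∀ x : ℝ, c ≤ V.derivative.derivative.eval x) {a b : ℕ → ℝ}
    (h : IsHalfLineCritical V a b) (hpos : ∀ k, 0 < b k)
    (hbdd : ∃ C : ℝ, ∀ k, |a k| ≤ C ∧ b k ≤ C) : IsHalfLineMinimizer V a b := by
  refine ⟨hpos, hbdd, fun l r N hlr hN a' b' hab hb' => ?_⟩
  have hd := two_le_natDegree_of_deriv_pos hc hV
  rw [hamiltonian_one_eq, hamiltonian_one_eq]
  have h1 := trace_aeval_jacobiBlock_tangent hV N a b a' b'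
  have h2 := mul_nonneg (div_nonneg hc.le two_pos.le)
    (trace_jacobiBlock_mul_self_nonneg N (a' - a) (b' - b))
  rw [trace_mul_jacobiBlock _ (aeval_transpose (jacobiBlock_transpose N a b) V.derivative)] at h1
  have h3 : ∑ k ∈ Finset.range N, ((aeval (jacobiBlock N a b) V.derivative).entry k k *
      (a' - a) k + 2 * (aeval (jacobiBlock N a b) V.derivative).entry k (k + 1) * (b' - b) k) =
      ∑ k ∈ Finset.range (N - 1), (b k)⁻¹ * (b' k - b k) := by
    have : ∀ k, (aeval (jacobiBlock N a b) V.derivative).entry k k * (a' - a) k +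
        2 * (aeval (jacobiBlock N a b) V.derivative).entry k (k + 1) * (b' - b) k =
        (b k)⁻¹ * (b' k - b k) := fun k => by
      by_cases hk : k ∈ Finset.Icc l r
      · have hk' := (Finset.mem_Icc.mp hk).2
        obtain ⟨e1, e2⟩ := h k N (by omega)
        rw [e1, e2, zero_mul, zero_add, Pi.sub_apply]
      · obtain ⟨e1, e2⟩ := hab k hk
        simp [e1, e2]
    rw [Finset.sum_congr rfl fun k _ => this k]
    obtain ⟨m, rfl⟩ : ∃ m, N = m + 1 := ⟨N - 1, by omega⟩
    rw [Finset.sum_range_succ, Nat.add_sub_cancel]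
    have : b' m = b m := (hab m (fun hm => by have := (Finset.mem_Icc.mp hm).2; omega)).2
    rw [this, sub_self, mul_zero, add_zero]
  have h4 : ∑ k ∈ Finset.range (N - 1), Real.log (b' k) -
      ∑ k ∈ Finset.range (N - 1), Real.log (b k) ≤
      ∑ k ∈ Finset.range (N - 1), (b k)⁻¹ * (b' k - b k) := by
    rw [← Finset.sum_sub_distrib]
    refine Finset.sum_le_sum fun k _ => ?_
    have := Real.log_le_sub_one_of_pos (div_pos (hb' k) (hpos k))
    rw [Real.log_div (hb' k).ne' (hpos k).ne'] at this
    have e : b' k / b k - 1 = (b k)⁻¹ * (b' k - b k) := by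
      have := (hpos k).ne'
      field_simp
    linarith
  rw [h3] at h1
  linarith

theorem abs_jacobiBlock_pow_le {C : ℝ} {a b : ℕ → ℝ} (ha : ∀ k, |a k| ≤ C) (hb : ∀ k, |b k| ≤ C)
    (n m : ℕ) (i j : Fin n) : |(jacobiBlock n a b ^ m) i j| ≤ (3 * C) ^ m := by
  have hC : 0 ≤ C := (abs_nonneg _).trans (ha 0)
  induction m generalizing j with
  | zero =>
    rw [pow_zero, pow_zero, Matrix.one_apply]
    split_ifs <;> simp
  | succ m ih =>
    rw [pow_succ, Matrix.mul_apply]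
    have habs : ∀ l, |jacobiBlock n a b l j| = jacobiBlock n (fun k => |a k|) (fun k => |b k|) l j :=
      fun l => by
        rw [jacobiBlock_apply, jacobiBlock_apply]
        split_ifs <;> simp
    have hrow : ∑ l, |jacobiBlock n a b l j| ≤ 3 * C := by
      have := sum_mul_jacobiBlock n (fun k => |a k|) (fun k => |b k|)
        (fun k => if k < n then 1 else 0) (fun k hk => by simp [hk]) j
      simp only [Fin.is_lt, if_true, one_mul] at this
      rw [Finset.sum_congr rfl fun l _ => habs l, this]
      have h1 := ha j
      have h2 : (if (j : ℕ) + 1 < n then (1 : ℝ) else 0) * |b j| ≤ C := by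
        split_ifs
        · simpa using hb j
        · simpa using hC
      have h3 : (if (j : ℕ) = 0 then 0 else (if (j : ℕ) - 1 < n then (1 : ℝ) else 0) *
          |b (j - 1)|) ≤ C := by
        split_ifs
        · exact hC
        · simpa using hb _
        · simpa using hC
      linarith
    calc |∑ l, (jacobiBlock n a b ^ m) i l * jacobiBlock n a b l j|
        ≤ ∑ l, |(jacobiBlock n a b ^ m) i l * jacobiBlock n a b l j| :=
          Finset.abs_sum_le_sum_abs _ _
      _ ≤ ∑ l, (3 * C) ^ m * |jacobiBlock n a b l j| := by
          refine Finset.sum_le_sum fun l _ => ?_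
          rw [abs_mul]
          exact mul_le_mul_of_nonneg_right (ih l) (abs_nonneg _)
      _ ≤ (3 * C) ^ m * (3 * C) := by
          rw [← Finset.mul_sum]
          exact mul_le_mul_of_nonneg_left hrow (by positivity)
      _ = (3 * C) ^ (m + 1) := (pow_succ _ _).symm

theorem exists_abs_entry_aeval_le {C : ℝ} (hC : 0 ≤ C) (p : ℝ[X]) :
    ∃ K : ℝ, 0 ≤ K ∧ ∀ a b : ℕ → ℝ, (∀ k, |a k| ≤ C) → (∀ k, |b k| ≤ C) →
      ∀ n i j, |(aeval (jacobiBlock n a b) p).entry i j| ≤ K := by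
  have hK : 0 ≤ ∑ m ∈ Finset.range (p.natDegree + 1), |p.coeff m| * (3 * C) ^ m :=
    Finset.sum_nonneg fun m _ => by positivity
  refine ⟨_, hK, fun a b ha hb n i j => ?_⟩
  unfold Matrix.entry
  split_ifs with h
  · rw [aeval_eq_sum_range, Matrix.sum_apply]
    refine (Finset.abs_sum_le_sum_abs _ _).trans (Finset.sum_le_sum fun m _ => ?_)
    rw [Matrix.smul_apply, smul_eq_mul, abs_mul]
    exact mul_le_mul_of_nonneg_left (abs_jacobiBlock_pow_le ha hb _ _ _ _) (abs_nonneg _)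
  · simpa using hK

/-- A nonnegative bounded sequence whose partial sums are controlled by its next few terms
vanishes. -/
theorem eq_zero_of_sum_range_le {g : ℕ → ℝ} (hg : ∀ k, 0 ≤ g k) {B c K : ℝ} (hB : ∀ k, g k ≤ B)
    (hc : 0 < c) (hK : 0 ≤ K) (d : ℕ)
    (h : ∀ M, c * ∑ k ∈ Finset.range M, g k ≤ K * ∑ i ∈ Finset.range d, √(g (M + i))) (j : ℕ) :
    g j = 0 := by
  have hs : Summable g := by
    refine summable_of_sum_range_le (c := c⁻¹ * (K * ∑ i ∈ Finset.range d, √B)) hg fun M => ?_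
    rw [le_inv_mul_iff₀ hc]
    refine (h M).trans (mul_le_mul_of_nonneg_left (Finset.sum_le_sum fun i _ => ?_) hK)
    exact Real.sqrt_le_sqrt (hB _)
  have h0 : Tendsto (fun M => K * ∑ i ∈ Finset.range d, √(g (M + i))) atTop (𝓝 0) := by
    have : Tendsto (fun M => K * ∑ i ∈ Finset.range d, √(g (M + i))) atTop
        (𝓝 (K * ∑ i ∈ Finset.range d, √0)) := by
      refine Tendsto.const_mul _ (tendsto_finsetSum _ fun i _ => ?_)
      exact (Real.continuous_sqrt.tendsto 0).comp
        (hs.tendsto_atTop_zero.comp (tendsto_add_atTop_nat i))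
    simpa using this
  have h1 : c * g j ≤ 0 := by
    refine ge_of_tendsto h0 ?_
    filter_upwards [eventually_gt_atTop j] with M hM
    refine le_trans ?_ (h M)
    exact mul_le_mul_of_nonneg_left
      (Finset.single_le_sum (fun k _ => hg k) (Finset.mem_range.mpr hM)) hc.le
  exact le_antisymm (nonpos_of_mul_nonpos_right h1 hc) (hg j)

theorem IsHalfLineMinimizer.unique (hc : 0 < c)
    (hV : ∀ x : ℝ, c ≤ V.derivative.derivative.eval x) {a b a' b' : ℕ → ℝ}
    (h : IsHalfLineMinimizer V a b) (h' : IsHalfLineMinimizer V a' b') : a = a' ∧ b = b' := by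
  obtain ⟨C, hC⟩ := h.bounded
  obtain ⟨C', hC'⟩ := h'.bounded
  obtain ⟨K, hK0, hK⟩ := exists_abs_entry_aeval_le ((abs_nonneg _).trans (hC 0).1) V.derivative
  replace hK := hK a b (fun k => (hC k).1) fun k => (abs_of_pos (h.pos k)).trans_le (hC k).2
  obtain ⟨K', hK0', hK'⟩ := exists_abs_entry_aeval_le ((abs_nonneg _).trans (hC' 0).1) V.derivative
  replace hK' := hK' a' b' (fun k => (hC' k).1) fun k => (abs_of_pos (h'.pos k)).trans_le (hC' k).2
  have hcr := h.isHalfLineCritical hc hV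
  have hcr' := h'.isHalfLineCritical hc hV
  have hd := two_le_natDegree_of_deriv_pos hc hV
  set g : ℕ → ℝ := fun k => (a k - a' k) ^ 2 + (b k - b' k) ^ 2 with hg
  have hg0 : ∀ k, 0 ≤ g k := fun k => by positivity
  have key : ∀ j, g j = 0 := by
    refine eq_zero_of_sum_range_le hg0 (B := (C + C') ^ 2 + (C + C') ^ 2)
      (K := 3 * (K + K')) ?_ hc (by positivity) V.natDegree ?_
    · intro k
      have h1 : |a k - a' k| ≤ C + C' := (abs_sub _ _).trans (add_le_add (hC k).1 (hC' k).1)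
      have h2 : |b k - b' k| ≤ C + C' := by
        have := h.pos k; have := h'.pos k; have := (hC k).2; have := (hC' k).2
        rw [abs_le]; constructor <;> linarith
      exact add_le_add (sq_le_sq' (abs_le.mp h1).1 (abs_le.mp h1).2)
        (sq_le_sq' (abs_le.mp h2).1 (abs_le.mp h2).2)
    intro M
    set N := M + V.natDegree with hN
    have t1 := trace_aeval_jacobiBlock_tangent hV N a b a' b'
    have t2 := trace_aeval_jacobiBlock_tangent hV N a' b' a b
    have e1 : a' - a = (-1 : ℝ) • (a - a') := by simp
    have e2 : b' - b = (-1 : ℝ) • (b - b') := by simp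
    rw [e1, e2, jacobiBlock_smul, Matrix.mul_smul, Matrix.mul_smul, Matrix.smul_mul, smul_smul,
      Matrix.trace_smul, neg_mul_neg, one_mul, one_smul] at t1
    rw [trace_jacobiBlock_mul_self, trace_mul_jacobiBlock _
      (aeval_transpose (jacobiBlock_transpose N _ _) V.derivative)] at t1 t2
    have t3 : ∑ k ∈ Finset.range M, g k ≤ ∑ k ∈ Finset.range N, ((a - a') k ^ 2 +
        2 * if k + 1 < N then (b - b') k ^ 2 else 0) := by
      refine (Finset.sum_le_sum fun k hk => ?_).trans (Finset.sum_le_sum_of_subset_of_nonneg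
        (Finset.range_mono (by omega : M ≤ N)) fun k _ _ => ?_)
      · have := Finset.mem_range.mp hk
        rw [if_pos (by omega), hg]
        simp only [Pi.sub_apply]
        nlinarith [sq_nonneg (b k - b' k)]
      · split_ifs <;> positivity
    set E := aeval (jacobiBlock N a b) V.derivative
    set E' := aeval (jacobiBlock N a' b') V.derivative
    have t4 : ∑ k ∈ Finset.range N, (E.entry k k * (a - a') k +
          2 * E.entry k (k + 1) * (b - b') k) - ∑ k ∈ Finset.range N, (E'.entry k k * (a - a') k +
          2 * E'.entry k (k + 1) * (b - b') k) ≤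
        3 * (K + K') * ∑ i ∈ Finset.range V.natDegree, √(g (M + i)) := by
      rw [← Finset.sum_sub_distrib, Finset.sum_range_add, Finset.mul_sum]
      have s1 : ∑ k ∈ Finset.range M, (E.entry k k * (a - a') k +
          2 * E.entry k (k + 1) * (b - b') k - (E'.entry k k * (a - a') k +
          2 * E'.entry k (k + 1) * (b - b') k)) ≤ 0 := by
        refine Finset.sum_nonpos fun k hk => ?_
        have hk := Finset.mem_range.mp hk
        obtain ⟨p1, p2⟩ := hcr k N (by omega)
        obtain ⟨p1', p2'⟩ := hcr' k N (by omega)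
        rw [p1, p2, p1', p2', Pi.sub_apply]
        have e : 0 * (a k - a' k) + (b k)⁻¹ * (b - b') k - (0 * (a k - a' k) +
            (b' k)⁻¹ * (b - b') k) = -((b k - b' k) ^ 2 / (b k * b' k)) := by
          have := (h.pos k).ne'; have := (h'.pos k).ne'
          rw [Pi.sub_apply]
          field_simp
          ring
        rw [e]
        have := h.pos k; have := h'.pos k
        exact neg_nonpos.mpr (by positivity)
      refine (add_le_add s1 (Finset.sum_le_sum fun i _ => ?_)).trans (zero_add _).le
      · generalize M + i = k
        have r1 : |a k - a' k| ≤ √(g k) := Real.abs_le_sqrt (by rw [hg]; nlinarith [sq_nonneg (b k - b' k)])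
        have r2 : |b k - b' k| ≤ √(g k) := Real.abs_le_sqrt (by rw [hg]; nlinarith [sq_nonneg (a k - a' k)])
        have q : ∀ i j, |E.entry i j - E'.entry i j| ≤ K + K' := fun i j =>
          (abs_sub _ _).trans (add_le_add (hK N i j) (hK' N i j))
        have q1 := mul_le_mul (q k k) r1 (abs_nonneg _) (by positivity)
        have q2 := mul_le_mul (q k (k + 1)) r2 (abs_nonneg _) (by positivity)
        rw [← abs_mul] at q1 q2
        have := le_abs_self ((E.entry k k - E'.entry k k) * (a k - a' k))
        have := le_abs_self ((E.entry k (k + 1) - E'.entry k (k + 1)) * (b k - b' k))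
        simp only [Pi.sub_apply]
        nlinarith
    have t5 := mul_le_mul_of_nonneg_left t3 hc.le
    rw [smul_eq_mul, neg_one_mul] at t1
    linarith
  have : ∀ k, a k = a' k ∧ b k = b' k := fun k => by
    have := key k
    simp only [hg] at this
    constructor <;> nlinarith [sq_nonneg (a k - a' k), sq_nonneg (b k - b' k)]
  exact ⟨funext fun k => (this k).1, funext fun k => (this k).2⟩

end HalfLine

/-! ## Jacobi coefficients of a measure satisfying the loop equation -/

section PositiveFunctional

variable {L : ℝ[X] →ₗ[ℝ] ℝ}

theorem orthoPoly_orthonormal' (h1 : L 1 = 1) (hpos : ∀ p : ℝ[X], p ≠ 0 → 0 < L (p * p))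
    (i j : ℕ) : L (orthoPoly L i * orthoPoly L j) = if i = j then 1 else 0 :=
  orthoPoly_orthonormal (N := i + j + 1) h1 (fun p hp _ => hpos p hp) (by omega) (by omega)

theorem jacobiOff_pos' (h1 : L 1 = 1) (hpos : ∀ p : ℝ[X], p ≠ 0 → 0 < L (p * p)) (k : ℕ) :
    0 < jacobiOff L k :=
  jacobiOff_pos (N := k + 2) h1 (fun p hp _ => hpos p hp) (by omega)

theorem natDegree_orthoPoly (h1 : L 1 = 1) (hpos : ∀ p : ℝ[X], p ≠ 0 → 0 < L (p * p)) (k : ℕ) :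
    (orthoPoly L k).natDegree = k :=
  (orthoPoly_aux (N := k + 1) h1 (fun p hp _ => hpos p hp) k (by omega)).1.1

theorem leadingCoeff_orthoPoly_pos (h1 : L 1 = 1) (hpos : ∀ p : ℝ[X], p ≠ 0 → 0 < L (p * p))
    (k : ℕ) : 0 < (orthoPoly L k).leadingCoeff :=
  (orthoPoly_aux (N := k + 1) h1 (fun p hp _ => hpos p hp) k (by omega)).1.2

theorem X_mul_orthoPoly (h1 : L 1 = 1) (hpos : ∀ p : ℝ[X], p ≠ 0 → 0 < L (p * p)) (k : ℕ) :
    X * orthoPoly L k = C (jacobiDiag L k) * orthoPoly L k +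
      C (jacobiOff L k) * orthoPoly L (k + 1) +
      (if k = 0 then 0 else C (jacobiOff L (k - 1)) * orthoPoly L (k - 1)) := by
  cases k with
  | zero => rw [X_mul_orthoPoly_zero L (jacobiOff_pos' h1 hpos 0)]; simp
  | succ k =>
    rw [X_mul_orthoPoly_succ L (jacobiOff_pos' h1 hpos _), if_neg (by omega), Nat.add_sub_cancel]
    ring

theorem map_orthoPoly_mul_of_natDegree_lt (h1 : L 1 = 1)
    (hpos : ∀ p : ℝ[X], p ≠ 0 → 0 < L (p * p)) {k : ℕ} (q : ℝ[X])
    (hq : q.degree < (k : WithBot ℕ)) : L (orthoPoly L k * q) = 0 := by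
  induction h : q.natDegree using Nat.strong_induction_on generalizing q with
  | _ d ih =>
  by_cases hq0 : q = 0
  · simp [hq0]
  have hl := leadingCoeff_orthoPoly_pos h1 hpos d
  have hp0 : orthoPoly L d ≠ 0 := fun e => by simp [e] at hl
  have hdk : d < k := by
    rw [degree_eq_natDegree hq0, h] at hq
    exact_mod_cast hq
  set r := q.leadingCoeff / (orthoPoly L d).leadingCoeff with hr
  have hr0 : r ≠ 0 := div_ne_zero (leadingCoeff_ne_zero.mpr hq0) hl.ne'
  have hdeg : q.degree = (C r * orthoPoly L d).degree := by
    rw [degree_C_mul hr0, degree_eq_natDegree hq0, degree_eq_natDegree hp0,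
      natDegree_orthoPoly h1 hpos, h]
  have hlt : (q - C r * orthoPoly L d).degree < q.degree :=
    degree_sub_lt_left hdeg hq0 (by rw [leadingCoeff_mul, leadingCoeff_C, hr]; field_simp)
  have hz : L (orthoPoly L k * (q - C r * orthoPoly L d)) = 0 := by
    by_cases hs0 : q - C r * orthoPoly L d = 0
    · simp [hs0]
    · refine ih _ ?_ _ (hlt.trans hq) rfl
      exact (natDegree_lt_natDegree hs0 hlt).trans_eq h
  have e : orthoPoly L k * q = orthoPoly L k * (q - C r * orthoPoly L d) +
      C r * (orthoPoly L k * orthoPoly L d) := by ring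
  rw [e, map_add, hz, L.map_C_mul, orthoPoly_orthonormal' h1 hpos, if_neg hdk.ne']
  simp

theorem map_orthoPoly_mul_of_natDegree_eq (h1 : L 1 = 1)
    (hpos : ∀ p : ℝ[X], p ≠ 0 → 0 < L (p * p)) {k : ℕ} (q : ℝ[X]) (hq0 : q ≠ 0)
    (hq : q.natDegree = k) :
    L (orthoPoly L k * q) = q.leadingCoeff / (orthoPoly L k).leadingCoeff := by
  have hl := leadingCoeff_orthoPoly_pos h1 hpos k
  have hp0 : orthoPoly L k ≠ 0 := fun e => by simp [e] at hl
  set r := q.leadingCoeff / (orthoPoly L k).leadingCoeff with hr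
  have hr0 : r ≠ 0 := div_ne_zero (leadingCoeff_ne_zero.mpr hq0) hl.ne'
  have hdeg : q.degree = (C r * orthoPoly L k).degree := by
    rw [degree_C_mul hr0, degree_eq_natDegree hq0, degree_eq_natDegree hp0,
      natDegree_orthoPoly h1 hpos, hq]
  have hlt : (q - C r * orthoPoly L k).degree < q.degree :=
    degree_sub_lt_left hdeg hq0 (by rw [leadingCoeff_mul, leadingCoeff_C, hr]; field_simp)
  have e : orthoPoly L k * q = orthoPoly L k * (q - C r * orthoPoly L k) +
      C r * (orthoPoly L k * orthoPoly L k) := by ring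
  rw [e, map_add, map_orthoPoly_mul_of_natDegree_lt h1 hpos, L.map_C_mul,
    orthoPoly_orthonormal' h1 hpos, if_pos rfl, mul_one, zero_add]
  rwa [degree_eq_natDegree hq0, hq] at hlt

theorem jacobiOff_eq_div (h1 : L 1 = 1) (hpos : ∀ p : ℝ[X], p ≠ 0 → 0 < L (p * p)) (k : ℕ) :
    jacobiOff L k = (orthoPoly L k).leadingCoeff / (orthoPoly L (k + 1)).leadingCoeff := by
  have hl := leadingCoeff_orthoPoly_pos h1 hpos k
  have hp0 : orthoPoly L k ≠ 0 := fun e => by simp [e] at hl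
  have e1 := map_X_mul_orthoPoly_of_lt (N := k + 2) h1 (fun p hp _ => hpos p hp)
    (Nat.lt_succ_self k) (by omega)
  rw [if_pos rfl, mul_comm, map_orthoPoly_mul_of_natDegree_eq h1 hpos _
    (mul_ne_zero X_ne_zero hp0) (by rw [natDegree_X_mul hp0, natDegree_orthoPoly h1 hpos]),
    leadingCoeff_mul, leadingCoeff_X, one_mul] at e1
  exact e1.symm

theorem jacobiBlock_pow_apply (h1 : L 1 = 1) (hpos : ∀ p : ℝ[X], p ≠ 0 → 0 < L (p * p))
    {N : ℕ} (m : ℕ) (k l : Fin N) (hk : (k : ℕ) + m < N) :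
    (jacobiBlock N (jacobiDiag L) (jacobiOff L) ^ m) k l =
      L (X ^ m * (orthoPoly L k * orthoPoly L l)) := by
  induction m generalizing k with
  | zero =>
    rw [pow_zero, pow_zero, one_mul, orthoPoly_orthonormal' h1 hpos, Matrix.one_apply]
    simp only [Fin.ext_iff]
  | succ m ih =>
    have hs := sum_mul_jacobiBlock N (jacobiDiag L) (jacobiOff L)
      (fun j => if j < N then L (X ^ m * (orthoPoly L j * orthoPoly L l)) else 0)
      (fun j hj => by simp [hj]) k
    rw [pow_succ', Matrix.mul_apply]
    have e : ∀ j : Fin N, jacobiBlock N (jacobiDiag L) (jacobiOff L) k j *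
        (jacobiBlock N (jacobiDiag L) (jacobiOff L) ^ m) j l =
        (if (j : ℕ) < N then L (X ^ m * (orthoPoly L j * orthoPoly L l)) else 0) *
          jacobiBlock N (jacobiDiag L) (jacobiOff L) j k := fun j => by
      have hsymm : jacobiBlock N (jacobiDiag L) (jacobiOff L) k j =
          jacobiBlock N (jacobiDiag L) (jacobiOff L) j k :=
        congrFun (congrFun (jacobiBlock_transpose N (jacobiDiag L) (jacobiOff L)) j) k
      rw [if_pos j.2, mul_comm, hsymm]
      by_cases hj : (j : ℕ) ≤ k + 1
      · rw [ih j (by omega)]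
      · have : jacobiBlock N (jacobiDiag L) (jacobiOff L) j k = 0 := by
          rw [jacobiBlock_apply, if_neg (by omega), if_neg (by omega), if_neg (by omega)]
        rw [this, mul_zero, mul_zero]
    rw [Finset.sum_congr rfl fun j _ => e j, hs, if_pos k.2, if_pos (by omega)]
    have e2 : X ^ (m + 1) * (orthoPoly L k * orthoPoly L l) =
        C (jacobiDiag L k) * (X ^ m * (orthoPoly L k * orthoPoly L l)) +
        C (jacobiOff L k) * (X ^ m * (orthoPoly L (k + 1) * orthoPoly L l)) +
        (if (k : ℕ) = 0 then 0 else C (jacobiOff L (k - 1)) *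
          (X ^ m * (orthoPoly L (k - 1) * orthoPoly L l))) := by
      have : X ^ (m + 1) * (orthoPoly L k * orthoPoly L l) =
        X ^ m * ((X * orthoPoly L k) * orthoPoly L l) := by ring
      rw [this, X_mul_orthoPoly h1 hpos]
      split_ifs <;> ring
    rw [e2, map_add, map_add, L.map_C_mul, L.map_C_mul]
    split_ifs with h0 h2
    · simp; ring
    · rw [L.map_C_mul]; ring
    · omega

theorem entry_aeval_jacobiBlock (h1 : L 1 = 1) (hpos : ∀ p : ℝ[X], p ≠ 0 → 0 < L (p * p))
    {N : ℕ} (q : ℝ[X]) {k l : ℕ} (hk : k + q.natDegree < N) (hl : l < N) :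
    (aeval (jacobiBlock N (jacobiDiag L) (jacobiOff L)) q).entry k l =
      L (q * (orthoPoly L k * orthoPoly L l)) := by
  rw [Matrix.entry, dif_pos ⟨by omega, hl⟩, aeval_eq_sum_range, Matrix.sum_apply]
  conv_rhs => rw [q.as_sum_range_C_mul_X_pow, Finset.sum_mul, map_sum]
  refine Finset.sum_congr rfl fun m hm => ?_
  have := Finset.mem_range.mp hm
  rw [Matrix.smul_apply, jacobiBlock_pow_apply h1 hpos m _ _ (by simp; omega), mul_assoc,
    L.map_C_mul, smul_eq_mul]

/-- The Euler–Lagrange equations in terms of the linear functional. -/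
theorem isHalfLineCritical_of_map (h1 : L 1 = 1) (hpos : ∀ p : ℝ[X], p ≠ 0 → 0 < L (p * p))
    {V : ℝ[X]} (hd : 2 ≤ V.natDegree)
    (e1 : ∀ k, L (V.derivative * (orthoPoly L k * orthoPoly L k)) = 0)
    (e2 : ∀ k, 2 * L (V.derivative * (orthoPoly L k * orthoPoly L (k + 1))) =
      (jacobiOff L k)⁻¹) : IsHalfLineCritical V (jacobiDiag L) (jacobiOff L) := by
  intro k N hN
  have := natDegree_derivative_le V
  rw [entry_aeval_jacobiBlock h1 hpos _ (by omega) (by omega),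
    entry_aeval_jacobiBlock h1 hpos _ (by omega) (by omega)]
  exact ⟨e1 k, e2 k⟩

end PositiveFunctional

section CompactlySupported

theorem ae_prod_abs_le {μ : Measure ℝ} [SFinite μ] {R : ℝ} (hR : ∀ᵐ x ∂μ, |x| ≤ R) :
    ∀ᵐ z ∂μ.prod μ, |z.1| ≤ R ∧ |z.2| ≤ R :=
  (Measure.quasiMeasurePreserving_fst.ae hR).and (Measure.quasiMeasurePreserving_snd.ae hR)

variable {μ : Measure ℝ} [IsProbabilityMeasure μ] {R : ℝ}

theorem Continuous.exists_abs_le_of_abs_le {f : ℝ → ℝ} (hf : Continuous f) (R : ℝ) :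
    ∃ K, 0 ≤ K ∧ ∀ x, |x| ≤ R → |f x| ≤ K := by
  obtain ⟨K, hK⟩ := isCompact_Icc.exists_bound_of_continuousOn (s := Set.Icc (-R) R)
    hf.continuousOn
  exact ⟨max K 0, le_max_right _ _, fun x hx => (hK x (abs_le.mp hx)).trans (le_max_left _ _)⟩

theorem integrable_of_continuous_of_support (hR : ∀ᵐ x ∂μ, |x| ≤ R) {f : ℝ → ℝ}
    (hf : Continuous f) : Integrable f μ := by
  obtain ⟨K, -, hK⟩ := hf.exists_abs_le_of_abs_le R
  refine Integrable.of_bound hf.aestronglyMeasurable K ?_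
  filter_upwards [hR] with x hx using hK x hx

/-- Integration of polynomials against a compactly supported measure. -/
noncomputable def integralFunctional (μ : Measure ℝ) [IsProbabilityMeasure μ] {R : ℝ}
    (hR : ∀ᵐ x ∂μ, |x| ≤ R) : ℝ[X] →ₗ[ℝ] ℝ where
  toFun p := ∫ x, p.eval x ∂μ
  map_add' p q := by
    simp only [eval_add]
    exact integral_add (integrable_of_continuous_of_support hR p.continuous)
      (integrable_of_continuous_of_support hR q.continuous)
  map_smul' r p := by
    simp only [eval_smul, smul_eq_mul, RingHom.id_apply]
    exact integral_const_mul _ _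

theorem integralFunctional_apply (hR : ∀ᵐ x ∂μ, |x| ≤ R) (p : ℝ[X]) :
    integralFunctional μ hR p = ∫ x, p.eval x ∂μ := rfl

theorem integralFunctional_one (hR : ∀ᵐ x ∂μ, |x| ≤ R) : integralFunctional μ hR 1 = 1 := by
  simp [integralFunctional_apply]

theorem integralFunctional_mul_self_pos [NullSingletonClass μ] (hR : ∀ᵐ x ∂μ, |x| ≤ R) (p : ℝ[X])
    (hp : p ≠ 0) : 0 < integralFunctional μ hR (p * p) := by
  rw [integralFunctional_apply]
  have hnn : ∀ x, 0 ≤ (p * p).eval x := fun x => by rw [eval_mul]; exact mul_self_nonneg _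
  refine lt_of_le_of_ne (integral_nonneg hnn) fun h => ?_
  have h0 := (integral_eq_zero_iff_of_nonneg hnn
    (integrable_of_continuous_of_support hR (p * p).continuous)).mp h.symm
  have h2 : μ {x | p.IsRoot x} = 0 := (Polynomial.finite_setOfPred_isRoot hp).measure_zero μ
  have h3 : ∀ᵐ x ∂μ, False := by
    filter_upwards [h0, measure_eq_zero_iff_ae_notMem.mp h2] with x hx hx'
    simp only [eval_mul, Pi.zero_apply, mul_self_eq_zero] at hx
    exact hx' hx
  simp at h3
  exact IsProbabilityMeasure.ne_zero μ h3

/-- The difference quotient `(f(x) - f(y)) / (x - y)`. -/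
noncomputable def diffQuot (f : ℝ[X]) (z : ℝ × ℝ) : ℝ := (f.eval z.1 - f.eval z.2) / (z.1 - z.2)

theorem diffQuot_swap (f : ℝ[X]) (z : ℝ × ℝ) : diffQuot f z.swap = diffQuot f z := by
  unfold diffQuot
  rw [← neg_div_neg_eq]
  simp

theorem diffQuot_mul (f g : ℝ[X]) (z : ℝ × ℝ) :
    diffQuot (f * g) z = f.eval z.1 * diffQuot g z + g.eval z.2 * diffQuot f z := by
  unfold diffQuot
  rw [eval_mul, eval_mul]
  ring

theorem measurable_diffQuot (f : ℝ[X]) : Measurable (diffQuot f) := by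
  have := f.continuous.measurable
  unfold diffQuot
  fun_prop

theorem exists_abs_diffQuot_le (f : ℝ[X]) (R : ℝ) :
    ∃ K, 0 ≤ K ∧ ∀ z : ℝ × ℝ, |z.1| ≤ R → |z.2| ≤ R → |diffQuot f z| ≤ K := by
  obtain ⟨K, hK0, hK⟩ := f.derivative.continuous.exists_abs_le_of_abs_le R
  refine ⟨K, hK0, fun z h1 h2 => ?_⟩
  have := (convex_Icc (-R) R).norm_image_sub_le_of_norm_deriv_le (f := fun x => f.eval x) (C := K)
    (fun x _ => f.differentiableAt) (fun x hx => by
      rw [Polynomial.deriv]; exact hK x (abs_le.mpr hx)) (abs_le.mp h2) (abs_le.mp h1)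
  rw [diffQuot, abs_div]
  exact div_le_of_le_mul₀ (abs_nonneg _) hK0 this

theorem integrable_mul_diffQuot (hR : ∀ᵐ x ∂μ, |x| ≤ R) (p f : ℝ[X]) :
    Integrable (fun z : ℝ × ℝ => p.eval z.1 * diffQuot f z) (μ.prod μ) := by
  obtain ⟨K, hK0, hK⟩ := exists_abs_diffQuot_le f R
  obtain ⟨K', hK0', hK'⟩ := p.continuous.exists_abs_le_of_abs_le R
  refine Integrable.of_bound ?_ (K' * K) ?_
  · exact ((p.continuous.measurable.comp measurable_fst).mul
      (measurable_diffQuot f)).aestronglyMeasurable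
  · filter_upwards [ae_prod_abs_le hR] with z hz
    rw [Real.norm_eq_abs, abs_mul]
    exact mul_le_mul (hK' _ hz.1) (hK z hz.1 hz.2) (abs_nonneg _) hK0'

theorem eval_divByMonic_X_sub_C (f : ℝ[X]) {x y : ℝ} (h : x ≠ y) :
    (f /ₘ (X - C y)).eval x = diffQuot f (x, y) := by
  have := congrArg (eval x) (X_sub_C_mul_divByMonic_eq_sub_modByMonic f y)
  rw [modByMonic_X_sub_C_eq_C_eval, eval_mul, eval_sub, eval_sub, eval_X, eval_C, eval_C] at this
  rw [diffQuot, eq_div_iff (sub_ne_zero.mpr h), ← this, mul_comm]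

theorem integral_mul_diffQuot [NullSingletonClass μ] (hR : ∀ᵐ x ∂μ, |x| ≤ R) (p f : ℝ[X]) {r : ℝ}
    (h : ∀ y, integralFunctional μ hR (p * (f /ₘ (X - C y))) = r) :
    ∫ z : ℝ × ℝ, p.eval z.1 * diffQuot f z ∂μ.prod μ = r := by
  rw [integral_prod_symm _ (integrable_mul_diffQuot hR p f)]
  have : ∀ y, ∫ x, p.eval x * diffQuot f (x, y) ∂μ = r := fun y => by
    rw [← h y, integralFunctional_apply]
    refine integral_congr_ae ?_
    filter_upwards [measure_eq_zero_iff_ae_notMem.mp (measure_singleton (μ := μ) y)] with x hx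
    rw [eval_mul, eval_divByMonic_X_sub_C f (by simpa using hx)]
  simp [this]

theorem integral_mul_diffQuot' [NullSingletonClass μ] (hR : ∀ᵐ x ∂μ, |x| ≤ R) (p f : ℝ[X]) {r : ℝ}
    (h : ∀ y, integralFunctional μ hR (p * (f /ₘ (X - C y))) = r) :
    ∫ z : ℝ × ℝ, p.eval z.2 * diffQuot f z ∂μ.prod μ = r := by
  rw [← integral_mul_diffQuot hR p f h, ← integral_prod_swap]
  refine integral_congr_ae (Eventually.of_forall fun z => ?_)
  simp only [diffQuot_swap, Prod.snd_swap]

theorem integrable_mul_diffQuot' (hR : ∀ᵐ x ∂μ, |x| ≤ R) (p f : ℝ[X]) :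
    Integrable (fun z : ℝ × ℝ => p.eval z.2 * diffQuot f z) (μ.prod μ) := by
  have := (integrable_mul_diffQuot hR p f).swap
  refine this.congr (Eventually.of_forall fun z => ?_)
  simp only [Function.comp_apply, diffQuot_swap, Prod.fst_swap]

/-- The loop (Schwinger–Dyson) equation with polynomial test functions. -/
def LoopEquation (V : ℝ[X]) (μ : Measure ℝ) : Prop :=
  ∀ f : ℝ[X], ∫ x, V.derivative.eval x * f.eval x ∂μ =
    1 / 2 * ∫ z : ℝ × ℝ, diffQuot f z ∂μ.prod μ

theorem LoopEquation.isHalfLineCritical [NullSingletonClass μ] (hR : ∀ᵐ x ∂μ, |x| ≤ R) {V : ℝ[X]}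
    (hd : 2 ≤ V.natDegree) (h : LoopEquation V μ) :
    IsHalfLineCritical V (jacobiDiag (integralFunctional μ hR))
      (jacobiOff (integralFunctional μ hR)) := by
  set L := integralFunctional μ hR with hL
  have h1 : L 1 = 1 := integralFunctional_one hR
  have hpos : ∀ p : ℝ[X], p ≠ 0 → 0 < L (p * p) := integralFunctional_mul_self_pos hR
  have hdeg : ∀ (f : ℝ[X]) (y : ℝ), (f /ₘ (X - C y)).natDegree = f.natDegree - 1 := fun f y => by
    rw [natDegree_divByMonic _ (monic_X_sub_C y), natDegree_X_sub_C]
  -- the quotient of a polynomial of degree at most `k` is orthogonal to `p_k`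
  have hz : ∀ j k, j ≤ k → ∀ y, L (orthoPoly L k * (orthoPoly L j /ₘ (X - C y))) = 0 := by
    intro j k hjk y
    cases j with
    | zero =>
      rw [orthoPoly_zero, (divByMonic_eq_zero_iff (monic_X_sub_C y)).mpr, mul_zero, map_zero]
      rw [degree_one, degree_X_sub_C]; exact zero_lt_one
    | succ j =>
      refine map_orthoPoly_mul_of_natDegree_lt h1 hpos _ ?_
      refine degree_le_natDegree.trans_lt ?_
      rw [hdeg, natDegree_orthoPoly h1 hpos]
      exact_mod_cast (by omega : j + 1 - 1 < k)
  refine isHalfLineCritical_of_map h1 hpos hd (fun k => ?_) fun k => ?_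
  · have := h (orthoPoly L k * orthoPoly L k)
    simp only [diffQuot_mul] at this
    rw [integral_add (integrable_mul_diffQuot hR _ _) (integrable_mul_diffQuot' hR _ _),
      integral_mul_diffQuot hR _ _ (hz k k le_rfl),
      integral_mul_diffQuot' hR _ _ (hz k k le_rfl)] at this
    rw [hL, integralFunctional_apply, ← hL]
    simp only [eval_mul] at this ⊢
    rw [this]; simp
  · have := h (orthoPoly L k * orthoPoly L (k + 1))
    have hl := leadingCoeff_orthoPoly_pos h1 hpos k
    have hl' := leadingCoeff_orthoPoly_pos h1 hpos (k + 1)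
    have hd1 := natDegree_orthoPoly h1 hpos (k + 1)
    simp only [diffQuot_mul] at this
    rw [integral_add (integrable_mul_diffQuot hR _ _) (integrable_mul_diffQuot' hR _ _),
      integral_mul_diffQuot hR _ _ (r := (jacobiOff L k)⁻¹),
      integral_mul_diffQuot' hR _ _ (hz k (k + 1) (by omega))] at this
    · rw [hL, integralFunctional_apply, ← hL]
      simp only [eval_mul] at this ⊢
      rw [this]; ring
    · intro y
      have hlead : (orthoPoly L (k + 1) /ₘ (X - C y)).leadingCoeff =
          (orthoPoly L (k + 1)).leadingCoeff :=
        leadingCoeff_divByMonic_X_sub_C _ (fun e => by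
          have := natDegree_eq_zero_iff_degree_le_zero.mpr e.le
          omega) y
      change L _ = _
      rw [map_orthoPoly_mul_of_natDegree_eq h1 hpos _ (fun e => by
        rw [e, leadingCoeff_zero] at hlead; exact hl'.ne hlead) (by rw [hdeg, hd1]; rfl), hlead,
        jacobiOff_eq_div h1 hpos, inv_div]

theorem abs_jacobi_le [NullSingletonClass μ] (hR : ∀ᵐ x ∂μ, |x| ≤ R) (k : ℕ) :
    |jacobiDiag (integralFunctional μ hR) k| ≤ R ∧ jacobiOff (integralFunctional μ hR) k ≤ R := by
  set L := integralFunctional μ hR with hL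
  have h1 : L 1 = 1 := integralFunctional_one hR
  have hpos : ∀ p : ℝ[X], p ≠ 0 → 0 < L (p * p) := integralFunctional_mul_self_pos hR
  have hint := fun p : ℝ[X] => integrable_of_continuous_of_support hR p.continuous
  have hbound : ∀ p q : ℝ[X], L (p * p) = 1 → L (q * q) = 1 → |L (X * p * q)| ≤ R := by
    intro p q hp hq
    have hle : ∀ᵐ x ∂μ, |(X * p * q).eval x| ≤ (C (R / 2) * (p * p + q * q)).eval x := by
      filter_upwards [hR] with x hx
      simp only [eval_mul, eval_X, eval_C, eval_add, abs_mul]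
      have hR0 : 0 ≤ R := (abs_nonneg _).trans hx
      have h3 : |p.eval x| * |q.eval x| ≤ (p.eval x * p.eval x + q.eval x * q.eval x) / 2 := by
        have := sq_nonneg (|p.eval x| - |q.eval x|)
        nlinarith [sq_abs (p.eval x), sq_abs (q.eval x)]
      calc |x| * |p.eval x| * |q.eval x| = |x| * (|p.eval x| * |q.eval x|) := by ring
        _ ≤ R * ((p.eval x * p.eval x + q.eval x * q.eval x) / 2) :=
          mul_le_mul hx h3 (by positivity) hR0
        _ = _ := by ring
    have h4 : L (C (R / 2) * (p * p + q * q)) = R := by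
      rw [L.map_C_mul, map_add, hp, hq]; ring
    calc |L (X * p * q)| ≤ ∫ x, |(X * p * q).eval x| ∂μ := abs_integral_le_integral_abs
      _ ≤ ∫ x, (C (R / 2) * (p * p + q * q)).eval x ∂μ := by
        refine integral_mono_ae (hint (X * p * q)).abs (hint _) ?_
        exact hle
      _ = R := h4
  have hn : ∀ k, L (orthoPoly L k * orthoPoly L k) = 1 := fun k => by
    rw [orthoPoly_orthonormal' h1 hpos, if_pos rfl]
  refine ⟨hbound _ _ (hn k) (hn k), ?_⟩
  have e := map_X_mul_orthoPoly_of_lt (N := k + 2) h1 (fun p hp _ => hpos p hp)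
    (Nat.lt_succ_self k) (by omega)
  rw [if_pos rfl] at e
  rw [← e]
  exact (le_abs_self _).trans (hbound _ _ (hn k) (hn (k + 1)))

end CompactlySupported

/-! ## The Jacobi operator and its spectral measure -/

section Operator

theorem memℓp_two_iff {f : ℕ → ℝ} : Memℓp f 2 ↔ Summable fun k => f k ^ 2 := by
  rw [memℓp_gen_iff (by norm_num)]
  simp

theorem summable_sq_of_eq_add {C : ℝ} {a b : ℕ → ℝ} (ha : ∀ k, |a k| ≤ C) (hb : ∀ k, |b k| ≤ C)
    {f g : ℕ → ℝ} (hf : Summable fun k => f k ^ 2) 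
    (hs : ∀ k, g (k + 1) = b k * f k + a (k + 1) * f (k + 1) + b (k + 1) * f (k + 2)) :
    Summable fun k => g k ^ 2 := by
  rw [← summable_nat_add_iff 1]
  have h1 : Summable fun k => f (k + 1) ^ 2 := (summable_nat_add_iff (f := fun k => f k ^ 2) 1).mpr hf
  have h2 : Summable fun k => f (k + 2) ^ 2 := (summable_nat_add_iff (f := fun k => f k ^ 2) 2).mpr hf
  refine Summable.of_nonneg_of_le (fun k => sq_nonneg _) (fun k => ?_)
    (((hf.add h1).add h2).mul_left (3 * C ^ 2))
  rw [hs]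
  have e : ∀ u v : ℝ, |u| ≤ C → (u * v) ^ 2 ≤ C ^ 2 * v ^ 2 := fun u v hu => by
    rw [mul_pow]
    exact mul_le_mul_of_nonneg_right (sq_le_sq' (abs_le.mp hu).1 (abs_le.mp hu).2) (sq_nonneg v)
  have e1 := e _ (f k) (hb k)
  have e2 := e _ (f (k + 1)) (ha (k + 1))
  have e3 := e _ (f (k + 2)) (hb (k + 1))
  have : ∀ x y z : ℝ, (x + y + z) ^ 2 ≤ 3 * (x ^ 2 + y ^ 2 + z ^ 2) := fun x y z => by
    nlinarith [sq_nonneg (x - y), sq_nonneg (y - z), sq_nonneg (x - z)]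
  have := this (b k * f k) (a (k + 1) * f (k + 1)) (b (k + 1) * f (k + 2))
  linarith

theorem exists_isJacobiOperator {C : ℝ} {a b : ℕ → ℝ} (ha : ∀ k, |a k| ≤ C)
    (hb : ∀ k, |b k| ≤ C) : ∃ J : ℓ²(ℕ, ℝ) →L[ℝ] ℓ²(ℕ, ℝ), IsJacobiOperator a b J := by
  let g : (ℕ → ℝ) → ℕ → ℝ := fun f k => k.casesOn (a 0 * f 0 + b 0 * f 1)
    fun k => b k * f k + a (k + 1) * f (k + 1) + b (k + 1) * f (k + 2)
  have hg : ∀ f : ℓ²(ℕ, ℝ), Memℓp (g f) 2 := fun f => memℓp_two_iff.mpr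
    (summable_sq_of_eq_add ha hb (memℓp_two_iff.mp (lp.memℓp f)) fun _ => rfl)
  let T : ℓ²(ℕ, ℝ) →ₗ[ℝ] ℓ²(ℕ, ℝ) :=
    { toFun := fun f => ⟨g f, hg f⟩
      map_add' := fun f f' => by
        ext k
        cases k with
        | zero =>
          change a 0 * (f 0 + f' 0) + b 0 * (f 1 + f' 1) =
            a 0 * f 0 + b 0 * f 1 + (a 0 * f' 0 + b 0 * f' 1)
          ring
        | succ k =>
          change b k * (f k + f' k) + a (k + 1) * (f (k + 1) + f' (k + 1)) +
              b (k + 1) * (f (k + 2) + f' (k + 2)) =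
            b k * f k + a (k + 1) * f (k + 1) + b (k + 1) * f (k + 2) +
              (b k * f' k + a (k + 1) * f' (k + 1) + b (k + 1) * f' (k + 2))
          ring
      map_smul' := fun r f => by
        ext k
        cases k <;> simp [g] <;> ring }
  have hT : ∀ f : ℓ²(ℕ, ℝ), ∀ k, T f k = g f k := fun f k => rfl
  have hcoord : ∀ (u : ℕ → ℓ²(ℕ, ℝ)) (x : ℓ²(ℕ, ℝ)), Tendsto u atTop (𝓝 x) → ∀ k,
      Tendsto (fun n => u n k) atTop (𝓝 (x k)) := fun u x h k =>
    ((lp.uniformContinuous_coe.continuous.tendsto x).comp h).apply_nhds k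
  refine ⟨⟨T, T.continuous_of_seq_closed_graph fun u x y hu hy => ?_⟩, fun f => ⟨rfl, fun k => rfl⟩⟩
  ext k
  refine tendsto_nhds_unique (hcoord _ _ hy k) ?_
  have hc := hcoord u x hu
  cases k with
  | zero => exact ((hc 0).const_mul _).add ((hc 1).const_mul _)
  | succ k =>
    exact (((hc k).const_mul _).add ((hc (k + 1)).const_mul _)).add ((hc (k + 2)).const_mul _)

theorem jacobiOperator_pow_apply {L : ℝ[X] →ₗ[ℝ] ℝ} (h1 : L 1 = 1)
    (hpos : ∀ p : ℝ[X], p ≠ 0 → 0 < L (p * p)) {J : ℓ²(ℕ, ℝ) →L[ℝ] ℓ²(ℕ, ℝ)}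
    (hJ : IsJacobiOperator (jacobiDiag L) (jacobiOff L) J) (m k : ℕ) :
    ((J ^ m) firstVector) k = L (X ^ m * orthoPoly L k) := by
  induction m generalizing k with
  | zero =>
    have := orthoPoly_orthonormal' h1 hpos 0 k
    rw [orthoPoly_zero, one_mul] at this
    rw [pow_zero, pow_zero, one_mul, this]
    change firstVector k = _
    by_cases hk : 0 = k
    · subst hk; simp [firstVector]
    · rw [if_neg hk, firstVector, lp.single_apply_ne _ _ _ (Ne.symm hk)]
  | succ m ih =>
    rw [pow_succ']
    change (J ((J ^ m) firstVector)) k = _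
    have e : X ^ (m + 1) * orthoPoly L k = X ^ m * (X * orthoPoly L k) := by ring
    rw [e, X_mul_orthoPoly h1 hpos]
    have e' : ∀ (r : ℝ) (i : ℕ), L (X ^ m * (C r * orthoPoly L i)) =
        r * L (X ^ m * orthoPoly L i) := fun r i => by
      rw [mul_left_comm, L.map_C_mul]
    cases k with
    | zero =>
      rw [(hJ _).1, ih, ih, if_pos rfl, add_zero, mul_add, map_add, e', e']
    | succ k =>
      rw [(hJ _).2, ih, ih, ih, if_neg (by omega), mul_add, mul_add, map_add, map_add, e', e', e',
        Nat.add_sub_cancel]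
      ring

theorem inner_firstVector (v : ℓ²(ℕ, ℝ)) : inner ℝ firstVector v = v 0 := by
  rw [firstVector, lp.inner_single_left]
  simp

variable {μ : Measure ℝ} [IsProbabilityMeasure μ] {R : ℝ}

theorem integral_pow_eq_inner [NullSingletonClass μ] (hR : ∀ᵐ x ∂μ, |x| ≤ R)
    {J : ℓ²(ℕ, ℝ) →L[ℝ] ℓ²(ℕ, ℝ)}
    (hJ : IsJacobiOperator (jacobiDiag (integralFunctional μ hR))
      (jacobiOff (integralFunctional μ hR)) J) (m : ℕ) :
    ∫ x, x ^ m ∂μ = inner ℝ firstVector ((J ^ m) firstVector) := by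
  rw [inner_firstVector, jacobiOperator_pow_apply (integralFunctional_one hR)
    (integralFunctional_mul_self_pos hR) hJ, orthoPoly_zero, mul_one, integralFunctional_apply]
  simp

/-- A compactly supported probability measure is determined by its moments. -/
theorem eq_of_integral_pow_eq (hR : ∀ᵐ x ∂μ, |x| ≤ R) {ν : Measure ℝ} [IsProbabilityMeasure ν]
    (hint : ∀ m : ℕ, Integrable (fun x : ℝ => x ^ m) ν)
    (h : ∀ m : ℕ, ∫ x, x ^ m ∂ν = ∫ x, x ^ m ∂μ) : ν = μ := by
  have hR0 : 0 ≤ R := by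
    by_contra hneg
    have : ∀ᵐ x ∂μ, False := hR.mono fun x hx => hneg ((abs_nonneg x).trans hx)
    simp at this
    exact IsProbabilityMeasure.ne_zero μ this
  -- `ν` has compact support
  have hν : ∀ᵐ x ∂ν, |x| ≤ R + 1 := by
    have hle : ∀ m : ℕ, ν.real {x | (R + 1) ^ (2 * m) ≤ x ^ (2 * m)} ≤ (R ^ 2 / (R + 1) ^ 2) ^ m := by
      intro m
      have h1 := mul_meas_ge_le_integral_of_nonneg (μ := ν) (f := fun x : ℝ => x ^ (2 * m))
        (Eventually.of_forall fun x => by simp only [pow_mul]; positivity) (hint _)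
        ((R + 1) ^ (2 * m))
      have h2 : ∫ x, x ^ (2 * m) ∂ν ≤ R ^ (2 * m) := by
        rw [h]
        have : ∫ x, x ^ (2 * m) ∂μ ≤ ∫ _, R ^ (2 * m) ∂μ := by
          refine integral_mono_ae (integrable_of_continuous_of_support hR (by fun_prop))
            (integrable_const _) ?_
          filter_upwards [hR] with x hx
          rw [pow_mul, pow_mul, ← sq_abs]
          gcongr
        simpa using this
      rw [← div_pow, ← pow_mul, div_pow, le_div_iff₀ (by positivity), mul_comm]
      exact h1.trans h2
    have hsub : {x : ℝ | ¬ |x| ≤ R + 1} ⊆ ⋂ m : ℕ, {x | (R + 1) ^ (2 * m) ≤ x ^ (2 * m)} := by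
      intro x hx
      rw [Set.mem_iInter]
      intro m
      have hx' : R + 1 < |x| := not_le.mp hx
      change (R + 1) ^ (2 * m) ≤ x ^ (2 * m)
      rw [pow_mul x, ← sq_abs x, ← pow_mul]
      gcongr
    have hz : ν.real {x : ℝ | ¬ |x| ≤ R + 1} ≤ 0 := by
      refine ge_of_tendsto' (tendsto_pow_atTop_nhds_zero_of_lt_one (r := R ^ 2 / (R + 1) ^ 2)
        (by positivity) ?_) fun m => (measureReal_mono (hsub.trans (Set.iInter_subset _ m))).trans
          (hle m)
      rw [div_lt_one (by positivity)]
      nlinarith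
    rw [ae_iff]
    exact (measureReal_eq_zero_iff).mp (le_antisymm hz measureReal_nonneg)
  have hμ : ∀ᵐ x ∂μ, |x| ≤ R + 1 := hR.mono fun x hx => hx.trans (by linarith)
  have hpoly : ∀ p : ℝ[X], ∫ x, p.eval x ∂ν = ∫ x, p.eval x ∂μ := by
    intro p
    have : integralFunctional ν hν p = integralFunctional μ hμ p := by
      rw [p.as_sum_range_C_mul_X_pow, map_sum, map_sum]
      refine Finset.sum_congr rfl fun m _ => ?_
      rw [LinearMap.map_C_mul, LinearMap.map_C_mul, integralFunctional_apply,
        integralFunctional_apply]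
      simp only [eval_pow, eval_X, h]
    exact this
  refine ext_of_forall_integral_eq_of_IsFiniteMeasure fun f => ?_
  refine eq_of_abs_sub_le_all fun ε hε => ?_
  obtain ⟨p, hp⟩ := exists_polynomial_near_of_continuousOn (-(R + 1)) (R + 1) f
    f.continuous.continuousOn (ε / 2) (half_pos hε)
  have hclose : ∀ (κ : Measure ℝ) [IsProbabilityMeasure κ], (∀ᵐ x ∂κ, |x| ≤ R + 1) →
      |∫ x, p.eval x ∂κ - ∫ x, f x ∂κ| ≤ ε / 2 := by
    intro κ _ hκ
    rw [← integral_sub (integrable_of_continuous_of_support hκ p.continuous)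
      (integrable_of_continuous_of_support hκ f.continuous)]
    have := norm_integral_le_of_norm_le_const (μ := κ) (f := fun x => p.eval x - f x)
      (C := ε / 2) (hκ.mono fun x hx => (hp x (abs_le.mp hx)).le)
    simpa using this
  have e1 := abs_le.mp (hclose ν hν)
  have e2 := abs_le.mp (hclose μ hμ)
  have e3 := hpoly p
  rw [abs_le]
  constructor <;> linarith

end Operator

/-! ## The logarithmic energy -/

/-- Lower bounds on a potential: quadratic growth, and domination of the logarithm. -/
structure PotentialBounds (V : ℝ[X]) (γ K : ℝ) : Prop where
  γ_pos : 0 < γ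
  K_nonneg : 0 ≤ K
  sq_le : ∀ s, γ * s ^ 2 ≤ V.eval s + K
  log_le : ∀ s, Real.log (1 + s ^ 2) ≤ V.eval s + K

theorem exists_potentialBounds {V : ℝ[X]} {c : ℝ} (hc : 0 < c)
    (hV : ∀ x : ℝ, c ≤ V.derivative.derivative.eval x) : ∃ γ K, PotentialBounds V γ K := by
  set d := V.derivative.eval 0
  set v := V.eval 0
  have h1 : ∀ s, c / 4 * s ^ 2 + (v - d ^ 2 / c) ≤ V.eval s := fun s => by
    have := Polynomial.tangent_add_sq_le hV s 0
    have h2 : 0 ≤ (c / 2 * s + d) ^ 2 / c := by positivity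
    have e : (c / 2 * s + d) ^ 2 / c = c / 4 * s ^ 2 + d * s + d ^ 2 / c := by
      field_simp
      ring
    rw [e] at h2
    simp only [sub_zero] at this
    linarith
  have h2 : ∀ s, Real.log (1 + s ^ 2) ≤ c / 4 * s ^ 2 + (c / 4 - 1 - Real.log (c / 4)) := fun s => by
    have hp : (0 : ℝ) < 1 + s ^ 2 := by positivity
    have := Real.log_le_sub_one_of_pos (mul_pos (by positivity : 0 < c / 4) hp)
    rw [Real.log_mul (by positivity) hp.ne'] at this
    linarith
  refine ⟨c / 4, max 0 (-(v - d ^ 2 / c)) + max 0 (c / 4 - 1 - Real.log (c / 4)),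
    by positivity, by positivity, fun s => ?_, fun s => ?_⟩
  · have := h1 s
    have := le_max_right 0 (-(v - d ^ 2 / c))
    have := le_max_left 0 (c / 4 - 1 - Real.log (c / 4))
    linarith
  · have := h1 s
    have := h2 s
    have := le_max_right 0 (-(v - d ^ 2 / c))
    have := le_max_right 0 (c / 4 - 1 - Real.log (c / 4))
    linarith

theorem abs_sub_le_sqrt_mul_sqrt (s t : ℝ) : |s - t| ≤ √(1 + s ^ 2) * √(1 + t ^ 2) := by
  rw [← Real.sqrt_mul (by positivity)]
  refine Real.abs_le_sqrt ?_
  nlinarith [sq_nonneg (1 + s * t)]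

theorem log_abs_sub_le (s t : ℝ) :
    Real.log |s - t| ≤ Real.log (1 + s ^ 2) / 2 + Real.log (1 + t ^ 2) / 2 := by
  by_cases h : s = t
  · subst h
    have : 0 ≤ Real.log (1 + s ^ 2) := Real.log_nonneg (by nlinarith [sq_nonneg s])
    simp
    linarith
  · have h1 : 0 < |s - t| := abs_pos.mpr (sub_ne_zero.mpr h)
    have := Real.log_le_log h1 (abs_sub_le_sqrt_mul_sqrt s t)
    rwa [Real.log_mul (by positivity) (by positivity), Real.log_sqrt (by positivity),
      Real.log_sqrt (by positivity)] at this

/-- The kernel whose double integral is the energy. -/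
noncomputable def logKernel (V : ℝ[X]) (z : ℝ × ℝ) : ℝ :=
  (V.eval z.1 + V.eval z.2) / 2 - Real.log |z.1 - z.2| / 2

/-- A bounded continuous truncation of the energy kernel. -/
noncomputable def truncKernel (V : ℝ[X]) (M : ℕ) (z : ℝ × ℝ) : ℝ :=
  min (M : ℝ) ((V.eval z.1 + V.eval z.2) / 2 - Real.log (max |z.1 - z.2| (Real.exp (-M))) / 2)

theorem measurable_logKernel (V : ℝ[X]) : Measurable (logKernel V) := by
  have := V.continuous.measurable
  unfold logKernel
  fun_prop

theorem continuous_truncKernel (V : ℝ[X]) (M : ℕ) : Continuous (truncKernel V M) := by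
  have hV := V.continuous
  have h : Continuous fun z : ℝ × ℝ => Real.log (max |z.1 - z.2| (Real.exp (-M))) :=
    Continuous.log (by fun_prop) fun z => (lt_max_of_lt_right (Real.exp_pos _)).ne'
  unfold truncKernel
  exact continuous_const.min ((((hV.comp continuous_fst).add (hV.comp continuous_snd)).div_const 2).sub
    (h.div_const 2))

theorem truncKernel_le (V : ℝ[X]) (M : ℕ) (z : ℝ × ℝ) : truncKernel V M z ≤ M := min_le_left _ _

theorem truncKernel_le_logKernel (V : ℝ[X]) (M : ℕ) {z : ℝ × ℝ} (hz : z.1 ≠ z.2) :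
    truncKernel V M z ≤ logKernel V z := by
  refine (min_le_right _ _).trans ?_
  unfold logKernel
  have := Real.log_le_log (abs_pos.mpr (sub_ne_zero.mpr hz)) (le_max_left |z.1 - z.2| (Real.exp (-M)))
  linarith

theorem eventually_truncKernel_eq (V : ℝ[X]) {z : ℝ × ℝ} (hz : z.1 ≠ z.2) :
    ∀ᶠ M : ℕ in atTop, truncKernel V M z = logKernel V z := by
  have h1 : Tendsto (fun M : ℕ => Real.exp (-M)) atTop (𝓝 0) :=
    Real.tendsto_exp_neg_atTop_nhds_zero.comp tendsto_natCast_atTop_atTop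
  filter_upwards [h1.eventually_lt_const (abs_pos.mpr (sub_ne_zero.mpr hz)),
    tendsto_natCast_atTop_atTop.eventually_ge_atTop (logKernel V z)] with M hM hM'
  rw [truncKernel, max_eq_left hM.le]
  exact min_eq_right hM'

section Bounds

variable {V : ℝ[X]} {γ K : ℝ} (hK : PotentialBounds V γ K)
include hK

theorem PotentialBounds.neg_le (s : ℝ) : -K ≤ V.eval s := by
  have := hK.sq_le s
  have := hK.γ_pos
  have : 0 ≤ γ * s ^ 2 := by positivity
  linarith

theorem PotentialBounds.le_logKernel (z : ℝ × ℝ) :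
    (V.eval z.1 + V.eval z.2) / 4 - K / 2 ≤ logKernel V z := by
  have := log_abs_sub_le z.1 z.2
  have := hK.log_le z.1
  have := hK.log_le z.2
  unfold logKernel
  linarith

theorem PotentialBounds.neg_le_logKernel (z : ℝ × ℝ) : -K ≤ logKernel V z := by
  have := hK.le_logKernel z
  have := hK.neg_le z.1
  have := hK.neg_le z.2
  linarith

theorem PotentialBounds.neg_le_truncKernel (M : ℕ) (z : ℝ × ℝ) : -K ≤ truncKernel V M z := by
  have hM : (0 : ℝ) ≤ M := Nat.cast_nonneg M
  have h0 := hK.K_nonneg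
  refine le_min (by linarith) ?_
  have hle : max |z.1 - z.2| (Real.exp (-M)) ≤ √(1 + z.1 ^ 2) * √(1 + z.2 ^ 2) := by
    refine max_le (abs_sub_le_sqrt_mul_sqrt _ _) ((Real.exp_le_one_iff.mpr (by linarith)).trans ?_)
    exact one_le_mul_of_one_le_of_one_le (Real.one_le_sqrt.mpr (by nlinarith [sq_nonneg z.1]))
      (Real.one_le_sqrt.mpr (by nlinarith [sq_nonneg z.2]))
  have h1 := Real.log_le_log (lt_max_of_lt_right (Real.exp_pos _)) hle
  rw [Real.log_mul (by positivity) (by positivity), Real.log_sqrt (by positivity),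
    Real.log_sqrt (by positivity)] at h1
  have := hK.log_le z.1
  have := hK.log_le z.2
  have := hK.neg_le z.1
  have := hK.neg_le z.2
  linarith

theorem PotentialBounds.le_truncKernel_diag (M : ℕ) (s : ℝ) :
    (M : ℝ) / 2 - K ≤ truncKernel V M (s, s) := by
  have hM : (0 : ℝ) ≤ M := Nat.cast_nonneg M
  have h0 := hK.K_nonneg
  refine le_min (by linarith) ?_
  have : max |s - s| (Real.exp (-M)) = Real.exp (-M) := by
    rw [sub_self, abs_zero]; exact max_eq_right (Real.exp_pos _).le
  have := hK.neg_le s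
  simp only [*, Real.log_exp]
  linarith

theorem PotentialBounds.abs_truncKernel_le (M : ℕ) (z : ℝ × ℝ) : |truncKernel V M z| ≤ M + K := by
  have h1 := hK.neg_le_truncKernel M z
  have h2 := truncKernel_le V M z
  have hM : (0 : ℝ) ≤ M := Nat.cast_nonneg M
  have h0 := hK.K_nonneg
  rw [abs_le]
  constructor <;> linarith

theorem PotentialBounds.integrable_truncKernel (M : ℕ) (P : Measure (ℝ × ℝ)) [IsFiniteMeasure P] :
    Integrable (truncKernel V M) P :=
  Integrable.of_bound (continuous_truncKernel V M).aestronglyMeasurable (M + K)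
    (Eventually.of_forall fun z => hK.abs_truncKernel_le M z)

end Bounds

theorem log_one_div_eq (V : ℝ[X]) (z : ℝ × ℝ) :
    Real.log (1 / |z.1 - z.2|) = 2 * logKernel V z - V.eval z.1 - V.eval z.2 := by
  rw [one_div, Real.log_inv, logKernel]
  ring

theorem integrable_comp_fst_of_integrable {ν : Measure ℝ} [IsProbabilityMeasure ν] {f : ℝ → ℝ}
    (hf : Integrable f ν) : Integrable (fun z : ℝ × ℝ => f z.1) (ν.prod ν) :=
  measurePreserving_fst.integrable_comp_of_integrable hf

theorem integrable_comp_snd_of_integrable {ν : Measure ℝ} [IsProbabilityMeasure ν] {f : ℝ → ℝ}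
    (hf : Integrable f ν) : Integrable (fun z : ℝ × ℝ => f z.2) (ν.prod ν) :=
  measurePreserving_snd.integrable_comp_of_integrable hf

theorem integral_comp_fst_eq {ν : Measure ℝ} [IsProbabilityMeasure ν] (f : ℝ → ℝ) :
    ∫ z : ℝ × ℝ, f z.1 ∂ν.prod ν = ∫ s, f s ∂ν := by
  rw [integral_fun_fst]; simp

theorem integral_comp_snd_eq {ν : Measure ℝ} [IsProbabilityMeasure ν] (f : ℝ → ℝ) :
    ∫ z : ℝ × ℝ, f z.2 ∂ν.prod ν = ∫ s, f s ∂ν := by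
  rw [integral_fun_snd]; simp

theorem HasFiniteEnergy.integrable_logKernel {V : ℝ[X]} {ν : ProbabilityMeasure ℝ}
    (h : HasFiniteEnergy V ν) :
    Integrable (logKernel V) ((ν : Measure ℝ).prod (ν : Measure ℝ)) := by
  have := ((h.integrable_log.add (integrable_comp_fst_of_integrable h.integrable_potential)).add
    (integrable_comp_snd_of_integrable h.integrable_potential)).div_const 2
  refine this.congr (Eventually.of_forall fun z => ?_)
  simp only [Pi.add_apply, log_one_div_eq V]
  ring

theorem HasFiniteEnergy.energy_eq {V : ℝ[X]} {ν : ProbabilityMeasure ℝ}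
    (h : HasFiniteEnergy V ν) :
    energy V ν = ∫ z, logKernel V z ∂(ν : Measure ℝ).prod (ν : Measure ℝ) := by
  have h1 := integrable_comp_fst_of_integrable h.integrable_potential
  have h2 := integrable_comp_snd_of_integrable h.integrable_potential
  have h3 := h.integrable_logKernel
  rw [energy]
  simp only [log_one_div_eq V]
  have h4 : Integrable (fun z => 2 * logKernel V z - V.eval z.1)
      ((ν : Measure ℝ).prod (ν : Measure ℝ)) := (h3.const_mul 2).sub h1
  rw [integral_sub h4 h2, integral_sub (h3.const_mul 2) h1,
    integral_comp_fst_eq (fun s => V.eval s), integral_comp_snd_eq (fun s => V.eval s),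
    integral_const_mul]
  ring

theorem PotentialBounds.hasFiniteEnergy_of_integrable {V : ℝ[X]} {γ K : ℝ}
    (hK : PotentialBounds V γ K) {ν : ProbabilityMeasure ℝ}
    (hd : ((ν : Measure ℝ).prod (ν : Measure ℝ)) {p | p.1 = p.2} = 0)
    (hi : Integrable (logKernel V) ((ν : Measure ℝ).prod (ν : Measure ℝ))) :
    HasFiniteEnergy V ν := by
  have h1 : Integrable (fun z : ℝ × ℝ => V.eval z.1) ((ν : Measure ℝ).prod (ν : Measure ℝ)) := by
    have h2 : Integrable (fun z => 4 * (logKernel V z + K) + K)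
        ((ν : Measure ℝ).prod (ν : Measure ℝ)) :=
      ((hi.add (integrable_const K)).const_mul 4).add (integrable_const K)
    refine h2.mono (V.continuous.comp continuous_fst).aestronglyMeasurable
      (Eventually.of_forall fun z => ?_)
    have e1 := hK.le_logKernel z
    have e2 := hK.neg_le z.1
    have e3 := hK.neg_le z.2
    have e4 := hK.K_nonneg
    rw [Real.norm_eq_abs, Real.norm_eq_abs, abs_of_nonneg (a := 4 * (logKernel V z + K) + K)
      (by linarith), abs_le]
    constructor <;> linarith
  have h2 : Integrable (fun s => V.eval s) (ν : Measure ℝ) :=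
    (measurePreserving_fst.integrable_comp V.continuous.aestronglyMeasurable).mp h1
  refine ⟨hd, h2, ?_⟩
  simp only [log_one_div_eq V]
  exact ((hi.const_mul 2).sub h1).sub (integrable_comp_snd_of_integrable h2)

/-- Uniform bounds on the truncated energies bound the energy. -/
theorem PotentialBounds.energy_le_of_truncKernel {V : ℝ[X]} {γ K : ℝ}
    (hK : PotentialBounds V γ K) {ν : ProbabilityMeasure ℝ} {e : ℝ}
    (h : ∀ M : ℕ, ∫ z, truncKernel V M z ∂(ν : Measure ℝ).prod (ν : Measure ℝ) ≤ e) :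
    HasFiniteEnergy V ν ∧ energy V ν ≤ e := by
  set P := (ν : Measure ℝ).prod (ν : Measure ℝ) with hP
  have hnn : ∀ M z, 0 ≤ truncKernel V M z + K := fun M z => by
    have := hK.neg_le_truncKernel M z; linarith
  have hint : ∀ M, Integrable (fun z => truncKernel V M z + K) P := fun M =>
    (hK.integrable_truncKernel M P).add (integrable_const K)
  have hle : ∀ M, ∫ z, (truncKernel V M z + K) ∂P ≤ e + K := fun M => by
    rw [integral_add (hK.integrable_truncKernel M P) (integrable_const K)]
    simpa using h M
  have hd : P {p | p.1 = p.2} = 0 := by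
    have h1 : ∀ M : ℕ, (M : ℝ) / 2 * P.real {p | p.1 = p.2} ≤ e + K := fun M => by
      refine le_trans ?_ ((mul_meas_ge_le_integral_of_nonneg (Eventually.of_forall (hnn M)) (hint M)
        ((M : ℝ) / 2)).trans (hle M))
      refine mul_le_mul_of_nonneg_left (measureReal_mono fun p hp => ?_) (by positivity)
      have hp' : p = (p.1, p.1) := Prod.ext rfl (Eq.symm hp)
      have := hK.le_truncKernel_diag M p.1
      rw [← hp'] at this
      change (M : ℝ) / 2 ≤ _
      linarith
    by_contra hne
    have hpos : 0 < P.real {p | p.1 = p.2} :=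
      lt_of_le_of_ne measureReal_nonneg fun h0 => hne ((measureReal_eq_zero_iff).mp h0.symm)
    obtain ⟨M, hM⟩ := exists_nat_gt ((e + K) / (P.real {p | p.1 = p.2} / 2))
    rw [div_lt_iff₀ (by positivity)] at hM
    have := h1 M
    linarith
  have hoff : ∀ᵐ z ∂P, z.1 ≠ z.2 := measure_eq_zero_iff_ae_notMem.mp hd
  have hlim : ∀ᵐ z ∂P, ENNReal.ofReal (logKernel V z + K) =
      liminf (fun M : ℕ => ENNReal.ofReal (truncKernel V M z + K)) atTop := by
    filter_upwards [hoff] with z hz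
    refine (Tendsto.liminf_eq ?_).symm
    refine tendsto_const_nhds.congr' ?_
    filter_upwards [eventually_truncKernel_eq V hz] with M hM
    rw [hM]
  have hfatou : ∫⁻ z, ENNReal.ofReal (logKernel V z + K) ∂P ≤ ENNReal.ofReal (e + K) := by
    rw [lintegral_congr_ae hlim]
    refine (lintegral_liminf_le fun M => ?_).trans ?_
    · exact ((continuous_truncKernel V M).measurable.add_const K).ennreal_ofReal
    · refine liminf_le_of_frequently_le' (Frequently.of_forall fun M => ?_)
      rw [← ofReal_integral_eq_lintegral_ofReal (hint M) (Eventually.of_forall (hnn M))]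
      exact ENNReal.ofReal_le_ofReal (hle M)
  have hknn : ∀ z, 0 ≤ logKernel V z + K := fun z => by
    have := hK.neg_le_logKernel z; linarith
  have hkint : Integrable (fun z => logKernel V z + K) P := by
    refine ⟨((measurable_logKernel V).add_const K).aestronglyMeasurable, ?_⟩
    rw [hasFiniteIntegral_iff_ofReal (Eventually.of_forall hknn)]
    exact hfatou.trans_lt ENNReal.ofReal_lt_top
  have hki : Integrable (logKernel V) P :=
    (hkint.sub (integrable_const K)).congr (Eventually.of_forall fun z => by simp)
  have hfin := hK.hasFiniteEnergy_of_integrable hd hki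
  refine ⟨hfin, ?_⟩
  have he0 : 0 ≤ e + K := (integral_nonneg (hnn 0)).trans (hle 0)
  have : ∫ z, (logKernel V z + K) ∂P ≤ e + K := by
    rw [integral_eq_lintegral_of_nonneg_ae (Eventually.of_forall hknn) hkint.aestronglyMeasurable]
    exact ENNReal.toReal_le_of_le_ofReal he0 hfatou
  rw [integral_add hki (integrable_const K)] at this
  rw [hfin.energy_eq]
  simpa using this

/-- A tight sequence of measures with asymptotically bounded truncated energies has a limit point
of bounded energy. -/
theorem PotentialBounds.exists_subseq_tendsto {V : ℝ[X]} {γ K : ℝ} (hK : PotentialBounds V γ K)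
    {ν : ℕ → ProbabilityMeasure ℝ} {C e : ℝ}
    (htight : ∀ j, ∀ r : ℝ, 0 < r → (ν j : Measure ℝ) {x | r < |x|} ≤ ENNReal.ofReal (C / r ^ 2))
    (he : ∀ M : ℕ, ∀ ε : ℝ, 0 < ε → ∀ᶠ j in atTop,
      ∫ z, truncKernel V M z ∂(ν j : Measure ℝ).prod (ν j : Measure ℝ) ≤ e + ε) :
    ∃ (κ : ProbabilityMeasure ℝ) (φ : ℕ → ℕ), StrictMono φ ∧ Tendsto (ν ∘ φ) atTop (𝓝 κ) ∧
      HasFiniteEnergy V κ ∧ energy V κ ≤ e := by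
  have hcpt : IsCompact (closure (Set.range ν)) := by
    refine isCompact_closure_of_isTightMeasureSet
      (isTightMeasureSet_of_tendsto_measure_norm_gt ?_)
    have h0 : Tendsto (fun r : ℝ => ENNReal.ofReal (C / r ^ 2)) atTop (𝓝 0) := by
      have : Tendsto (fun r : ℝ => C / r ^ 2) atTop (𝓝 0) :=
        tendsto_const_nhds.div_atTop (tendsto_pow_atTop two_ne_zero)
      simpa using ENNReal.tendsto_ofReal this
    refine tendsto_of_tendsto_of_tendsto_of_le_of_le' tendsto_const_nhds h0
      (Eventually.of_forall fun _ => zero_le) ?_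
    filter_upwards [eventually_gt_atTop 0] with r hr
    refine iSup₂_le ?_
    rintro _ ⟨_, ⟨j, rfl⟩, rfl⟩
    simpa using htight j r hr
  obtain ⟨κ, -, φ, hφ, hlim⟩ := hcpt.tendsto_subseq fun j => subset_closure (Set.mem_range_self j)
  refine ⟨κ, φ, hφ, hlim, hK.energy_le_of_truncKernel fun M => ?_⟩
  let f : BoundedContinuousFunction (ℝ × ℝ) ℝ :=
    BoundedContinuousFunction.ofNormedAddCommGroup (truncKernel V M) (continuous_truncKernel V M)
      (M + K) (hK.abs_truncKernel_le M)
  have h2 : Tendsto (fun j => (ν (φ j)).prod (ν (φ j))) atTop (𝓝 (κ.prod κ)) :=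
    (ProbabilityMeasure.continuous_prod.tendsto (κ, κ)).comp (hlim.prodMk_nhds hlim)
  have h3 := (ProbabilityMeasure.tendsto_iff_forall_integral_tendsto.mp h2) f
  refine le_of_forall_pos_le_add fun ε hε => ?_
  exact le_of_tendsto h3 (hφ.tendsto_atTop.eventually (he M ε hε))

/-! ## Equilibrium measures -/

theorem HasFiniteEnergy.nullSingletonClass {V : ℝ[X]} {ν : ProbabilityMeasure ℝ}
    (h : HasFiniteEnergy V ν) : NullSingletonClass (ν : Measure ℝ) := by
  refine ⟨fun x => ?_⟩
  have h1 : ((ν : Measure ℝ).prod (ν : Measure ℝ)) ({x} ×ˢ {x}) = 0 :=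
    measure_mono_null (fun p hp => by
      have hp' : p.1 = x ∧ p.2 = x := hp
      exact hp'.1.trans hp'.2.symm) h.diagonal
  rw [Measure.prod_prod, mul_self_eq_zero] at h1
  exact h1

/-- The uniform distribution on the unit interval. -/
noncomputable def uniformUnit : ProbabilityMeasure ℝ :=
  ⟨volume.restrict (Set.Icc 0 1), ⟨by simp⟩⟩

theorem integrable_log_abs_sub_uniformUnit :
    Integrable (fun z : ℝ × ℝ => Real.log |z.1 - z.2|)
      ((uniformUnit : Measure ℝ).prod (uniformUnit : Measure ℝ)) := by
  have hm : Measurable fun z : ℝ × ℝ => Real.log |z.1 - z.2| := by fun_prop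
  refine ⟨hm.aestronglyMeasurable, ?_⟩
  set g : ℝ → ℝ≥0∞ := (Set.Icc (-1) 1).indicator fun u => ‖Real.log |u|‖ₑ with hg
  have hgm : Measurable g := by
    have : Measurable fun u : ℝ => ‖Real.log |u|‖ₑ := by fun_prop
    exact this.indicator measurableSet_Icc
  have hgfin : ∫⁻ u, g u < ⊤ := by
    rw [hg, lintegral_indicator measurableSet_Icc]
    have : IntegrableOn Real.log (Set.Icc (-1) 1) volume := by
      rw [integrableOn_Icc_iff_integrableOn_Ioc]
      exact (intervalIntegrable_iff_integrableOn_Ioc_of_le (by norm_num)).mp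
        intervalIntegral.intervalIntegrable_log'
    simpa only [Real.log_abs, HasFiniteIntegral] using this.2
  have hinner : ∀ s ∈ Set.Icc (0 : ℝ) 1,
      ∫⁻ t in Set.Icc (0 : ℝ) 1, ‖Real.log |s - t|‖ₑ ≤ ∫⁻ u, g u := fun s hs => by
    rw [← lintegral_sub_left_eq_self g s, ← lintegral_indicator measurableSet_Icc]
    refine lintegral_mono fun t => ?_
    by_cases ht : t ∈ Set.Icc (0 : ℝ) 1
    · have hst : s - t ∈ Set.Icc (-1 : ℝ) 1 :=
        ⟨by linarith [hs.1, ht.2], by linarith [hs.2, ht.1]⟩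
      rw [Set.indicator_of_mem ht, hg, Set.indicator_of_mem hst]
    · rw [Set.indicator_of_notMem ht]
      exact zero_le
  rw [HasFiniteIntegral, lintegral_prod _ hm.enorm.aemeasurable]
  refine lt_of_le_of_lt ?_ hgfin
  change ∫⁻ s in Set.Icc (0 : ℝ) 1, ∫⁻ t in Set.Icc (0 : ℝ) 1, ‖Real.log |s - t|‖ₑ ≤ _
  refine (setLIntegral_mono measurable_const hinner).trans ?_
  simp

theorem hasFiniteEnergy_uniformUnit {V : ℝ[X]} {γ K : ℝ} (hK : PotentialBounds V γ K) :
    HasFiniteEnergy V uniformUnit := by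
  have hsupp : ∀ᵐ x ∂(uniformUnit : Measure ℝ), |x| ≤ 1 := by
    filter_upwards [ae_restrict_mem measurableSet_Icc] with x hx
    exact abs_le.mpr ⟨by linarith [hx.1], hx.2⟩
  have hV : Integrable (fun s => V.eval s) (uniformUnit : Measure ℝ) :=
    integrable_of_continuous_of_support hsupp V.continuous
  refine hK.hasFiniteEnergy_of_integrable ?_ ?_
  · rw [Measure.measure_prod_null (measurableSet_eq_fun measurable_fst measurable_snd)]
    refine Eventually.of_forall fun x => ?_
    have : Prod.mk x ⁻¹' {p : ℝ × ℝ | p.1 = p.2} = {x} := by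
      ext y
      exact eq_comm
    change (uniformUnit : Measure ℝ) (Prod.mk x ⁻¹' {p : ℝ × ℝ | p.1 = p.2}) = 0
    rw [this]
    exact Measure.restrict_apply_eq_zero' measurableSet_Icc |>.mpr
      (measure_mono_null Set.inter_subset_left (measure_singleton x))
  · exact ((integrable_comp_fst_of_integrable hV).add (integrable_comp_snd_of_integrable hV)).div_const 2
      |>.sub (integrable_log_abs_sub_uniformUnit.div_const 2)

section Equilibrium

variable {V : ℝ[X]} {γ K : ℝ}

/-- An equilibrium measure has compact support: otherwise conditioning on a large interval would
decrease its energy. -/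
theorem IsEquilibriumMeasure.exists_abs_le (hK : PotentialBounds V γ K) {ν : ProbabilityMeasure ℝ}
    (h : IsEquilibriumMeasure V ν) : ∃ R : ℝ, ∀ᵐ x ∂(ν : Measure ℝ), |x| ≤ R := by
  have hγ := hK.γ_pos
  set E := energy V ν with hE
  set P := (ν : Measure ℝ).prod (ν : Measure ℝ) with hP
  have hki := h.1.integrable_logKernel
  set R := √(max 0 (4 * (E + 1 + K) / γ)) with hR
  have hR2 : E + 1 + K ≤ γ * R ^ 2 / 4 := by
    rw [hR, Real.sq_sqrt (le_max_left _ _)]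
    have := mul_le_mul_of_nonneg_left (le_max_right 0 (4 * (E + 1 + K) / γ)) hγ.le
    rw [mul_div_cancel₀ _ hγ.ne'] at this
    linarith
  have hfar : ∀ s, R < |s| → E + 1 + K ≤ γ * s ^ 2 / 4 := fun s hs => by
    have : R ^ 2 ≤ s ^ 2 := by
      rw [← sq_abs s]
      exact pow_le_pow_left₀ (Real.sqrt_nonneg _) hs.le 2
    have := mul_le_mul_of_nonneg_left this hγ.le
    linarith
  set S : Set ℝ := {x | |x| ≤ R} with hS
  have hSm : MeasurableSet S := measurableSet_le measurable_abs measurable_const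
  refine ⟨R, ?_⟩
  set p := (ν : Measure ℝ).real S with hp
  have hp0 : 0 ≤ p := measureReal_nonneg
  have hp1 : p ≤ 1 := measureReal_le_one
  suffices hp' : p = 1 by
    have h0 : (ν : Measure ℝ).real Sᶜ = 0 := by
      rw [measureReal_compl hSm, probReal_univ, ← hp, hp', sub_self]
    exact (measureReal_eq_zero_iff).mp h0
  by_contra hne
  have hlt : p < 1 := lt_of_le_of_ne hp1 hne
  have hPS : P.real (S ×ˢ S) = p * p := measureReal_prod_prod _ _
  have hPSm : MeasurableSet (S ×ˢ S) := hSm.prod hSm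
  have hsplit : E = ∫ z in S ×ˢ S, logKernel V z ∂P + ∫ z in (S ×ˢ S)ᶜ, logKernel V z ∂P := by
    rw [integral_add_compl hPSm hki, hE, h.1.energy_eq]
  have hout : (E + 1) * (1 - p * p) ≤ ∫ z in (S ×ˢ S)ᶜ, logKernel V z ∂P := by
    have h1 : P.real (S ×ˢ S)ᶜ = 1 - p * p := by
      rw [measureReal_compl hPSm, probReal_univ, hPS]
    have h2 : ∫ _ in (S ×ˢ S)ᶜ, (E + 1) ∂P = (E + 1) * (1 - p * p) := by
      rw [setIntegral_const, h1, smul_eq_mul, mul_comm]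
    rw [← h2]
    refine setIntegral_mono_on (integrable_const _).integrableOn hki.integrableOn hPSm.compl
      fun z hz => ?_
    have e1 := hK.le_logKernel z
    have e2 := hK.sq_le z.1
    have e3 := hK.sq_le z.2
    have e4 : 0 ≤ γ * z.1 ^ 2 := by positivity
    have e5 : 0 ≤ γ * z.2 ^ 2 := by positivity
    by_cases hz1 : |z.1| ≤ R
    · have hz2 : R < |z.2| := by
        by_contra hcon
        exact hz ⟨hz1, not_lt.mp hcon⟩
      have := hfar _ hz2
      linarith
    · have := hfar _ (not_le.mp hz1)
      linarith
  by_cases hpz : p = 0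
  · have : ∫ z in S ×ˢ S, logKernel V z ∂P = 0 := by
      refine setIntegral_measure_zero _ ?_
      rw [← measureReal_eq_zero_iff, hPS, hpz, mul_zero]
    rw [hpz] at hout
    linarith
  have hνS : (ν : Measure ℝ) S ≠ 0 := fun h0 => hpz (by rw [hp, measureReal_def, h0]; simp)
  have : IsProbabilityMeasure ((ν : Measure ℝ)[|S]) := cond_isProbabilityMeasure hνS
  let ν' : ProbabilityMeasure ℝ := ⟨(ν : Measure ℝ)[|S], this⟩
  have hprod : (ν' : Measure ℝ).prod (ν' : Measure ℝ) =
      (((ν : Measure ℝ) S)⁻¹ * ((ν : Measure ℝ) S)⁻¹) • P.restrict (S ×ˢ S) := by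
    change ((ν : Measure ℝ)[|S]).prod ((ν : Measure ℝ)[|S]) = _
    rw [ProbabilityTheory.cond, Measure.prod_smul_left, Measure.prod_smul_right, smul_smul,
      Measure.prod_restrict]
  have hfin : HasFiniteEnergy V ν' := by
    refine hK.hasFiniteEnergy_of_integrable ?_ ?_
    · rw [hprod, Measure.smul_apply, smul_eq_mul]
      have : P.restrict (S ×ˢ S) {p | p.1 = p.2} = 0 :=
        le_antisymm ((Measure.restrict_apply_le _ _).trans h.1.diagonal.le) zero_le
      rw [this, mul_zero]
    · rw [hprod]
      refine hki.integrableOn.integrable.smul_measure ?_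
      exact ENNReal.mul_ne_top (ENNReal.inv_ne_top.mpr hνS) (ENNReal.inv_ne_top.mpr hνS)
  have hle := h.2 ν' hfin
  rw [hfin.energy_eq, hprod, integral_smul_measure, ENNReal.toReal_mul, ENNReal.toReal_inv,
    smul_eq_mul, ← measureReal_def, ← hp, ← hE] at hle
  have hppos : 0 < p := lt_of_le_of_ne hp0 (Ne.symm hpz)
  have hle' : p * p * E ≤ ∫ z in S ×ˢ S, logKernel V z ∂P := by
    have := mul_le_mul_of_nonneg_left hle (by positivity : 0 ≤ p * p)
    have e : p * p * (p⁻¹ * p⁻¹ * ∫ z in S ×ˢ S, logKernel V z ∂P) =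
        ∫ z in S ×ˢ S, logKernel V z ∂P := by
      field_simp
    rwa [e] at this
  nlinarith

theorem neg_log_one_add_le {u : ℝ} (hu : |u| ≤ 1 / 2) : -Real.log (1 + u) ≤ -u + 2 * u ^ 2 := by
  obtain ⟨h1, h2⟩ := abs_le.mp hu
  have hp : 0 < 1 + u := by linarith
  have h3 := Real.one_sub_inv_le_log_of_pos hp
  have h4 : u - 2 * u ^ 2 ≤ 1 - (1 + u)⁻¹ := by
    have e : 1 - (1 + u)⁻¹ = u / (1 + u) := by field_simp; ring
    rw [e, le_div_iff₀ hp]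
    nlinarith [mul_nonneg (sq_nonneg u) (by linarith : 0 ≤ 1 + 2 * u)]
  linarith

/-- The equilibrium measure satisfies the loop equation, by perturbation of the identity map. -/
theorem IsEquilibriumMeasure.loopEquation (hK : PotentialBounds V γ K) {c : ℝ} (hc : 0 ≤ c)
    (hV : ∀ x : ℝ, c ≤ V.derivative.derivative.eval x) {ν : ProbabilityMeasure ℝ}
    (h : IsEquilibriumMeasure V ν) : LoopEquation V (ν : Measure ℝ) := by
  intro f
  obtain ⟨R, hR⟩ := h.exists_abs_le hK
  set P := (ν : Measure ℝ).prod (ν : Measure ℝ) with hP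
  have hki := h.1.integrable_logKernel
  obtain ⟨Q, hQ0, hQ⟩ := exists_abs_diffQuot_le f R
  obtain ⟨F, hF0, hF⟩ := f.continuous.exists_abs_le_of_abs_le R
  obtain ⟨D, hD0, hD⟩ := exists_abs_diffQuot_le V.derivative (R + F)
  have hVf : Integrable (fun x => V.derivative.eval x * f.eval x) (ν : Measure ℝ) :=
    integrable_of_continuous_of_support hR (V.derivative.continuous.mul f.continuous)
  have hq : Integrable (diffQuot f) P := by
    simpa using integrable_mul_diffQuot hR 1 f
  set G : ℝ × ℝ → ℝ := fun z => (V.derivative.eval z.1 * f.eval z.1 +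
    V.derivative.eval z.2 * f.eval z.2) / 2 - diffQuot f z / 2 with hG
  have hGi : Integrable G P := (((integrable_comp_fst_of_integrable hVf).add
    (integrable_comp_snd_of_integrable hVf)).div_const 2).sub (hq.div_const 2)
  have hGint : ∫ z, G z ∂P = ∫ x, V.derivative.eval x * f.eval x ∂(ν : Measure ℝ) -
      1 / 2 * ∫ z, diffQuot f z ∂P := by
    have h1 : Integrable (fun z : ℝ × ℝ => (V.derivative.eval z.1 * f.eval z.1 +
        V.derivative.eval z.2 * f.eval z.2) / 2) P :=
      ((integrable_comp_fst_of_integrable hVf).add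
        (integrable_comp_snd_of_integrable hVf)).div_const 2
    rw [hG, integral_sub h1 (hq.div_const 2), integral_div, integral_div,
      integral_add (integrable_comp_fst_of_integrable hVf) (integrable_comp_snd_of_integrable hVf),
      integral_comp_fst_eq (fun x => V.derivative.eval x * f.eval x),
      integral_comp_snd_eq (fun x => V.derivative.eval x * f.eval x)]
    ring
  set B := D * F ^ 2 + Q ^ 2 with hB
  suffices hkey : ∀ᶠ t in 𝓝 (0 : ℝ), 0 ≤ t * (∫ z, G z ∂P + B * t) by
    have h0 := eq_zero_of_mul_nonneg (h := fun t => ∫ z, G z ∂P + B * t)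
      (by fun_prop) hkey
    simp only [mul_zero, add_zero] at h0
    rw [hGint] at h0
    linarith
  have hsmall : ∀ᶠ t in 𝓝 (0 : ℝ), |t| * Q < 1 / 2 := by
    have : Tendsto (fun t : ℝ => |t| * Q) (𝓝 0) (𝓝 (|0| * Q)) :=
      (continuous_abs.mul continuous_const).tendsto 0
    simp only [abs_zero, zero_mul] at this
    exact this.eventually_lt_const (by norm_num)
  have hone : ∀ᶠ t in 𝓝 (0 : ℝ), |t| < 1 := by
    have : Tendsto (fun t : ℝ => |t|) (𝓝 0) (𝓝 |0|) := continuous_abs.tendsto 0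
    simp only [abs_zero] at this
    exact this.eventually_lt_const one_pos
  filter_upwards [hsmall, hone] with t ht ht1
  set g : ℝ → ℝ := fun x => x + t * f.eval x with hg
  have hgc : Continuous g := by
    have := f.continuous
    fun_prop
  let ν' : ProbabilityMeasure ℝ := ν.map hgc.measurable.aemeasurable
  have hprod : (ν' : Measure ℝ).prod (ν' : Measure ℝ) = P.map (Prod.map g g) :=
    Measure.map_prod_map _ _ hgc.measurable hgc.measurable
  have hgm : Measurable (Prod.map g g) := hgc.measurable.prodMap hgc.measurable
  have hoff : ∀ᵐ z ∂P, z.1 ≠ z.2 := measure_eq_zero_iff_ae_notMem.mp h.1.diagonal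
  have hsupp := ae_prod_abs_le hR
  have hsub : ∀ z : ℝ × ℝ, z.1 ≠ z.2 → g z.1 - g z.2 = (z.1 - z.2) * (1 + t * diffQuot f z) := by
    intro z hz
    have : z.1 - z.2 ≠ 0 := sub_ne_zero.mpr hz
    simp only [hg, diffQuot]
    field_simp
    ring
  have htq : ∀ z : ℝ × ℝ, |z.1| ≤ R → |z.2| ≤ R → |t * diffQuot f z| ≤ 1 / 2 := fun z h1 h2 => by
    rw [abs_mul]
    exact (mul_le_mul_of_nonneg_left (hQ z h1 h2) (abs_nonneg t)).trans ht.le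
  -- the change of the kernel
  set H : ℝ × ℝ → ℝ := fun z => (V.eval (g z.1) - V.eval z.1 + (V.eval (g z.2) - V.eval z.2)) / 2 -
    Real.log (1 + t * diffQuot f z) / 2 with hH
  have hcomp : ∀ᵐ z ∂P, logKernel V (Prod.map g g z) = logKernel V z + H z := by
    filter_upwards [hoff, hsupp] with z hz hz'
    obtain ⟨h1, -⟩ := abs_le.mp (htq z hz'.1 hz'.2)
    have hpos : 0 < 1 + t * diffQuot f z := by linarith
    simp only [logKernel, Prod.map_fst, Prod.map_snd, hsub z hz, hH]
    rw [abs_mul, Real.log_mul (abs_ne_zero.mpr (sub_ne_zero.mpr hz)) (abs_ne_zero.mpr hpos.ne'),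
      Real.log_abs (1 + _)]
    ring
  have hΔ : Continuous fun x => V.eval (g x) - V.eval x :=
    (V.continuous.comp hgc).sub V.continuous
  have hΔi : Integrable (fun x => V.eval (g x) - V.eval x) (ν : Measure ℝ) :=
    integrable_of_continuous_of_support hR hΔ
  have hlog : Integrable (fun z => Real.log (1 + t * diffQuot f z)) P := by
    refine Integrable.of_bound (C := Real.log 2) ?_ ?_
    · exact (((measurable_diffQuot f).const_mul t).const_add 1).log.aestronglyMeasurable
    · filter_upwards [hsupp] with z hz
      obtain ⟨h1, h2⟩ := abs_le.mp (htq z hz.1 hz.2)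
      rw [Real.norm_eq_abs, abs_le]
      constructor
      · rw [← Real.log_inv]
        exact Real.log_le_log (by norm_num) (by linarith)
      · exact Real.log_le_log (by linarith) (by linarith)
  have hHi : Integrable H P := (((integrable_comp_fst_of_integrable hΔi).add
    (integrable_comp_snd_of_integrable hΔi)).div_const 2).sub (hlog.div_const 2)
  have hki' : Integrable (fun z => logKernel V z + H z) P := hki.add hHi
  have hfin : HasFiniteEnergy V ν' := by
    refine hK.hasFiniteEnergy_of_integrable ?_ ?_
    · rw [hprod, Measure.map_apply hgm (measurableSet_eq_fun measurable_fst measurable_snd)]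
      refine measure_eq_zero_iff_ae_notMem.mpr ?_
      filter_upwards [hoff, hsupp] with z hz hz' hcon
      have h0 : g z.1 - g z.2 = 0 := sub_eq_zero.mpr hcon
      obtain ⟨h1, -⟩ := abs_le.mp (htq z hz'.1 hz'.2)
      rw [hsub z hz] at h0
      exact mul_ne_zero (sub_ne_zero.mpr hz) (by linarith) h0
    · rw [hprod, integrable_map_measure (measurable_logKernel V).aestronglyMeasurable
        hgm.aemeasurable]
      exact hki'.congr (hcomp.mono fun z hz => hz.symm)
  have hle := h.2 ν' hfin
  rw [hfin.energy_eq, h.1.energy_eq, hprod, integral_map hgm.aemeasurable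
    (measurable_logKernel V).aestronglyMeasurable, integral_congr_ae hcomp,
    integral_add hki hHi] at hle
  have hHle : ∫ z, H z ∂P ≤ ∫ z, (t * G z + B * t ^ 2) ∂P := by
    refine integral_mono_ae hHi ((hGi.const_mul t).add (integrable_const _)) ?_
    filter_upwards [hsupp] with z hz
    have hVle : ∀ x, |x| ≤ R → V.eval (g x) - V.eval x ≤
        t * (V.derivative.eval x * f.eval x) + D * F ^ 2 * t ^ 2 := fun x hx => by
      have h1 := Polynomial.tangent_add_sq_le hV x (g x)
      have h2 : 0 ≤ c / 2 * (x - g x) ^ 2 := by positivity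
      have hfx := hF x hx
      have hgx : |g x| ≤ R + F := by
        refine (abs_add_le _ _).trans (add_le_add hx ?_)
        rw [abs_mul]
        calc |t| * |f.eval x| ≤ 1 * F := mul_le_mul ht1.le hfx (abs_nonneg _) zero_le_one
          _ = F := one_mul F
      have h3 : V.derivative.eval (g x) * (x - g x) =
          -(t * (V.derivative.eval x * f.eval x)) -
            (V.derivative.eval (g x) - V.derivative.eval x) * (t * f.eval x) := by
        simp only [hg]; ring
      have h4 : (V.derivative.eval (g x) - V.derivative.eval x) * (t * f.eval x) ≤
          D * F ^ 2 * t ^ 2 := by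
        have e : (V.derivative.eval (g x) - V.derivative.eval x) * (t * f.eval x) =
            diffQuot V.derivative (g x, x) * (t * f.eval x) ^ 2 := by
          by_cases hxx : t * f.eval x = 0
          · rw [hxx]; ring
          · have : g x - x = t * f.eval x := by simp [hg]
            simp only [diffQuot, this]
            field_simp
        rw [e, mul_pow]
        have e1 := le_of_abs_le (hD (g x, x) hgx (hx.trans (by linarith)))
        have e2 : f.eval x ^ 2 ≤ F ^ 2 := sq_le_sq' (abs_le.mp hfx).1 (abs_le.mp hfx).2
        calc diffQuot V.derivative (g x, x) * (t ^ 2 * f.eval x ^ 2)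
            ≤ D * (t ^ 2 * f.eval x ^ 2) := mul_le_mul_of_nonneg_right e1 (by positivity)
          _ ≤ D * (t ^ 2 * F ^ 2) := by gcongr
          _ = D * F ^ 2 * t ^ 2 := by ring
      linarith
    have e1 := hVle _ hz.1
    have e2 := hVle _ hz.2
    have e3 := neg_log_one_add_le (htq z hz.1 hz.2)
    have e4 : (t * diffQuot f z) ^ 2 ≤ Q ^ 2 * t ^ 2 := by
      obtain ⟨q1, q2⟩ := abs_le.mp (hQ z hz.1 hz.2)
      have := mul_le_mul_of_nonneg_left (sq_le_sq' q1 q2) (sq_nonneg t)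
      nlinarith
    simp only [hH, hG, hB]
    linarith
  rw [integral_add (hGi.const_mul t) (integrable_const _), integral_const_mul] at hHle
  simp only [integral_const, probReal_univ, one_smul] at hHle
  nlinarith

end Equilibrium

/-! ## Uniqueness and existence of the equilibrium measure -/

section EquilibriumUnique

variable {V : ℝ[X]} {γ K c : ℝ}

/-- The Jacobi coefficients of an equilibrium measure minimize the half-line Hamiltonian. -/
theorem IsEquilibriumMeasure.isHalfLineMinimizer (hK : PotentialBounds V γ K) (hc : 0 < c)
    (hV : ∀ x : ℝ, c ≤ V.derivative.derivative.eval x) {ν : ProbabilityMeasure ℝ}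
    (h : IsEquilibriumMeasure V ν) {R : ℝ} (hR : ∀ᵐ x ∂(ν : Measure ℝ), |x| ≤ R) :
    IsHalfLineMinimizer V (jacobiDiag (integralFunctional (ν : Measure ℝ) hR))
      (jacobiOff (integralFunctional (ν : Measure ℝ) hR)) := by
  have := h.1.nullSingletonClass
  have hcrit := (h.loopEquation hK hc.le hV).isHalfLineCritical hR
    (two_le_natDegree_of_deriv_pos hc hV)
  exact hcrit.isHalfLineMinimizer hc hV
    (jacobiOff_pos' (integralFunctional_one hR) (integralFunctional_mul_self_pos hR))
    ⟨R, abs_jacobi_le hR⟩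

theorem IsEquilibriumMeasure.unique (hK : PotentialBounds V γ K) (hc : 0 < c)
    (hV : ∀ x : ℝ, c ≤ V.derivative.derivative.eval x) {ν ν' : ProbabilityMeasure ℝ}
    (h : IsEquilibriumMeasure V ν) (h' : IsEquilibriumMeasure V ν') : ν = ν' := by
  have := h.1.nullSingletonClass
  have := h'.1.nullSingletonClass
  obtain ⟨R, hR⟩ := h.exists_abs_le hK
  obtain ⟨R', hR'⟩ := h'.exists_abs_le hK
  have hm := h.isHalfLineMinimizer hK hc hV hR
  obtain ⟨ea, eb⟩ := hm.unique hc hV (h'.isHalfLineMinimizer hK hc hV hR')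
  obtain ⟨C, hC⟩ := hm.bounded
  obtain ⟨J, hJ⟩ := exists_isJacobiOperator (fun k => (hC k).1)
    (fun k => (abs_of_pos (hm.pos k)).trans_le (hC k).2)
  have hJ' := hJ
  rw [ea, eb] at hJ'
  refine Subtype.ext (eq_of_integral_pow_eq (ν := (ν : Measure ℝ)) hR' (fun m =>
    integrable_of_continuous_of_support hR (by fun_prop)) fun m => ?_)
  exact (integral_pow_eq_inner hR hJ m).trans (integral_pow_eq_inner hR' hJ' m).symm

theorem measure_abs_gt_le_of_integral_sq_le {ν : Measure ℝ} [IsProbabilityMeasure ν] {C : ℝ}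
    (hi : Integrable (fun x => x ^ 2) ν) (hC : ∫ x, x ^ 2 ∂ν ≤ C) {r : ℝ} (hr : 0 < r) :
    ν {x | r < |x|} ≤ ENNReal.ofReal (C / r ^ 2) := by
  have h1 := mul_meas_ge_le_integral_of_nonneg (μ := ν) (f := fun x : ℝ => x ^ 2)
    (Eventually.of_forall fun x => sq_nonneg x) hi (r ^ 2)
  have h2 : ν.real {x | r < |x|} ≤ ν.real {x | r ^ 2 ≤ x ^ 2} := by
    refine measureReal_mono fun x hx => ?_
    have hx' : r < |x| := hx
    change r ^ 2 ≤ x ^ 2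
    rw [← sq_abs x]
    gcongr
  rw [← ofReal_measureReal]
  refine ENNReal.ofReal_le_ofReal ?_
  rw [le_div_iff₀ (by positivity), mul_comm]
  exact (mul_le_mul_of_nonneg_left h2 (by positivity)).trans (h1.trans hC)

theorem PotentialBounds.integrable_sq (hK : PotentialBounds V γ K) {ν : Measure ℝ}
    [IsProbabilityMeasure ν] (hi : Integrable (fun s => V.eval s) ν) :
    Integrable (fun x => x ^ 2) ν := by
  have hγ := hK.γ_pos
  refine ((hi.add (integrable_const K)).div_const γ).mono (by fun_prop)
    (Eventually.of_forall fun x => ?_)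
  have := hK.sq_le x
  have h0 : 0 ≤ γ * x ^ 2 := by positivity
  simp only [Pi.add_apply]
  rw [Real.norm_of_nonneg (sq_nonneg x), Real.norm_of_nonneg (div_nonneg (by linarith) hγ.le),
    le_div_iff₀ hγ]
  linarith

theorem PotentialBounds.integral_sq_le (hK : PotentialBounds V γ K) {ν : Measure ℝ}
    [IsProbabilityMeasure ν] (hi : Integrable (fun s => V.eval s) ν) :
    ∫ x, x ^ 2 ∂ν ≤ (∫ x, V.eval x ∂ν + K) / γ := by
  have hγ := hK.γ_pos
  rw [le_div_iff₀ hγ, ← integral_mul_const]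
  have h1 : ∫ x, (V.eval x + K) ∂ν = ∫ x, V.eval x ∂ν + K := by
    rw [integral_add hi (integrable_const K)]; simp
  rw [← h1]
  refine integral_mono ((hK.integrable_sq hi).mul_const γ) (hi.add (integrable_const K))
    fun x => ?_
  have := hK.sq_le x
  simp only
  linarith

theorem PotentialBounds.integral_le_energy (hK : PotentialBounds V γ K) {ν : ProbabilityMeasure ℝ}
    (h : HasFiniteEnergy V ν) : ∫ x, V.eval x ∂(ν : Measure ℝ) ≤ 2 * energy V ν + K := by
  have h1 := integrable_comp_fst_of_integrable h.integrable_potential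
  have h2 := integrable_comp_snd_of_integrable h.integrable_potential
  have h3 : Integrable (fun z : ℝ × ℝ => (V.eval z.1 + V.eval z.2) / 4)
      ((ν : Measure ℝ).prod (ν : Measure ℝ)) := (h1.add h2).div_const 4
  have := integral_mono (h3.sub (integrable_const (K / 2))) h.integrable_logKernel hK.le_logKernel
  simp only [Pi.sub_apply] at this
  rw [← h.energy_eq, integral_sub h3 (integrable_const _), integral_div, integral_add h1 h2,
    integral_comp_fst_eq (fun x => V.eval x), integral_comp_snd_eq (fun x => V.eval x)] at this
  simp at this
  linarith

theorem PotentialBounds.neg_le_energy (hK : PotentialBounds V γ K) {ν : ProbabilityMeasure ℝ}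
    (h : HasFiniteEnergy V ν) : -K ≤ energy V ν := by
  rw [h.energy_eq]
  have := integral_mono (integrable_const (-K)) h.integrable_logKernel hK.neg_le_logKernel
  simpa using this

theorem PotentialBounds.exists_isEquilibriumMeasure (hK : PotentialBounds V γ K) :
    ∃ μ : ProbabilityMeasure ℝ, IsEquilibriumMeasure V μ := by
  set S : Set ℝ := {e | ∃ ν, HasFiniteEnergy V ν ∧ energy V ν = e} with hS
  have hne : S.Nonempty := ⟨_, uniformUnit, hasFiniteEnergy_uniformUnit hK, rfl⟩
  have hbdd : BddBelow S := ⟨-K, by rintro _ ⟨ν, hν, rfl⟩; exact hK.neg_le_energy hν⟩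
  have hex : ∀ j : ℕ, ∃ ν, HasFiniteEnergy V ν ∧ energy V ν < sInf S + 1 / ((j : ℝ) + 1) := fun j => by
    obtain ⟨_, ⟨ν, hν, rfl⟩, hlt⟩ := exists_lt_of_csInf_lt hne
      (lt_add_of_pos_right (sInf S) (Nat.one_div_pos_of_nat (α := ℝ) (n := j)))
    exact ⟨ν, hν, hlt⟩
  choose ν hfin hlt using hex
  refine Exists.elim (hK.exists_subseq_tendsto (ν := ν)
    (C := (2 * (sInf S + 1) + K + K) / γ) (e := sInf S) ?_ ?_) ?_
  rotate_left 2
  · rintro κ ⟨-, -, -, hκ, hle⟩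
    exact ⟨κ, hκ, fun ν' hν' => hle.trans (csInf_le hbdd ⟨ν', hν', rfl⟩)⟩
  · intro j r hr
    refine measure_abs_gt_le_of_integral_sq_le (hK.integrable_sq (hfin j).integrable_potential)
      ((hK.integral_sq_le (hfin j).integrable_potential).trans ?_) hr
    have h1 := hK.integral_le_energy (hfin j)
    have h2 := hlt j
    have h3 : 1 / ((j : ℝ) + 1) ≤ 1 := by
      rw [div_le_one (by positivity)]; linarith [(Nat.cast_nonneg j : (0 : ℝ) ≤ j)]
    have := hK.γ_pos
    gcongr
    linarith
  · intro M ε hε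
    have h1 := (tendsto_one_div_add_atTop_nhds_zero_nat (𝕜 := ℝ)).eventually_lt_const hε
    filter_upwards [h1] with j hj
    have h2 := hlt j
    rw [(hfin j).energy_eq] at h2
    have h3 := integral_mono_ae (hK.integrable_truncKernel M _) (hfin j).integrable_logKernel
      ((measure_eq_zero_iff_ae_notMem.mp (hfin j).diagonal).mono
        fun z hz => truncKernel_le_logKernel V M hz)
    linarith

end EquilibriumUnique

/-! ## Discrete energies -/

/-- `n ∑ V(x_i) - ∑_{i < j} log |x_i - x_j|`. -/
noncomputable def discreteEnergy (V : ℝ[X]) {n : ℕ} (x : Fin n → ℝ) : ℝ :=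
  n * ∑ i, V.eval (x i) - ∑ i, ∑ j ∈ Finset.Ioi i, Real.log |x i - x j|

theorem sum_logKernel (V : ℝ[X]) {n : ℕ} (x : Fin n → ℝ) :
    ∑ i, ∑ j, logKernel V (x i, x j) = discreteEnergy V x := by
  have h1 : ∑ i, ∑ j, Real.log |x i - x j| =
      2 * ∑ i, ∑ j ∈ Finset.Ioi i, Real.log |x i - x j| := by
    have := Finset.sum_sum_Ioi_add_eq_sum_sum_off_diag fun i j => Real.log |x i - x j|
    have e : ∀ i, ∑ j, Real.log |x i - x j| = ∑ j ∈ {i}ᶜ, Real.log |x j - x i| := fun i => by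
      rw [← Finset.sum_add_sum_compl {i}, Finset.sum_singleton, sub_self, abs_zero, Real.log_zero,
        zero_add]
      exact Finset.sum_congr rfl fun j _ => by rw [abs_sub_comm]
    rw [Finset.sum_congr rfl fun i _ => e i, ← this, Finset.mul_sum]
    refine Finset.sum_congr rfl fun i _ => ?_
    rw [Finset.mul_sum]
    refine Finset.sum_congr rfl fun j _ => ?_
    rw [abs_sub_comm (x j), two_mul]
  simp only [logKernel, Finset.sum_sub_distrib, ← Finset.sum_div, Finset.sum_add_distrib, h1,
    Finset.sum_const, Finset.card_univ, Fintype.card_fin, nsmul_eq_mul, discreteEnergy,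
    ← Finset.mul_sum]
  ring

theorem feketeDensity_eq_of_injective (V : ℝ[X]) {n : ℕ} {x : Fin n → ℝ}
    (hx : Function.Injective x) : feketeDensity V x = Real.exp (-discreteEnergy V x) := by
  have h : ∀ i, ∀ j ∈ Finset.Ioi i, 0 < |x i - x j| := fun i j hj =>
    abs_pos.mpr (sub_ne_zero.mpr (hx.ne (Finset.mem_Ioi.mp hj).ne))
  rw [feketeDensity, discreteEnergy, neg_sub, sub_eq_add_neg, add_comm, Real.exp_add, Real.exp_sum]
  congr 1
  refine Finset.prod_congr rfl fun i _ => ?_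
  rw [Real.exp_sum]
  exact Finset.prod_congr rfl fun j hj => (Real.exp_log (h i j hj)).symm

theorem injective_of_prod_ne_zero {n : ℕ} {x : Fin n → ℝ}
    (h : ∏ i, ∏ j ∈ Finset.Ioi i, |x i - x j| ≠ 0) : Function.Injective x := by
  have hlt : ∀ i j, i < j → x i ≠ x j := fun i j hij e => h <|
    Finset.prod_eq_zero (Finset.mem_univ i)
      (Finset.prod_eq_zero (Finset.mem_Ioi.mpr hij) (by rw [e, sub_self, abs_zero]))
  intro i j e
  rcases lt_trichotomy i j with hij | hij | hij
  · exact absurd e (hlt i j hij)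
  · exact hij
  · exact absurd e.symm (hlt j i hij)

theorem injective_of_feketeDensity_pos {V : ℝ[X]} {n : ℕ} {x : Fin n → ℝ}
    (h : 0 < feketeDensity V x) : Function.Injective x :=
  injective_of_prod_ne_zero (right_ne_zero_of_mul h.ne')

section Empirical

variable {n : ℕ} [NeZero n]

theorem integral_empiricalDistribution (x : Fin n → ℝ) (g : ℝ → ℝ) :
    ∫ s, g s ∂(empiricalDistribution x : Measure ℝ) = (n : ℝ)⁻¹ * ∑ i, g (x i) := by
  change ∫ s, g s ∂((n : ℝ≥0∞)⁻¹ • ∑ i, Measure.dirac (x i)) = _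
  rw [integral_smul_measure, integral_finsetSum_measure fun i _ => integrable_dirac (by simp)]
  simp

theorem integrable_empiricalDistribution (x : Fin n → ℝ) (g : ℝ → ℝ) :
    Integrable g (empiricalDistribution x : Measure ℝ) := by
  change Integrable g ((n : ℝ≥0∞)⁻¹ • ∑ i, Measure.dirac (x i))
  refine Integrable.smul_measure (integrable_finsetSum_measure.mpr fun i _ =>
    integrable_dirac (by simp)) ?_
  exact ENNReal.inv_ne_top.mpr (Nat.cast_ne_zero.mpr (NeZero.ne n))

variable {V : ℝ[X]} {γ K : ℝ} (hK : PotentialBounds V γ K)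
include hK

theorem PotentialBounds.integral_truncKernel_le {x : Fin n → ℝ} (hx : Function.Injective x) (M : ℕ) :
    ∫ z, truncKernel V M z ∂(empiricalDistribution x : Measure ℝ).prod
      (empiricalDistribution x : Measure ℝ) ≤ discreteEnergy V x / n ^ 2 + (M + K) / n := by
  have hn : (0 : ℝ) < n := Nat.cast_pos.mpr (NeZero.pos n)
  rw [integral_prod _ (hK.integrable_truncKernel M _)]
  simp only [integral_empiricalDistribution]
  rw [← Finset.mul_sum, ← mul_assoc, ← sum_logKernel]
  have h1 : ∀ i j, truncKernel V M (x i, x j) ≤ logKernel V (x i, x j) +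
      if i = j then (M + K) else 0 := fun i j => by
    by_cases h : i = j
    · subst h
      rw [if_pos rfl]
      have h2 := truncKernel_le V M (x i, x i)
      have h3 := hK.neg_le_logKernel (x i, x i)
      linarith
    · rw [if_neg h, add_zero]
      exact truncKernel_le_logKernel V M (hx.ne h)
  have h2 : ∑ i, ∑ j, truncKernel V M (x i, x j) ≤
      ∑ i, ∑ j, logKernel V (x i, x j) + n * (M + K) := by
    calc ∑ i, ∑ j, truncKernel V M (x i, x j)
        ≤ ∑ i, ∑ j, (logKernel V (x i, x j) + if i = j then (M + K) else 0) :=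
          Finset.sum_le_sum fun i _ => Finset.sum_le_sum fun j _ => h1 i j
      _ = _ := by simp [Finset.sum_add_distrib]; ring
  calc (n : ℝ)⁻¹ * (n : ℝ)⁻¹ * ∑ i, ∑ j, truncKernel V M (x i, x j)
      ≤ (n : ℝ)⁻¹ * (n : ℝ)⁻¹ * (∑ i, ∑ j, logKernel V (x i, x j) + n * (M + K)) := by gcongr
    _ = _ := by field_simp

theorem PotentialBounds.sum_eval_le (x : Fin n → ℝ) :
    ∑ i, V.eval (x i) ≤ 2 * discreteEnergy V x / n + n * K := by
  have hn : (0 : ℝ) < n := Nat.cast_pos.mpr (NeZero.pos n)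
  have h1 : ∑ i, ∑ j, ((V.eval (x i) + V.eval (x j)) / 4 - K / 2) ≤ discreteEnergy V x := by
    rw [← sum_logKernel]
    exact Finset.sum_le_sum fun i _ => Finset.sum_le_sum fun j _ => hK.le_logKernel (x i, x j)
  simp only [Finset.sum_sub_distrib, ← Finset.sum_div, Finset.sum_add_distrib, Finset.sum_const,
    Finset.card_univ, Fintype.card_fin, nsmul_eq_mul, ← Finset.mul_sum] at h1
  have h2 : 2 * discreteEnergy V x / n + n * K = (2 * discreteEnergy V x + n * (n * K)) / n := by
    field_simp
  rw [h2, le_div_iff₀ hn]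
  linarith

theorem PotentialBounds.sum_sq_le (x : Fin n → ℝ) :
    γ * ∑ i, x i ^ 2 ≤ 2 * discreteEnergy V x / n + 2 * n * K := by
  have h1 := hK.sum_eval_le x
  have h2 : γ * ∑ i, x i ^ 2 ≤ ∑ i, (V.eval (x i) + K) := by
    rw [Finset.mul_sum]
    exact Finset.sum_le_sum fun i _ => hK.sq_le (x i)
  rw [Finset.sum_add_distrib] at h2
  simp at h2
  linarith

theorem PotentialBounds.empirical_abs_gt_le {x : Fin n → ℝ} {e : ℝ}
    (he : discreteEnergy V x ≤ n ^ 2 * e) {r : ℝ} (hr : 0 < r) :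
    (empiricalDistribution x : Measure ℝ) {s | r < |s|} ≤
      ENNReal.ofReal ((2 * e + 2 * K) / γ / r ^ 2) := by
  have hn : (0 : ℝ) < n := Nat.cast_pos.mpr (NeZero.pos n)
  refine measure_abs_gt_le_of_integral_sq_le (integrable_empiricalDistribution x _) ?_ hr
  rw [integral_empiricalDistribution, le_div_iff₀ hK.γ_pos, inv_mul_eq_div, div_mul_eq_mul_div,
    div_le_iff₀ hn, mul_comm _ γ]
  refine (hK.sum_sq_le x).trans ?_
  have : 2 * discreteEnergy V x / n ≤ 2 * (n ^ 2 * e) / n := by gcongr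
  refine (add_le_add_left this _).trans_eq ?_
  field_simp

end Empirical

section Averaging

variable {V : ℝ[X]} {ν : ProbabilityMeasure ℝ}

theorem map_pi_pair {n : ℕ} (ν : Measure ℝ) [IsProbabilityMeasure ν] {i j : Fin n} (h : i ≠ j) :
    MeasurePreserving (fun ω : Fin n → ℝ => (ω i, ω j)) (Measure.pi fun _ => ν) (ν.prod ν) := by
  have hi := measurePreserving_eval (fun _ : Fin n => ν) i
  have hj := measurePreserving_eval (fun _ : Fin n => ν) j
  refine ⟨by fun_prop, ?_⟩
  have hind := (iIndepFun_pi (μ := fun _ : Fin n => ν) (X := fun _ x => x)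
    fun _ => aemeasurable_id).indepFun h
  have := (indepFun_iff_map_prod_eq_prod_map_map hi.aemeasurable hj.aemeasurable).mp hind
  rw [hi.map_eq, hj.map_eq] at this
  exact this

/-- Some configuration of distinct points has discrete energy at most the average. -/
theorem HasFiniteEnergy.exists_injective_discreteEnergy_le (h : HasFiniteEnergy V ν) (n : ℕ) :
    ∃ x : Fin n → ℝ, Function.Injective x ∧ discreteEnergy V x ≤
      n ^ 2 * energy V ν + n * (∫ s, V.eval s ∂(ν : Measure ℝ) - energy V ν) := by
  set P := Measure.pi fun _ : Fin n => (ν : Measure ℝ) with hP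
  have hterm : ∀ i j : Fin n, Integrable (fun ω : Fin n → ℝ => logKernel V (ω i, ω j)) P ∧
      ∫ ω, logKernel V (ω i, ω j) ∂P =
        if i = j then ∫ s, V.eval s ∂(ν : Measure ℝ) else energy V ν := fun i j => by
    by_cases hij : i = j
    · subst hij
      have hi := measurePreserving_eval (fun _ : Fin n => (ν : Measure ℝ)) i
      have e : ∀ s, logKernel V (s, s) = V.eval s := fun s => by simp [logKernel]
      simp only [e, if_true]
      refine ⟨hi.integrable_comp_of_integrable h.integrable_potential, ?_⟩
      rw [← hi.map_eq, integral_map hi.aemeasurable V.continuous.aestronglyMeasurable]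
    · have hp := map_pi_pair (ν : Measure ℝ) hij
      rw [if_neg hij]
      refine ⟨hp.integrable_comp_of_integrable h.integrable_logKernel, ?_⟩
      rw [h.energy_eq, ← hp.map_eq, integral_map hp.aemeasurable
        (measurable_logKernel V).aestronglyMeasurable]
  have hint : Integrable (discreteEnergy V (n := n)) P := by
    have : Integrable (fun ω : Fin n → ℝ => ∑ i, ∑ j, logKernel V (ω i, ω j)) P :=
      integrable_finsetSum _ fun i _ => integrable_finsetSum _ fun j _ => (hterm i j).1
    simpa only [sum_logKernel] using this
  have hval : ∫ ω, discreteEnergy V ω ∂P =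
      n ^ 2 * energy V ν + n * (∫ s, V.eval s ∂(ν : Measure ℝ) - energy V ν) := by
    simp only [← sum_logKernel]
    rw [integral_finsetSum _ fun i _ => integrable_finsetSum _ fun j _ => (hterm i j).1]
    have : ∀ i : Fin n, ∫ ω, ∑ j, logKernel V (ω i, ω j) ∂P =
        n * energy V ν + (∫ s, V.eval s ∂(ν : Measure ℝ) - energy V ν) := fun i => by
      rw [integral_finsetSum _ fun j _ => (hterm i j).1, Finset.sum_congr rfl fun j _ => (hterm i j).2]
      have e : ∀ j, (if i = j then ∫ s, V.eval s ∂(ν : Measure ℝ) else energy V ν) =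
          energy V ν + if i = j then (∫ s, V.eval s ∂(ν : Measure ℝ) - energy V ν) else 0 := fun j => by
        split_ifs <;> ring
      rw [Finset.sum_congr rfl fun j _ => e j, Finset.sum_add_distrib]
      simp
    rw [Finset.sum_congr rfl fun i _ => this i]
    simp
    ring
  have hnull : P {ω | ¬ Function.Injective ω} = 0 := by
    have hsub : {ω : Fin n → ℝ | ¬ Function.Injective ω} ⊆
        ⋃ (i : Fin n) (j : Fin n) (_ : i ≠ j), {ω | ω i = ω j} := by
      intro ω hω
      simp only [Function.Injective, not_forall, Set.mem_ofPred_eq] at hω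
      obtain ⟨i, j, e, hij⟩ := hω
      simp only [Set.mem_iUnion]
      exact ⟨i, j, hij, e⟩
    refine measure_mono_null hsub (measure_iUnion_null fun i => measure_iUnion_null fun j =>
      measure_iUnion_null fun hij => ?_)
    exact (map_pi_pair (ν : Measure ℝ) hij).quasiMeasurePreserving.preimage_null h.diagonal
  obtain ⟨x, hx, hle⟩ := exists_notMem_null_le_integral hint hnull
  exact ⟨x, not_not.mp hx, hle.trans hval.le⟩

end Averaging

/-- Configurations whose empirical distribution is far from the equilibrium measure have large
energy. -/
theorem IsEquilibriumMeasure.exists_lt_discreteEnergy {V : ℝ[X]} {γ K c : ℝ}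
    (hK : PotentialBounds V γ K) (hc : 0 < c)
    (hV : ∀ x : ℝ, c ≤ V.derivative.derivative.eval x) {μ : ProbabilityMeasure ℝ}
    (h : IsEquilibriumMeasure V μ) {U : Set (ProbabilityMeasure ℝ)} (hU : U ∈ 𝓝 μ) :
    ∃ η : ℝ, 0 < η ∧ ∃ N : ℕ, ∀ n ≥ N, ∀ x : Fin (n + 1) → ℝ, Function.Injective x →
      empiricalDistribution x ∉ U →
        ((n + 1 : ℕ) : ℝ) ^ 2 * (energy V μ + η) ≤ discreteEnergy V x := by
  by_contra! hcon
  choose n hn x hx hxU hlt using fun j : ℕ => hcon (1 / ((j : ℝ) + 1)) Nat.one_div_pos_of_nat j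
  have hone : ∀ j : ℕ, 1 / ((j : ℝ) + 1) ≤ 1 := fun j => by
    rw [div_le_one (by positivity)]; linarith [(Nat.cast_nonneg j : (0 : ℝ) ≤ j)]
  refine Exists.elim (hK.exists_subseq_tendsto
    (ν := fun j => empiricalDistribution (x j)) (C := (2 * (energy V μ + 1) + 2 * K) / γ)
    (e := energy V μ) ?_ ?_) ?_
  rotate_left 2
  · rintro κ ⟨φ, -, hlim, hκ, hle⟩
    have heq : IsEquilibriumMeasure V κ := ⟨hκ, fun ν' hν' => hle.trans (h.2 ν' hν')⟩
    rw [heq.unique hK hc hV h] at hlim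
    obtain ⟨j, hj⟩ := (hlim.eventually hU).exists
    exact hxU _ hj
  · intro j r hr
    refine hK.empirical_abs_gt_le ((hlt j).le.trans ?_) hr
    gcongr
    exact hone j
  · intro M ε hε
    have h0 : Tendsto (fun j : ℕ => 1 / ((j : ℝ) + 1) + (M + K) * (1 / ((j : ℝ) + 1))) atTop
        (𝓝 0) := by
      have := tendsto_one_div_add_atTop_nhds_zero_nat (𝕜 := ℝ)
      simpa using this.add (this.const_mul ((M : ℝ) + K))
    filter_upwards [h0.eventually_lt_const hε] with j hj
    refine (hK.integral_truncKernel_le (hx j) M).trans ?_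
    have hpos : (0 : ℝ) < ((n j + 1 : ℕ) : ℝ) := by positivity
    have h1 : discreteEnergy V (x j) / ((n j + 1 : ℕ) : ℝ) ^ 2 ≤
        energy V μ + 1 / ((j : ℝ) + 1) := by
      rw [div_le_iff₀ (by positivity), mul_comm]
      exact (hlt j).le
    have h2 : (M + K) / ((n j + 1 : ℕ) : ℝ) ≤ (M + K) * (1 / ((j : ℝ) + 1)) := by
      rw [div_eq_mul_one_div]
      have h3 : (0 : ℝ) ≤ M + K := add_nonneg (Nat.cast_nonneg M) hK.K_nonneg
      refine mul_le_mul_of_nonneg_left ?_ h3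
      refine one_div_le_one_div_of_le (by positivity) ?_
      have := hn j
      exact_mod_cast Nat.succ_le_succ this
    linarith

/-! ## Fekete points -/

section Fekete

variable {V : ℝ[X]} {γ K c : ℝ}

theorem continuous_feketeDensity (V : ℝ[X]) (n : ℕ) :
    Continuous (feketeDensity V : (Fin n → ℝ) → ℝ) := by
  have := V.continuous
  unfold feketeDensity
  fun_prop

theorem PotentialBounds.exists_isFekete (hK : PotentialBounds V γ K) (n : ℕ) :
    ∃ x : Fin n → ℝ, IsFekete V x := by
  rcases Nat.eq_zero_or_pos n with rfl | hn
  · exact ⟨0, fun y => (congrArg _ (Subsingleton.elim y 0)).le⟩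
  have : NeZero n := ⟨hn.ne'⟩
  have hn' : (0 : ℝ) < n := Nat.cast_pos.mpr hn
  let x₀ : Fin n → ℝ := fun i => (i : ℕ)
  have hx₀ : Function.Injective x₀ := fun i j e => Fin.ext (Nat.cast_injective e)
  have hpos : 0 < feketeDensity V x₀ := by
    rw [feketeDensity_eq_of_injective V hx₀]; exact Real.exp_pos _
  refine (continuous_feketeDensity V n).exists_forall_ge' x₀ ?_
  set B := (2 * discreteEnergy V x₀ / n + 2 * n * K) / γ with hB
  filter_upwards [(isCompact_closedBall (0 : Fin n → ℝ) (√B)).compl_mem_cocompact] with y hy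
  by_contra! hlt
  have hyi := injective_of_feketeDensity_pos (hpos.trans hlt)
  rw [feketeDensity_eq_of_injective V hx₀, feketeDensity_eq_of_injective V hyi,
    Real.exp_lt_exp, neg_lt_neg_iff] at hlt
  refine hy ?_
  rw [mem_closedBall_zero_iff, pi_norm_le_iff_of_nonneg (Real.sqrt_nonneg _)]
  intro i
  rw [Real.norm_eq_abs]
  refine Real.abs_le_sqrt ?_
  rw [hB, le_div_iff₀ hK.γ_pos, mul_comm]
  have h1 : y i ^ 2 ≤ ∑ j, y j ^ 2 :=
    Finset.single_le_sum (f := fun j => y j ^ 2) (fun j _ => sq_nonneg _) (Finset.mem_univ i)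
  refine (mul_le_mul_of_nonneg_left h1 hK.γ_pos.le).trans ((hK.sum_sq_le y).trans ?_)
  gcongr

theorem IsFekete.injective {n : ℕ} {x : Fin n → ℝ} (h : IsFekete V x) : Function.Injective x := by
  let x₀ : Fin n → ℝ := fun i => (i : ℕ)
  have hx₀ : Function.Injective x₀ := fun i j e => Fin.ext (Nat.cast_injective e)
  refine injective_of_feketeDensity_pos (V := V) (lt_of_lt_of_le ?_ (h x₀))
  rw [feketeDensity_eq_of_injective V hx₀]
  exact Real.exp_pos _

theorem IsFekete.discreteEnergy_le {n : ℕ} {x : Fin n → ℝ} (h : IsFekete V x)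
    {ν : ProbabilityMeasure ℝ} (hν : HasFiniteEnergy V ν) : discreteEnergy V x ≤
      n ^ 2 * energy V ν + n * (∫ s, V.eval s ∂(ν : Measure ℝ) - energy V ν) := by
  obtain ⟨y, hy, hle⟩ := hν.exists_injective_discreteEnergy_le n
  have := h y
  rw [feketeDensity_eq_of_injective V hy, feketeDensity_eq_of_injective V h.injective,
    Real.exp_le_exp, neg_le_neg_iff] at this
  exact this.trans hle

theorem IsEquilibriumMeasure.tendsto_fekete (hK : PotentialBounds V γ K) (hc : 0 < c)
    (hV : ∀ x : ℝ, c ≤ V.derivative.derivative.eval x) {μ : ProbabilityMeasure ℝ}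
    (h : IsEquilibriumMeasure V μ) {x : ∀ n : ℕ, Fin n → ℝ} (hx : ∀ n, IsFekete V (x n)) :
    Tendsto (fun n : ℕ => empiricalDistribution (x (n + 1))) atTop (𝓝 μ) := by
  refine tendsto_def.mpr fun U hU => ?_
  obtain ⟨η, hη, N, hN⟩ := h.exists_lt_discreteEnergy hK hc hV hU
  set D := ∫ s, V.eval s ∂(μ : Measure ℝ) - energy V μ
  filter_upwards [eventually_ge_atTop N,
    tendsto_natCast_atTop_atTop.eventually_gt_atTop (D / η)] with n hn hn'
  by_contra hcon
  have h1 := hN n hn (x (n + 1)) (hx (n + 1)).injective hcon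
  have h2 := (hx (n + 1)).discreteEnergy_le h.1
  rw [div_lt_iff₀ hη] at hn'
  have hpos : (0 : ℝ) < ((n + 1 : ℕ) : ℝ) := by positivity
  have h3 : ((n + 1 : ℕ) : ℝ) ^ 2 * η ≤ ((n + 1 : ℕ) : ℝ) * D := by linarith
  have h4 : ((n + 1 : ℕ) : ℝ) * η ≤ D := by
    rw [sq, mul_assoc] at h3
    exact le_of_mul_le_mul_left h3 hpos
  push_cast at h4
  linarith

end Fekete

/-! ## The density of the beta ensemble -/

/-- Extension of a finite sequence by zero. -/
def zeroExtend {n : ℕ} (f : Fin n → ℝ) (k : ℕ) : ℝ :=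
  if h : k < n then f ⟨k, h⟩ else 0

theorem zeroExtend_coe {n : ℕ} (f : Fin n → ℝ) (k : Fin n) : zeroExtend f k = f k := by
  simp [zeroExtend]

theorem abs_zeroExtend_le {n : ℕ} {f : Fin n → ℝ} {C : ℝ} (hC : 0 ≤ C) (h : ∀ k, |f k| ≤ C)
    (k : ℕ) : |zeroExtend f k| ≤ C := by
  unfold zeroExtend
  split_ifs
  · exact h _
  · simpa using hC

theorem jacobiBlock_zeroExtend (n : ℕ) (a : Fin n → ℝ) (b : Fin (n - 1) → ℝ) :
    jacobiBlock n (zeroExtend a) (zeroExtend b) = jacobiMatrix n a b := by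
  unfold jacobiBlock
  congr 1 <;> ext k <;> exact zeroExtend_coe _ _

theorem trace_jacobiMatrix_mul_self (n : ℕ) (a : Fin n → ℝ) (b : Fin (n - 1) → ℝ) :
    (jacobiMatrix n a b * jacobiMatrix n a b).trace = ∑ k, a k ^ 2 + 2 * ∑ k, b k ^ 2 := by
  rw [← jacobiBlock_zeroExtend, trace_jacobiBlock_mul_self, Finset.sum_add_distrib,
    ← Finset.mul_sum, ← Fin.sum_univ_eq_sum_range (fun k => zeroExtend a k ^ 2)]
  simp only [zeroExtend_coe]
  congr 2
  cases n with
  | zero => simp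
  | succ m =>
    rw [Finset.sum_range_succ, if_neg (by omega), add_zero]
    rw [← Fin.sum_univ_eq_sum_range (fun k => if k + 1 < m + 1 then zeroExtend b k ^ 2 else 0) m]
    refine Finset.sum_congr rfl fun k _ => ?_
    rw [if_pos (by omega)]
    exact congrArg (· ^ 2) (zeroExtend_coe b k)

theorem sum_range_sum_range (f : ℕ → ℝ) (m : ℕ) :
    ∑ j ∈ Finset.range (m + 1), ∑ k ∈ Finset.range j, f k =
      ∑ k ∈ Finset.range m, ((m : ℝ) - k) * f k := by
  induction m with
  | zero => simp
  | succ m ih =>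
    have h : ∑ k ∈ Finset.range (m + 1), (((m + 1 : ℕ) : ℝ) - k) * f k =
        ∑ k ∈ Finset.range (m + 1), ((m : ℝ) - k) * f k + ∑ k ∈ Finset.range (m + 1), f k := by
      rw [← Finset.sum_add_distrib]
      refine Finset.sum_congr rfl fun k _ => ?_
      push_cast
      ring
    rw [Finset.sum_range_succ, ih, h, Finset.sum_range_succ (fun k => ((m : ℝ) - k) * f k)]
    simp

/-- `n tr V(T) - ∑ (n - k) log b_k`. -/
noncomputable def matrixEnergy (V : ℝ[X]) (n : ℕ) (a : Fin n → ℝ) (b : Fin (n - 1) → ℝ) : ℝ :=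
  n * (aeval (jacobiMatrix n a b) V).trace - ∑ k, ((n : ℝ) - 1 - k) * Real.log (b k)

theorem mul_betaHamiltonian (V : ℝ[X]) {β : ℝ} (hβ : β ≠ 0) (n : ℕ) [NeZero n] (a : Fin n → ℝ)
    (b : Fin (n - 1) → ℝ) :
    n * β * betaHamiltonian V β n a b = β * matrixEnergy V n a b + ∑ k, Real.log (b k) := by
  have hn : (n : ℝ) ≠ 0 := Nat.cast_ne_zero.mpr (NeZero.ne n)
  have h : ∑ k : Fin (n - 1), n * β * ((1 - ((k : ℝ) + 1) / n - 1 / (n * β)) * Real.log (b k)) =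
      β * ∑ k : Fin (n - 1), ((n : ℝ) - 1 - k) * Real.log (b k) - ∑ k, Real.log (b k) := by
    rw [Finset.mul_sum, ← Finset.sum_sub_distrib]
    refine Finset.sum_congr rfl fun k _ => ?_
    field_simp
    ring
  rw [betaHamiltonian, hamiltonian, matrixEnergy, mul_sub, Finset.mul_sum, h]
  ring

section Spectral

variable {n : ℕ} [NeZero n] {a : Fin n → ℝ} {b : Fin (n - 1) → ℝ}

theorem log_prod_zeroExtend (hb : ∀ k, 0 < b k) :
    Real.log |∏ j ∈ Finset.range n, ∏ k ∈ Finset.range j, zeroExtend b k| =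
      ∑ k : Fin (n - 1), ((n : ℝ) - 1 - k) * Real.log (b k) ∧
    0 < |∏ j ∈ Finset.range n, ∏ k ∈ Finset.range j, zeroExtend b k| := by
  have hpos : ∀ j ∈ Finset.range n, ∀ k ∈ Finset.range j, 0 < zeroExtend b k := by
    intro j hj k hk
    rw [Finset.mem_range] at hj hk
    rw [zeroExtend, dif_pos (by omega)]
    exact hb _
  have hp : 0 < ∏ j ∈ Finset.range n, ∏ k ∈ Finset.range j, zeroExtend b k :=
    Finset.prod_pos fun j hj => Finset.prod_pos fun k hk => hpos j hj k hk
  refine ⟨?_, abs_pos.mpr hp.ne'⟩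
  rw [abs_of_pos hp, Real.log_prod fun j hj => (Finset.prod_pos fun k hk => hpos j hj k hk).ne',
    Finset.sum_congr rfl fun j hj => Real.log_prod fun k hk => (hpos j hj k hk).ne']
  obtain ⟨m, rfl⟩ := Nat.exists_eq_succ_of_ne_zero (NeZero.ne n)
  refine (sum_range_sum_range _ m).trans ?_
  rw [← Fin.sum_univ_eq_sum_range (fun k => ((m : ℝ) - k) * Real.log (zeroExtend b k)) m]
  refine Finset.sum_congr rfl fun k _ => ?_
  have : zeroExtend b k = b k := zeroExtend_coe b k
  rw [this]
  push_cast
  ring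

theorem matrixEnergy_eq (V : ℝ[X]) (hb : ∀ k, 0 < b k) {O : Matrix (Fin n) (Fin n) ℝ}
    (hO : O.transpose * O = 1) {x : Fin n → ℝ}
    (h : jacobiMatrix n a b = O * Matrix.diagonal x * O.transpose) :
    Function.Injective x ∧ 0 < ∏ i, |O 0 i| ∧
      matrixEnergy V n a b = discreteEnergy V x - Real.log (∏ i, |O 0 i|) := by
  obtain ⟨h1, h2⟩ := log_prod_zeroExtend hb
  rw [← jacobiBlock_zeroExtend] at h
  rw [prod_offDiagonal_eq hO h] at h1 h2
  have hx := injective_of_prod_ne_zero (right_ne_zero_of_mul h2.ne')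
  have hO0 : 0 < ∏ i, |O 0 i| :=
    (Finset.prod_nonneg fun i _ => abs_nonneg _).lt_of_ne (left_ne_zero_of_mul h2.ne').symm
  refine ⟨hx, hO0, ?_⟩
  have hlt : ∀ i, ∀ j ∈ Finset.Ioi i, |x i - x j| ≠ 0 := fun i j hj =>
    abs_ne_zero.mpr (sub_ne_zero.mpr (hx.ne (Finset.mem_Ioi.mp hj).ne))
  rw [Real.log_mul hO0.ne' (right_ne_zero_of_mul h2.ne'),
    Real.log_prod fun i _ => Finset.prod_ne_zero_iff.mpr (hlt i),
    Finset.sum_congr rfl fun i _ => Real.log_prod (hlt i)] at h1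
  rw [matrixEnergy, ← h1, discreteEnergy, ← jacobiBlock_zeroExtend, h,
    trace_aeval_conj_diagonal hO]
  ring

theorem discreteEnergy_eigenvalues_le (V : ℝ[X]) (hb : ∀ k, 0 < b k) :
    Function.Injective (jacobiMatrix_isHermitian n a b).eigenvalues ∧
    discreteEnergy V (jacobiMatrix_isHermitian n a b).eigenvalues ≤ matrixEnergy V n a b := by
  obtain ⟨O, hO, h⟩ := (jacobiMatrix_isHermitian n a b).exists_eq_conj_diagonal
  obtain ⟨hx, hpos, he⟩ := matrixEnergy_eq V hb hO h
  refine ⟨hx, he ▸ ?_⟩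
  have h1 : ∏ i, |O 0 i| ≤ 1 := by
    refine Finset.prod_le_one (fun i _ => abs_nonneg _) fun i _ => ?_
    have e := congrFun (congrFun (mul_eq_one_comm.mp hO : O * O.transpose = 1) 0) 0
    rw [Matrix.mul_apply, Matrix.one_apply_eq] at e
    have h2 : O 0 i ^ 2 ≤ ∑ j, O 0 j * O.transpose j 0 := by
      rw [sq]
      exact Finset.single_le_sum (f := fun j => O 0 j * O.transpose j 0)
        (fun j _ => mul_self_nonneg _) (Finset.mem_univ i)
    exact (sq_le_one_iff_abs_le_one _).mp (h2.trans e.le)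
  linarith [Real.log_nonpos hpos.le h1]

end Spectral

theorem PotentialBounds.neg_le_discreteEnergy {V : ℝ[X]} {γ K : ℝ} (hK : PotentialBounds V γ K)
    {n : ℕ} (x : Fin n → ℝ) : -(K * n ^ 2) ≤ discreteEnergy V x := by
  rw [← sum_logKernel]
  calc -(K * n ^ 2) = ∑ _i : Fin n, ∑ _j : Fin n, -K := by simp; ring
    _ ≤ _ := Finset.sum_le_sum fun i _ => Finset.sum_le_sum fun j _ => hK.neg_le_logKernel _

theorem PotentialBounds.le_trace_aeval {V : ℝ[X]} {γ K : ℝ} (hK : PotentialBounds V γ K) {n : ℕ}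
    (a : Fin n → ℝ) (b : Fin (n - 1) → ℝ) :
    γ * (∑ k, a k ^ 2 + 2 * ∑ k, b k ^ 2) - n * K ≤ (aeval (jacobiMatrix n a b) V).trace := by
  obtain ⟨O, hO, h⟩ := (jacobiMatrix_isHermitian n a b).exists_eq_conj_diagonal
  have h2 := trace_aeval_conj_diagonal hO (jacobiMatrix_isHermitian n a b).eigenvalues (X ^ 2)
  have h1 := trace_aeval_conj_diagonal hO (jacobiMatrix_isHermitian n a b).eigenvalues V
  rw [← h] at h1 h2
  rw [map_pow, aeval_X, sq, trace_jacobiMatrix_mul_self] at h2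
  rw [h1, h2, Finset.mul_sum]
  calc _ = ∑ i, (γ * eval ((jacobiMatrix_isHermitian n a b).eigenvalues i) (X ^ 2) - K) := by
        simp [Finset.sum_sub_distrib]
    _ ≤ _ := Finset.sum_le_sum fun i _ => by
      have := hK.sq_le ((jacobiMatrix_isHermitian n a b).eigenvalues i)
      simp only [eval_pow, eval_X]
      linarith

/-! ## Upper bounds for the beta ensemble -/

theorem exists_integral_rpow_mul_exp_le {β κ : ℝ} (hβ : 0 < β) (hκ : 0 < κ) :
    ∃ C : ℝ, 0 ≤ C ∧ ∀ q : ℝ, 0 < q → q ≤ β →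
      ∫ x in Set.Ioi (0 : ℝ), x ^ (q - 1) * Real.exp (-κ * x ^ 2) ≤ 1 / q + C := by
  have hint : ∀ q : ℝ, 0 < q → IntegrableOn (fun x : ℝ => x ^ (q - 1) * Real.exp (-κ * x ^ 2))
      (Set.Ioi 0) := fun q hq => integrableOn_rpow_mul_exp_neg_mul_sq hκ (by linarith)
  have hsub : Set.Ioi (1 : ℝ) ⊆ Set.Ioi 0 := Set.Ioi_subset_Ioi zero_le_one
  refine ⟨∫ x in Set.Ioi (0 : ℝ), x ^ (β - 1) * Real.exp (-κ * x ^ 2),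
    setIntegral_nonneg measurableSet_Ioi fun x hx => ?_, fun q hq hqβ => ?_⟩
  · have : (0 : ℝ) < x := hx
    positivity
  have hu := (Set.Ioc_union_Ioi_eq_Ioi (zero_le_one' ℝ))
  have hi := hint q hq
  rw [← hu] at hi ⊢
  rw [setIntegral_union (Set.Ioc_disjoint_Ioi le_rfl) measurableSet_Ioi hi.left_of_union
    hi.right_of_union, hu]
  have hrpow : IntervalIntegrable (fun x : ℝ => x ^ (q - 1)) volume 0 1 :=
    intervalIntegral.intervalIntegrable_rpow' (by linarith)
  refine add_le_add ?_ ?_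
  · have h1 : ∫ x in Set.Ioc (0 : ℝ) 1, x ^ (q - 1) = 1 / q := by
      rw [← intervalIntegral.integral_of_le zero_le_one, integral_rpow (Or.inl (by linarith))]
      simp [Real.zero_rpow hq.ne']
    rw [← h1]
    refine setIntegral_mono_on hi.left_of_union
      ((intervalIntegrable_iff_integrableOn_Ioc_of_le zero_le_one).mp hrpow) measurableSet_Ioc
      fun x hx => ?_
    have hx0 : 0 < x := hx.1
    have : Real.exp (-κ * x ^ 2) ≤ 1 := Real.exp_le_one_iff.mpr (by nlinarith [sq_nonneg x])
    exact mul_le_of_le_one_right (by positivity) this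
  · refine (setIntegral_mono_on hi.right_of_union ((hint β hβ).mono_set hsub) measurableSet_Ioi
      fun x hx => ?_).trans (setIntegral_mono_set (hint β hβ) ?_ hsub.eventuallyLE)
    · have hx0 : 1 < x := hx
      gcongr
      exact hx0.le
    · refine (ae_restrict_iff' measurableSet_Ioi).mpr (ae_of_all _ fun x hx => ?_)
      have : (0 : ℝ) < x := hx
      simp only [Pi.zero_apply]
      positivity

/-- The density which dominates the density of the beta ensemble, up to a factor depending on the
energy of the eigenvalues only. -/
noncomputable def gammaWeight (β κ : ℝ) (n : ℕ) (p : (Fin n → ℝ) × (Fin (n - 1) → ℝ)) : ℝ :=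
  (∏ i, Real.exp (-κ * p.1 i ^ 2)) *
    ∏ k, (p.2 k ^ (β * ((n : ℝ) - 1 - k) / n - 1) * Real.exp (-(2 * κ) * p.2 k ^ 2))

theorem restrict_pos_eq (n m : ℕ) :
    (volume : Measure ((Fin n → ℝ) × (Fin m → ℝ))).restrict {p | ∀ k, 0 < p.2 k} =
      (volume : Measure (Fin n → ℝ)).prod (Measure.pi fun _ => volume.restrict (Set.Ioi 0)) := by
  have h : {p : (Fin n → ℝ) × (Fin m → ℝ) | ∀ k, 0 < p.2 k} =
      Set.univ ×ˢ Set.univ.pi fun _ => Set.Ioi 0 := by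
    ext p
    simp
  rw [h, ← Measure.restrict_pi_pi, ← volume_pi]
  conv_rhs => rw [← Measure.restrict_univ (μ := (volume : Measure (Fin n → ℝ)))]
  rw [Measure.prod_restrict]
  rfl

theorem measurableSet_pos (n m : ℕ) :
    MeasurableSet {p : (Fin n → ℝ) × (Fin m → ℝ) | ∀ k, 0 < p.2 k} := by
  refine MeasurableSet.congr (s := ⋂ k, {p | 0 < p.2 k}) (.iInter fun k => ?_) (by ext; simp)
  exact measurableSet_lt measurable_const (by fun_prop)

theorem exists_integral_gammaWeight_le {β κ : ℝ} (hβ : 0 < β) (hκ : 0 < κ) :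
    ∃ C : ℝ, 1 ≤ C ∧ ∀ (n : ℕ) [NeZero n],
      Integrable (gammaWeight β κ n) (volume.restrict {p | ∀ k, 0 < p.2 k}) ∧
      ∫ p in {p | ∀ k, 0 < p.2 k}, gammaWeight β κ n p ≤ (C * n) ^ (2 * n) := by
  obtain ⟨C, hC, hle⟩ := exists_integral_rpow_mul_exp_le hβ (mul_pos two_pos hκ)
  refine ⟨1 + √(Real.pi / κ) + 1 / β + C, ?_, fun n _ => ?_⟩
  · have := Real.sqrt_nonneg (Real.pi / κ)
    have : 0 < 1 / β := by positivity
    linarith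
  have hn : (1 : ℝ) ≤ n := Nat.one_le_cast.mpr (NeZero.pos n)
  have hn0 : (0 : ℝ) < n := by linarith
  have hq : ∀ k : Fin (n - 1), β / n ≤ β * ((n : ℝ) - 1 - k) / n ∧
      β * ((n : ℝ) - 1 - k) / n ≤ β := fun k => by
    have h1 : ((k : ℝ) + 1) + 1 ≤ n := by
      have := k.2
      exact_mod_cast (by omega : (k : ℕ) + 1 + 1 ≤ n)
    have h2 : (0 : ℝ) ≤ k := Nat.cast_nonneg _
    refine ⟨div_le_div_of_nonneg_right (by nlinarith) hn0.le, ?_⟩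
    rw [div_le_iff₀ hn0]
    exact mul_le_mul_of_nonneg_left (by linarith) hβ.le
  have hq0 : ∀ k : Fin (n - 1), 0 < β * ((n : ℝ) - 1 - k) / n := fun k =>
    (div_pos hβ hn0).trans_le (hq k).1
  rw [restrict_pos_eq]
  unfold gammaWeight
  constructor
  · refine Integrable.mul_prod (f := fun a : Fin n → ℝ => ∏ i, Real.exp (-κ * a i ^ 2))
      (g := fun b : Fin (n - 1) → ℝ => ∏ k, (b k ^ (β * ((n : ℝ) - 1 - k) / n - 1) *
        Real.exp (-(2 * κ) * b k ^ 2))) ?_ ?_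
    · exact Integrable.fintype_prod fun _ => integrable_exp_neg_mul_sq hκ
    · exact Integrable.fintype_prod (f := fun (k : Fin (n - 1)) (x : ℝ) =>
        x ^ (β * ((n : ℝ) - 1 - k) / n - 1) * Real.exp (-(2 * κ) * x ^ 2)) fun k =>
        integrableOn_rpow_mul_exp_neg_mul_sq (mul_pos two_pos hκ) (by linarith [hq0 k])
  · rw [integral_prod_mul (fun a : Fin n → ℝ => ∏ i, Real.exp (-κ * a i ^ 2))
      (fun b : Fin (n - 1) → ℝ => ∏ k, (b k ^ (β * ((n : ℝ) - 1 - k) / n - 1) *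
        Real.exp (-(2 * κ) * b k ^ 2))),
      integral_fintype_prod_volume_eq_prod (fun (_ : Fin n) (x : ℝ) => Real.exp (-κ * x ^ 2)),
      integral_fintype_prod_eq_prod (fun (k : Fin (n - 1)) (x : ℝ) =>
        x ^ (β * ((n : ℝ) - 1 - k) / n - 1) * Real.exp (-(2 * κ) * x ^ 2))]
    simp only [integral_gaussian, Finset.prod_const, Finset.card_univ, Fintype.card_fin]
    set D := 1 + √(Real.pi / κ) + 1 / β + C with hD
    have hs := Real.sqrt_nonneg (Real.pi / κ)
    have hβ' : 0 < 1 / β := by positivity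
    have hD1 : 1 ≤ D := by linarith
    have hDn : D ≤ D * n := le_mul_of_one_le_right (by linarith) hn
    calc _ ≤ (D * n) ^ n * ∏ _k : Fin (n - 1), D * n := by
          refine mul_le_mul (pow_le_pow_left₀ hs (by linarith) n) ?_ ?_ (by positivity)
          · refine Finset.prod_le_prod (fun k _ => ?_) fun k _ => ?_
            · refine setIntegral_nonneg measurableSet_Ioi fun x hx => ?_
              have : (0 : ℝ) < x := hx
              positivity
            · refine (hle _ (hq0 k) (hq k).2).trans ?_
              have h1 : 1 / (β * ((n : ℝ) - 1 - k) / n) ≤ 1 / β * n := by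
                refine (one_div_le_one_div_of_le (div_pos hβ hn0) (hq k).1).trans (le_of_eq ?_)
                field_simp
              have h2 : C ≤ C * n := le_mul_of_one_le_right hC hn
              have h3 : 0 ≤ (1 + √(Real.pi / κ)) * n := by positivity
              rw [hD]
              linarith
          · refine Finset.prod_nonneg fun k _ => setIntegral_nonneg measurableSet_Ioi fun x hx => ?_
            have : (0 : ℝ) < x := hx
            positivity
      _ ≤ (D * n) ^ n * (D * n) ^ n := by
          rw [Finset.prod_const, Finset.card_univ, Fintype.card_fin]
          exact mul_le_mul_of_nonneg_left
            (pow_le_pow_right₀ (by linarith) (Nat.sub_le n 1)) (by positivity)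
      _ = _ := by rw [← pow_add, two_mul]

theorem PotentialBounds.exp_neg_betaHamiltonian_le {V : ℝ[X]} {γ K β : ℝ}
    (hK : PotentialBounds V γ K) (hβ : 0 < β) {n : ℕ} [NeZero n] {E : ℝ}
    {p : (Fin n → ℝ) × (Fin (n - 1) → ℝ)} (hp : ∀ k, 0 < p.2 k)
    (hE : E ≤ matrixEnergy V n p.1 p.2) :
    Real.exp (-(n * β * betaHamiltonian V β n p.1 p.2)) ≤
      Real.exp (-(β * (1 - 1 / n) * E) + β * n * K) * gammaWeight β (β * γ) n p := by
  have hn : (1 : ℝ) ≤ n := Nat.one_le_cast.mpr (NeZero.pos n)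
  have hn0 : (n : ℝ) ≠ 0 := by linarith
  have hW : gammaWeight β (β * γ) n p = Real.exp (∑ i, -(β * γ) * p.1 i ^ 2 +
      ∑ k : Fin (n - 1), ((β * ((n : ℝ) - 1 - k) / n - 1) * Real.log (p.2 k) +
        -(2 * (β * γ)) * p.2 k ^ 2)) := by
    rw [Real.exp_add, Real.exp_sum, Real.exp_sum, gammaWeight]
    congr 1
    refine Finset.prod_congr rfl fun k _ => ?_
    rw [Real.exp_add, Real.rpow_def_of_pos (hp k), mul_comm (Real.log _)]
  rw [hW, ← Real.exp_add, Real.exp_le_exp, mul_betaHamiltonian V hβ.ne']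
  have h1 := hK.le_trace_aeval p.1 p.2
  have h2 : β * (1 - 1 / n) * E ≤ β * (1 - 1 / n) * matrixEnergy V n p.1 p.2 :=
    mul_le_mul_of_nonneg_left hE (mul_nonneg hβ.le (sub_nonneg.mpr
      ((div_le_one (by linarith)).mpr hn)))
  have h3 : β * (1 - 1 / n) * matrixEnergy V n p.1 p.2 = β * matrixEnergy V n p.1 p.2 -
      (β * (aeval (jacobiMatrix n p.1 p.2) V).trace -
        ∑ k : Fin (n - 1), (β * ((n : ℝ) - 1 - k) / n) * Real.log (p.2 k)) := by
    have h4 : ∑ k : Fin (n - 1), (β * ((n : ℝ) - 1 - k) / n) * Real.log (p.2 k) =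
        β / n * ∑ k : Fin (n - 1), ((n : ℝ) - 1 - k) * Real.log (p.2 k) := by
      rw [Finset.mul_sum]
      exact Finset.sum_congr rfl fun k _ => by ring
    rw [h4, matrixEnergy]
    field_simp
  have h5 := mul_le_mul_of_nonneg_left h1 hβ.le
  simp only [sub_mul, Finset.sum_add_distrib, Finset.sum_sub_distrib, one_mul, ← Finset.mul_sum]
    at h3 ⊢
  linarith

theorem PotentialBounds.exists_unnormalizedTridiagonalLaw_le {V : ℝ[X]} {γ K β : ℝ}
    (hK : PotentialBounds V γ K) (hβ : 0 < β) :
    ∃ C : ℝ, 1 ≤ C ∧ ∀ (n : ℕ) [NeZero n] (E : ℝ) (S : Set ((Fin n → ℝ) × (Fin (n - 1) → ℝ))),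
      (∀ p ∈ S, (∀ k, 0 < p.2 k) → E ≤ matrixEnergy V n p.1 p.2) →
        unnormalizedTridiagonalLaw V β n S ≤
          ENNReal.ofReal (Real.exp (-(β * (1 - 1 / n) * E) + β * n * K) * (C * n) ^ (2 * n)) := by
  obtain ⟨C, hC, h⟩ := exists_integral_gammaWeight_le hβ (mul_pos hβ hK.γ_pos)
  refine ⟨C, hC, fun n _ E S hS => ?_⟩
  obtain ⟨hint, hle⟩ := h n
  set c := Real.exp (-(β * (1 - 1 / n) * E) + β * n * K)
  have hB := measurableSet_pos n (n - 1)
  have hmeas : Measurable (gammaWeight β (β * γ) n) := by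
    unfold gammaWeight
    fun_prop
  rw [unnormalizedTridiagonalLaw, withDensity_apply', Measure.restrict_restrict' hB]
  calc ∫⁻ p in S ∩ {p | ∀ k, 0 < p.2 k},
        ENNReal.ofReal (Real.exp (-(n * β * betaHamiltonian V β n p.1 p.2)))
      ≤ ∫⁻ p in S ∩ {p | ∀ k, 0 < p.2 k}, ENNReal.ofReal (c * gammaWeight β (β * γ) n p) :=
        setLIntegral_mono (by fun_prop) fun p hp => ENNReal.ofReal_le_ofReal
          (hK.exp_neg_betaHamiltonian_le hβ hp.2 (hS p hp.1 hp.2))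
    _ ≤ ∫⁻ p in {p | ∀ k, 0 < p.2 k}, ENNReal.ofReal (c * gammaWeight β (β * γ) n p) :=
        lintegral_mono_set Set.inter_subset_right
    _ = ENNReal.ofReal (c * ∫ p in {p | ∀ k, 0 < p.2 k}, gammaWeight β (β * γ) n p) := by
        rw [← integral_const_mul, ofReal_integral_eq_lintegral_ofReal (hint.const_mul c)]
        refine (ae_restrict_iff' hB).mpr (ae_of_all _ fun p hp => ?_)
        have hp' : ∀ k, 0 < p.2 k := hp
        refine mul_nonneg (Real.exp_pos _).le (mul_nonneg (by positivity)
          (Finset.prod_nonneg fun k _ => ?_))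
        have := hp' k
        positivity
    _ ≤ _ := ENNReal.ofReal_le_ofReal (mul_le_mul_of_nonneg_left hle (Real.exp_pos _).le)

/-! ## Lower bounds for the beta ensemble -/

theorem trace_aeval_jacobiBlock_convex {V : ℝ[X]} {c : ℝ} (hc : 0 < c)
    (hV : ∀ x : ℝ, c ≤ V.derivative.derivative.eval x) (n : ℕ) (a b a' b' : ℕ → ℝ) {t : ℝ}
    (ht : 0 ≤ t) (ht' : t ≤ 1) :
    (aeval (jacobiBlock n ((1 - t) • a + t • a') ((1 - t) • b + t • b')) V).trace ≤
      (1 - t) * (aeval (jacobiBlock n a b) V).trace +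
        t * (aeval (jacobiBlock n a' b') V).trace := by
  set u := (1 - t) • a + t • a'
  set w := (1 - t) • b + t • b'
  have e1 : a - u = t • (a - a') := by ext; simp [u]; ring
  have e2 : b - w = t • (b - b') := by ext; simp [w]; ring
  have e3 : a' - u = (-(1 - t)) • (a - a') := by ext; simp [u]; ring
  have e4 : b' - w = (-(1 - t)) • (b - b') := by ext; simp [w]; ring
  have h1 := trace_aeval_jacobiBlock_tangent hV n u w a b
  have h2 := trace_aeval_jacobiBlock_tangent hV n u w a' b'
  have h3 := mul_nonneg (half_pos hc).le (trace_jacobiBlock_mul_self_nonneg n (a - u) (b - w))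
  have h4 := mul_nonneg (half_pos hc).le (trace_jacobiBlock_mul_self_nonneg n (a' - u) (b' - w))
  replace h1 := (add_le_add_right h3 _).trans h1
  replace h2 := (add_le_add_right h4 _).trans h2
  rw [add_zero, e1, e2, jacobiBlock_smul, Matrix.mul_smul, Matrix.trace_smul, smul_eq_mul] at h1
  rw [add_zero, e3, e4, jacobiBlock_smul, Matrix.mul_smul, Matrix.trace_smul, smul_eq_mul] at h2
  have := mul_le_mul_of_nonneg_left h1 (sub_nonneg.mpr ht')
  have := mul_le_mul_of_nonneg_left h2 ht
  linarith

theorem volume_prod_Icc_ge {n m : ℕ} {δ : ℝ} (hδ : 0 ≤ δ) (u : Fin n → ℝ) (w : Fin m → ℝ) :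
    ENNReal.ofReal (δ ^ (n + m)) ≤ (volume : Measure ((Fin n → ℝ) × (Fin m → ℝ)))
      (Set.Icc u (fun i => u i + 2 * δ) ×ˢ Set.Icc w (fun k => w k + δ)) := by
  rw [Measure.volume_eq_prod, Measure.prod_prod, Real.volume_Icc_pi, Real.volume_Icc_pi, pow_add,
    ENNReal.ofReal_mul (by positivity)]
  simp only [add_sub_cancel_left, Finset.prod_const, Finset.card_univ, Fintype.card_fin]
  rw [ENNReal.ofReal_pow hδ, ENNReal.ofReal_pow hδ]
  gcongr
  linarith

section LowerBound

variable {V : ℝ[X]} {c γ K β : ℝ}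

/-- Near a tridiagonal matrix of small energy the matrices have small energy. -/
theorem exists_matrixEnergy_le (hK : PotentialBounds V γ K) (hc : 0 < c)
    (hV : ∀ x : ℝ, c ≤ V.derivative.derivative.eval x) : ∃ C : ℝ, 0 ≤ C ∧
    ∀ (n : ℕ) [NeZero n] (a : Fin n → ℝ) (b : Fin (n - 1) → ℝ), (∀ k, 0 < b k) →
      -(K * n ^ 2) ≤ matrixEnergy V n a b → ∃ (u : Fin n → ℝ) (w : Fin (n - 1) → ℝ),
      ∀ p ∈ Set.Icc u (fun i => u i + 2 * (n : ℝ)⁻¹) ×ˢ Set.Icc w (fun k => w k + (n : ℝ)⁻¹),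
        (∀ k, 0 < p.2 k ∧ p.2 k ≤ b k + 2) ∧
          matrixEnergy V n p.1 p.2 ≤ matrixEnergy V n a b + C * n := by
  obtain ⟨K₂, hK₂, hent⟩ := exists_abs_entry_aeval_le (C := 2) (by norm_num) V
  refine ⟨K + K₂, add_nonneg hK.K_nonneg hK₂, fun n _ a b hb hE => ?_⟩
  have hn : (1 : ℝ) ≤ n := Nat.one_le_cast.mpr (NeZero.pos n)
  have hn0 : (0 : ℝ) < n := by linarith
  set δ := (n : ℝ)⁻¹ with hδ
  have hδ0 : 0 < δ := inv_pos.mpr hn0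
  have hδ1 : δ ≤ 1 := inv_le_one_of_one_le₀ hn
  have hnδ : n * δ = 1 := mul_inv_cancel₀ hn0.ne'
  refine ⟨fun i => (1 - δ) * a i - δ, fun k => (1 - δ) * b k + δ, ?_⟩
  rintro ⟨p, q⟩ ⟨⟨hp1, hp2⟩, ⟨hq1, hq2⟩⟩
  simp only at hp1 hp2 hq1 hq2 ⊢
  let s : Fin n → ℝ := fun i => n * (p i - (1 - δ) * a i)
  let t : Fin (n - 1) → ℝ := fun k => n * (q k - (1 - δ) * b k)
  have hs : ∀ i, p i = (1 - δ) * a i + δ * s i := fun i => by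
    simp only [s]
    linear_combination (-(p i - (1 - δ) * a i)) * hnδ
  have ht : ∀ k, q k = (1 - δ) * b k + δ * t k := fun k => by
    simp only [t]
    linear_combination (-(q k - (1 - δ) * b k)) * hnδ
  have hs2 : ∀ i, |s i| ≤ 2 := fun i => by
    have h1 := hp1 i
    have h2 := hp2 i
    simp only at h1 h2
    rw [hs i] at h1 h2
    rw [abs_le]
    constructor <;> nlinarith
  have ht2 : ∀ k, 1 ≤ t k ∧ t k ≤ 2 := fun k => by
    have h1 := hq1 k
    have h2 := hq2 k
    simp only at h1 h2
    rw [ht k] at h1 h2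
    constructor <;> nlinarith
  have hq0 : ∀ k, 0 < q k := fun k => by
    have h1 := hb k
    have h2 := (ht2 k).1
    have h3 := mul_nonneg (sub_nonneg.mpr hδ1) h1.le
    rw [ht k]
    nlinarith
  refine ⟨fun k => ⟨hq0 k, ?_⟩, ?_⟩
  · have h1 := hb k
    have h2 := (ht2 k).2
    rw [ht k]
    nlinarith
  have htr : (aeval (jacobiMatrix n p q) V).trace ≤
      (1 - δ) * (aeval (jacobiMatrix n a b) V).trace + δ * (n * K₂) := by
    have e : jacobiMatrix n p q = jacobiBlock n ((1 - δ) • zeroExtend a + δ • zeroExtend s)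
        ((1 - δ) • zeroExtend b + δ • zeroExtend t) := by
      unfold jacobiBlock
      congr 1
      · ext k
        simp [zeroExtend_coe, hs k]
      · ext k
        simp [zeroExtend_coe, ht k]
    rw [e]
    refine (trace_aeval_jacobiBlock_convex hc hV n _ _ _ _ hδ0.le hδ1).trans ?_
    rw [jacobiBlock_zeroExtend]
    gcongr
    rw [Matrix.trace]
    calc _ ≤ ∑ _i : Fin n, K₂ := Finset.sum_le_sum fun i _ => by
          refine (Matrix.entry_coe (aeval (jacobiBlock n (zeroExtend s) (zeroExtend t)) V)
            i i).ge.trans ?_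
          exact (le_abs_self _).trans (hent _ _ (abs_zeroExtend_le (by norm_num) hs2)
            (abs_zeroExtend_le (by norm_num) fun k => abs_le.mpr
              ⟨by linarith [(ht2 k).1], (ht2 k).2⟩) n i i)
      _ = _ := by simp
  have hlog : (1 - δ) * ∑ k : Fin (n - 1), ((n : ℝ) - 1 - k) * Real.log (b k) ≤
      ∑ k : Fin (n - 1), ((n : ℝ) - 1 - k) * Real.log (q k) := by
    rw [Finset.mul_sum]
    refine Finset.sum_le_sum fun k _ => ?_
    have hw : (0 : ℝ) ≤ (n : ℝ) - 1 - k := by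
      have h1 : ((k : ℝ) + 1) + 1 ≤ n := by
        have := k.2
        exact_mod_cast (by omega : (k : ℕ) + 1 + 1 ≤ n)
      linarith
    rw [mul_left_comm]
    refine mul_le_mul_of_nonneg_left ?_ hw
    have h1 := strictConcaveOn_log_Ioi.concaveOn.2 (hb k : b k ∈ Set.Ioi (0 : ℝ))
      (zero_lt_one.trans_le (ht2 k).1 : t k ∈ Set.Ioi (0 : ℝ)) (sub_nonneg.mpr hδ1) hδ0.le
      (by ring)
    simp only [smul_eq_mul] at h1
    rw [ht k]
    have h2 := mul_nonneg hδ0.le (Real.log_nonneg (ht2 k).1)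
    linarith
  have h1 : matrixEnergy V n p q ≤ (1 - δ) * matrixEnergy V n a b + n * K₂ := by
    have h2 := mul_le_mul_of_nonneg_left htr hn0.le
    have h3 : n * (δ * (n * K₂)) = n * K₂ := by rw [← mul_assoc, hnδ, one_mul]
    rw [mul_add, h3] at h2
    unfold matrixEnergy
    linarith
  have h2 : -(K * n) ≤ δ * matrixEnergy V n a b := by
    have h3 := mul_le_mul_of_nonneg_left hE hδ0.le
    have h4 : δ * -(K * n ^ 2) = -(K * n) * (n * δ) := by ring
    rwa [h4, hnδ, mul_one] at h3
  linarith

theorem HasFiniteEnergy.exists_matrixEnergy_le {ν : ProbabilityMeasure ℝ}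
    (hν : HasFiniteEnergy V ν) (hK : PotentialBounds V γ K) : ∃ C : ℝ, 0 ≤ C ∧
    ∀ (n : ℕ) [NeZero n], ∃ (a : Fin n → ℝ) (b : Fin (n - 1) → ℝ), (∀ k, 0 < b k) ∧
      -(K * n ^ 2) ≤ matrixEnergy V n a b ∧
      matrixEnergy V n a b ≤ n ^ 2 * energy V ν + C * n * (1 + Real.log n) ∧
      ∑ k, b k ^ 2 ≤ C * n := by
  set d := ∫ s, V.eval s ∂(ν : Measure ℝ) - energy V ν with hd
  have hγ := hK.γ_pos
  have hK0 := hK.K_nonneg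
  set L := (|energy V ν| + |d| + K) / γ with hL
  have hL0 : 0 ≤ L := by positivity
  refine ⟨1 + |d| + L, by positivity, fun n _ => ?_⟩
  have hn : (1 : ℝ) ≤ n := Nat.one_le_cast.mpr (NeZero.pos n)
  have hn0 : (0 : ℝ) < n := by linarith
  have hlog := Real.log_nonneg hn
  obtain ⟨x, hx, hle⟩ := hν.exists_injective_discreteEnergy_le n
  obtain ⟨a, b, O, hb, hO, h, hO0⟩ := exists_jacobiBlock_of_injective hx
  have hb' : ∀ k : Fin (n - 1), 0 < b k := fun k => hb k (by have := k.2; omega)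
  have hle' : discreteEnergy V x ≤ n ^ 2 * energy V ν + |d| * n :=
    hle.trans (by nlinarith [le_abs_self d])
  obtain ⟨-, -, he⟩ := matrixEnergy_eq V hb' hO h
  have hO1 : Real.log (∏ i, |O 0 i|) = -(n / 2 * Real.log n) := by
    simp only [hO0, abs_inv, abs_of_nonneg (Real.sqrt_nonneg _), Finset.prod_const,
      Finset.card_univ, Fintype.card_fin, Real.log_pow, Real.log_inv, Real.log_sqrt hn0.le]
    ring
  rw [hO1] at he
  have hnl := mul_nonneg hn0.le hlog
  refine ⟨fun i => a i, fun k => b k, hb', ?_, ?_, ?_⟩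
  · rw [he]
    have := hK.neg_le_discreteEnergy x
    linarith
  · rw [he]
    have h1 : 0 ≤ |d| * n * Real.log n := by positivity
    have h2 : 0 ≤ L * n * (1 + Real.log n) := by positivity
    linarith
  · have h2 := trace_aeval_conj_diagonal hO x (X ^ 2)
    rw [← h, map_pow, aeval_X, sq, jacobiBlock, trace_jacobiMatrix_mul_self] at h2
    simp only [eval_pow, eval_X] at h2
    have h3 : 0 ≤ ∑ k : Fin n, a k ^ 2 := Finset.sum_nonneg fun _ _ => sq_nonneg _
    have h4 := hK.sum_sq_le x
    rw [← h2] at h4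
    have h5 : discreteEnergy V x / n ≤ (|energy V ν| + |d|) * n := by
      rw [div_le_iff₀ hn0]
      have h6 := mul_le_mul_of_nonneg_left (le_abs_self (energy V ν)) (sq_nonneg (n : ℝ))
      have h7 : |d| * n ≤ |d| * n * n := le_mul_of_one_le_right (by positivity) hn
      linarith
    have h6 : ∑ k : Fin (n - 1), b k ^ 2 ≤ L * n := by
      rw [hL, div_mul_eq_mul_div, le_div_iff₀ hγ]
      have h7 := mul_nonneg hγ.le h3
      have h8 : 2 * discreteEnergy V x / n = 2 * (discreteEnergy V x / n) := by ring
      linarith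
    have h7 : 0 ≤ (1 + |d|) * n := by positivity
    linarith

theorem HasFiniteEnergy.exists_le_unnormalizedTridiagonalLaw {ν : ProbabilityMeasure ℝ}
    (hν : HasFiniteEnergy V ν) (hK : PotentialBounds V γ K) (hc : 0 < c)
    (hV : ∀ x : ℝ, c ≤ V.derivative.derivative.eval x) (hβ : 0 < β) :
    ∃ C : ℝ, ∀ (n : ℕ) [NeZero n],
      ENNReal.ofReal (Real.exp (-(β * n ^ 2 * energy V ν) - C * n * (1 + Real.log n))) ≤
        unnormalizedTridiagonalLaw V β n Set.univ := by
  obtain ⟨C₁, hC₁, h₁⟩ := hν.exists_matrixEnergy_le hK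
  obtain ⟨C₂, hC₂, h₂⟩ := _root_.exists_matrixEnergy_le hK hc hV
  refine ⟨β * (C₁ + C₂) + C₁ + 4, fun n _ => ?_⟩
  have hn : (1 : ℝ) ≤ n := Nat.one_le_cast.mpr (NeZero.pos n)
  have hn0 : (0 : ℝ) < n := by linarith
  have hlog := Real.log_nonneg hn
  obtain ⟨a, b, hb, hE, hE', hsq⟩ := h₁ n
  obtain ⟨u, w, hQ⟩ := h₂ n a b hb hE
  set Q := Set.Icc u (fun i => u i + 2 * (n : ℝ)⁻¹) ×ˢ Set.Icc w (fun k => w k + (n : ℝ)⁻¹)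
  have hQm : MeasurableSet Q := measurableSet_Icc.prod measurableSet_Icc
  set H := β * (n ^ 2 * energy V ν + C₁ * n * (1 + Real.log n) + C₂ * n) + (C₁ + 2) * n with hH
  have hden : ∀ p ∈ Q, n * β * betaHamiltonian V β n p.1 p.2 ≤ H := fun p hp => by
    obtain ⟨hp1, hp2⟩ := hQ p hp
    rw [mul_betaHamiltonian V hβ.ne']
    have h1 : ∑ k, Real.log (p.2 k) ≤ ∑ k, (b k ^ 2 + 2) := Finset.sum_le_sum fun k _ => by
      have := Real.log_le_sub_one_of_pos (hp1 k).1
      have := (hp1 k).2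
      nlinarith [sq_nonneg (b k - 1)]
    have h2 : ∑ k : Fin (n - 1), (b k ^ 2 + 2) ≤ (C₁ + 2) * n := by
      rw [Finset.sum_add_distrib, Finset.sum_const, Finset.card_univ, Fintype.card_fin,
        nsmul_eq_mul]
      have : ((n - 1 : ℕ) : ℝ) ≤ n := Nat.cast_le.mpr (Nat.sub_le n 1)
      linarith
    have h3 := mul_le_mul_of_nonneg_left (hp2.trans (add_le_add_left hE' (C₂ * n))) hβ.le
    linarith
  have hvol : ENNReal.ofReal (Real.exp (-(2 * n * Real.log n))) ≤ volume Q := by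
    refine le_trans (ENNReal.ofReal_le_ofReal ?_) (volume_prod_Icc_ge (inv_pos.mpr hn0).le u w)
    rw [← Real.log_le_log_iff (Real.exp_pos _) (by positivity), Real.log_exp, Real.log_pow,
      Real.log_inv, mul_neg, neg_le_neg_iff]
    refine mul_le_mul_of_nonneg_right ?_ hlog
    exact_mod_cast (by omega : n + (n - 1) ≤ 2 * n)
  rw [unnormalizedTridiagonalLaw, withDensity_apply', Measure.restrict_univ]
  calc _ ≤ ENNReal.ofReal (Real.exp (-H)) * ENNReal.ofReal (Real.exp (-(2 * n * Real.log n))) := by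
        rw [← ENNReal.ofReal_mul (Real.exp_pos _).le, ← Real.exp_add]
        refine ENNReal.ofReal_le_ofReal (Real.exp_le_exp.mpr ?_)
        have h1 : 0 ≤ n * Real.log n := by positivity
        have h2 : 0 ≤ β * C₂ * (n * Real.log n) := by positivity
        have h3 : 0 ≤ C₁ * (n * Real.log n) := by positivity
        rw [hH]
        linarith
    _ ≤ ENNReal.ofReal (Real.exp (-H)) * volume Q := by gcongr
    _ = ∫⁻ _ in Q, ENNReal.ofReal (Real.exp (-H)) := (setLIntegral_const _ _).symm
    _ ≤ ∫⁻ p in Q, ENNReal.ofReal (Real.exp (-(n * β * betaHamiltonian V β n p.1 p.2))) :=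
        setLIntegral_mono' hQm fun p hp => ENNReal.ofReal_le_ofReal
          (Real.exp_le_exp.mpr (neg_le_neg (hden p hp)))
    _ ≤ _ := lintegral_mono_set fun p hp k => ((hQ p hp).1 k).1

end LowerBound

/-! ## Convergence of the beta ensemble -/

section BetaEnsemble

variable {V : ℝ[X]} {c γ K β : ℝ}

theorem unnormalizedTridiagonalLaw_zero (V : ℝ[X]) (β : ℝ) :
    unnormalizedTridiagonalLaw V β 0 Set.univ = 1 := by
  have h : {p : (Fin 0 → ℝ) × (Fin (0 - 1) → ℝ) | ∀ k, 0 < p.2 k} = Set.univ ×ˢ Set.univ := by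
    ext p
    simp
  rw [unnormalizedTridiagonalLaw, withDensity_apply', Measure.restrict_univ, h]
  simp only [Nat.cast_zero, zero_mul, neg_zero, Real.exp_zero, ENNReal.ofReal_one,
    setLIntegral_one, Measure.volume_eq_prod, Measure.prod_prod]
  simp [volume_pi]

theorem IsEquilibriumMeasure.isProbabilityMeasure_tridiagonalLaw {μ : ProbabilityMeasure ℝ}
    (h : IsEquilibriumMeasure V μ) (hK : PotentialBounds V γ K) (hc : 0 < c)
    (hV : ∀ x : ℝ, c ≤ V.derivative.derivative.eval x) (hβ : 0 < β) (n : ℕ) :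
    IsProbabilityMeasure (tridiagonalLaw V β n) := by
  suffices hZ : unnormalizedTridiagonalLaw V β n Set.univ ≠ 0 ∧
      unnormalizedTridiagonalLaw V β n Set.univ ≠ ∞ from
    ⟨by rw [tridiagonalLaw, Measure.smul_apply, smul_eq_mul, ENNReal.inv_mul_cancel hZ.1 hZ.2]⟩
  rcases Nat.eq_zero_or_pos n with rfl | hn
  · rw [unnormalizedTridiagonalLaw_zero]
    simp
  have : NeZero n := ⟨hn.ne'⟩
  obtain ⟨C₁, -, h₁⟩ := hK.exists_unnormalizedTridiagonalLaw_le hβ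
  obtain ⟨C₂, h₂⟩ := h.1.exists_le_unnormalizedTridiagonalLaw hK hc hV hβ
  refine ⟨fun h0 => ?_, ((h₁ n (-(K * n ^ 2)) Set.univ fun p _ hp => ?_).trans_lt
    ENNReal.ofReal_lt_top).ne⟩
  · have := h₂ n
    rw [h0, nonpos_iff_eq_zero, ENNReal.ofReal_eq_zero] at this
    exact absurd (Real.exp_pos _) (not_lt.mpr this)
  · exact (hK.neg_le_discreteEnergy _).trans (discreteEnergy_eigenvalues_le V hp).2

theorem IsEquilibriumMeasure.eventually_tridiagonalLaw_le {μ : ProbabilityMeasure ℝ}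
    (h : IsEquilibriumMeasure V μ) (hK : PotentialBounds V γ K) (hc : 0 < c)
    (hV : ∀ x : ℝ, c ≤ V.derivative.derivative.eval x) (hβ : 0 < β)
    {U : Set (ProbabilityMeasure ℝ)} (hU : U ∈ 𝓝 μ) :
    ∀ᶠ m : ℕ in atTop, tridiagonalLaw V β (m + 1)
      {p | eigenvalueDistribution (m + 1) p.1 p.2 ∉ U} ≤ ENNReal.ofReal (Real.exp (-m)) := by
  obtain ⟨C₁, hC₁, h₁⟩ := hK.exists_unnormalizedTridiagonalLaw_le hβ
  obtain ⟨C₂, h₂⟩ := h.1.exists_le_unnormalizedTridiagonalLaw hK hc hV hβ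
  obtain ⟨η, hη, N, hN⟩ := h.exists_lt_discreteEnergy hK hc hV hU
  set e := energy V μ
  set A := β * (e + η) + β * K + 2 * Real.log C₁ + C₂ + 1
  have hlog : ∀ᶠ m : ℕ in atTop, A + (2 + C₂) * Real.log ((m + 1 : ℕ) : ℝ) ≤
      β * η * ((m + 1 : ℕ) : ℝ) := by
    have h3 := ((Asymptotics.isLittleO_const_id_atTop A).add
      (Real.isLittleO_log_id_atTop.const_mul_left (2 + C₂))).def (mul_pos hβ hη)
    have h4 : Tendsto (fun m : ℕ => ((m + 1 : ℕ) : ℝ)) atTop atTop :=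
      tendsto_natCast_atTop_atTop.comp (tendsto_add_atTop_nat 1)
    filter_upwards [h4.eventually h3] with m hm
    refine (le_abs_self _).trans (hm.trans (le_of_eq ?_))
    rw [id, Real.norm_of_nonneg (Nat.cast_nonneg _)]
  filter_upwards [hlog, eventually_ge_atTop N] with m hm hmN
  have h3 := h₁ (m + 1) (((m + 1 : ℕ) : ℝ) ^ 2 * (e + η))
    {p | eigenvalueDistribution (m + 1) p.1 p.2 ∉ U} fun p hp hpos =>
      have hx := discreteEnergy_eigenvalues_le V hpos
      (hN m hmN _ hx.1 hp).trans hx.2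
  have h4 := h₂ (m + 1)
  rw [tridiagonalLaw, Measure.smul_apply, smul_eq_mul]
  refine (mul_le_mul' (ENNReal.inv_le_inv.mpr h4) h3).trans ?_
  have hn : (1 : ℝ) ≤ ((m + 1 : ℕ) : ℝ) := Nat.one_le_cast.mpr (Nat.succ_pos m)
  have hmn : (m : ℝ) = ((m + 1 : ℕ) : ℝ) - 1 := by push_cast; ring
  have hpow : (C₁ * ((m + 1 : ℕ) : ℝ)) ^ (2 * (m + 1)) =
      Real.exp (2 * ((m + 1 : ℕ) : ℝ) * (Real.log C₁ + Real.log ((m + 1 : ℕ) : ℝ))) := by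
    rw [← Real.log_mul (by linarith) (by linarith), ← Real.exp_log (pow_pos (by positivity) _),
      Real.log_pow]
    push_cast
    rfl
  rw [hpow, ← ENNReal.ofReal_inv_of_pos (Real.exp_pos _), ← Real.exp_neg,
    ← ENNReal.ofReal_mul (Real.exp_pos _).le, ← Real.exp_add, ← Real.exp_add, hmn]
  generalize ((m + 1 : ℕ) : ℝ) = n at *
  refine ENNReal.ofReal_le_ofReal (Real.exp_le_exp.mpr ?_)
  have h5 := mul_le_mul_of_nonneg_left hm (zero_le_one.trans hn)
  have h6 : β * (1 - 1 / n) * (n ^ 2 * (e + η)) = β * (n ^ 2 - n) * (e + η) := by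
    have : n ≠ 0 := by linarith
    field_simp
  rw [h6]
  simp only [A] at h5
  linarith

theorem IsEquilibriumMeasure.ae_tendsto_eigenvalueDistribution {μ : ProbabilityMeasure ℝ}
    (h : IsEquilibriumMeasure V μ) (hK : PotentialBounds V γ K) (hc : 0 < c)
    (hV : ∀ x : ℝ, c ≤ V.derivative.derivative.eval x) (hβ : 0 < β)
    {Ω : Type*} [MeasurableSpace Ω] {P : Measure Ω}
    {A : ∀ n : ℕ, Ω → Fin n → ℝ} {B : ∀ n : ℕ, Ω → Fin (n - 1) → ℝ}
    (hX : ∀ n : ℕ, HasLaw (fun ω => (A n ω, B n ω)) (tridiagonalLaw V β n) P) :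
    ∀ᵐ ω ∂P, Tendsto (fun n : ℕ => eigenvalueDistribution (n + 1) (A (n + 1) ω) (B (n + 1) ω))
      atTop (𝓝 μ) := by
  obtain ⟨U, hU⟩ := (𝓝 μ).exists_antitone_basis
  simp only [hU.1.tendsto_right_iff, true_imp_iff]
  rw [ae_all_iff]
  intro i
  obtain ⟨N, hN⟩ := eventually_atTop.mp
    (h.eventually_tridiagonalLaw_le hK hc hV hβ (hU.1.mem_of_mem (i := i) trivial))
  have hsum : ∑' m : ℕ, P {ω | eigenvalueDistribution (m + N + 1) (A (m + N + 1) ω)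
      (B (m + N + 1) ω) ∉ U i} ≠ ∞ := by
    refine ne_top_of_le_ne_top Real.summable_exp_neg_nat.tsum_ofReal_ne_top
      (ENNReal.tsum_le_tsum fun m => ?_)
    refine ((hX (m + N + 1)).map_eq ▸ Measure.le_map_apply (hX (m + N + 1)).aemeasurable
      {p | eigenvalueDistribution (m + N + 1) p.1 p.2 ∉ U i} : _ ≤ _).trans
      ((hN (m + N) (Nat.le_add_left N m)).trans (ENNReal.ofReal_le_ofReal (Real.exp_le_exp.mpr ?_)))
    push_cast
    linarith [(Nat.cast_nonneg N : (0 : ℝ) ≤ N)]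
  filter_upwards [ae_eventually_notMem hsum] with ω hω
  rw [← map_add_atTop_eq_nat N, eventually_map]
  filter_upwards [hω] with m hm
  exact not_not.mp hm

end BetaEnsemble

theorem corollaryc (V : ℝ[X]) (c : ℝ) (hc : 0 < c)
    (hV : ∀ x : ℝ, c ≤ V.derivative.derivative.eval x) :
    (∃! ab : (ℕ → ℝ) × (ℕ → ℝ), IsHalfLineMinimizer V ab.1 ab.2) ∧
    ∀ a b : ℕ → ℝ, IsHalfLineMinimizer V a b →
      ∃ J : ℓ²(ℕ, ℝ) →L[ℝ] ℓ²(ℕ, ℝ), IsJacobiOperator a b J ∧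
      ∃ μ : ProbabilityMeasure ℝ,
        (∀ ν : ProbabilityMeasure ℝ, IsSpectralMeasure J ν ↔ ν = μ) ∧
        (∀ β : ℝ, 0 < β →
          (∀ n : ℕ, IsProbabilityMeasure (tridiagonalLaw V β n)) ∧
          ∀ (Ω : Type*) [MeasurableSpace Ω] (P : Measure Ω) [IsProbabilityMeasure P]
            (A : ∀ n : ℕ, Ω → Fin n → ℝ) (B : ∀ n : ℕ, Ω → Fin (n - 1) → ℝ),
            (∀ n : ℕ, HasLaw (fun ω => (A n ω, B n ω)) (tridiagonalLaw V β n) P) →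
            ∀ᵐ ω ∂P, Tendsto
              (fun n : ℕ => eigenvalueDistribution (n + 1) (A (n + 1) ω) (B (n + 1) ω))
              atTop (𝓝 μ)) ∧
        ((∀ n : ℕ, ∃ x : Fin n → ℝ, IsFekete V x) ∧
          ∀ x : (∀ n : ℕ, Fin n → ℝ), (∀ n : ℕ, IsFekete V (x n)) →
            Tendsto (fun n : ℕ => empiricalDistribution (x (n + 1))) atTop (𝓝 μ)) ∧
        ∀ ν : ProbabilityMeasure ℝ, IsEquilibriumMeasure V ν ↔ ν = μ := by
  obtain ⟨γ, K, hK⟩ := exists_potentialBounds hc hV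
  obtain ⟨μ, hμ⟩ := hK.exists_isEquilibriumMeasure
  have := hμ.1.nullSingletonClass
  obtain ⟨R, hR⟩ := hμ.exists_abs_le hK
  have hmin := hμ.isHalfLineMinimizer hK hc hV hR
  refine ⟨⟨(_, _), hmin, fun ab h => Prod.ext_iff.mpr (h.unique hc hV hmin)⟩, fun a b h => ?_⟩
  obtain ⟨rfl, rfl⟩ := h.unique hc hV hmin
  obtain ⟨C, hC⟩ := h.bounded
  obtain ⟨J, hJ⟩ := exists_isJacobiOperator (fun k => (hC k).1)
    fun k => (abs_of_pos (h.pos k)).trans_le (hC k).2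
  have hmom := integral_pow_eq_inner hR hJ
  refine ⟨J, hJ, μ, fun ν => ⟨fun hν => Subtype.ext (eq_of_integral_pow_eq (ν := (ν : Measure ℝ)) hR
      (fun m => (hν m).1) fun m => (hν m).2.trans (hmom m).symm), ?_⟩,
    fun β hβ => ⟨hμ.isProbabilityMeasure_tridiagonalLaw hK hc hV hβ,
      fun Ω _ P _ A B hX => hμ.ae_tendsto_eigenvalueDistribution hK hc hV hβ hX⟩,
    ⟨hK.exists_isFekete, fun x hx => hμ.tendsto_fekete hK hc hV hx⟩,
    fun ν => ⟨fun hν => hν.unique hK hc hV hμ, fun e => e ▸ hμ⟩⟩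
  rintro rfl
  exact fun m => ⟨integrable_of_continuous_of_support hR (by fun_prop), hmom m⟩
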